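/- Let $\beta>0$, $\mu\in\mathbb R$, and let $W:\mathbb R\to\mathbb R$ be a bounded, $1$-periodic function with $\int_0^1 W\,dx=0$. For $h>0$ and a $1$-periodic function $\psi\in H^2_{\rm loc}(\mathbb R)$ (complex-valued) put $\Delta=-h\psi$ and let $$H_\Delta=\begin{pmatrix} -h^2\nabla^2-\mu+h^2W & \Delta\\ \overline{\Delta} & h^2\nabla^2+\mu-h^2W\end{pmatrix}$$ be the self-adjoint operator on $L^2(\mathbb R)\oplus L^2(\mathbb R)$ with domain $H^2(\mathbb R)\oplus H^2(\mathbb R)$. Let $\rho(z)=(1+e^z)^{-1}$, $g_0(z)=\tanh(z/2)/z$ (with $g_0(0)=1/2$), and $k_0=-h^2\nabla^2-\mu$; operators of the form $\rho(\beta H_\Delta)$ and $g_0(\beta k_0)$ are defined by the spectral calculus. For a bounded operator $\eta$ on $L^2(\mathbb R)$ that is periodic (commutes with translation by $1$) let $\|\eta\|_{H^1}^2=\operatorname{Tr}[\eta^*(1-h^2\nabla^2)\eta]$, where $\operatorname{Tr}$ is the trace per unit volume, i.e. $\operatorname{Tr} B$ is the usual trace of $\chi B\chi$, with $\chi$ the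 characteristic function of $[0,1]$. Write $\|\psi\|_{H^1}^2=\int_0^1(|\psi|^2+|\psi'|^2)\,dx$ and $\|\psi\|_{H^2}^2=\int_0^1(|\psi|^2+|\psi'|^2+|\psi''|^2)\,dx$. Then there are constants $C,h_0>0$, depending only on $\beta,\mu,W$, such that for all $0<h<h_0$ and all $1$-periodic $\psi\in H^2_{\rm loc}(\mathbb R)$ the upper off-diagonal entry of $\rho(\beta H_\Delta)$ can be written as $$[\rho(\beta H_\Delta)]_{12}=\frac{\beta h}{4}\bigl(\psi\,g_0(\beta k_0)+g_0(\beta k_0)\,\psi\bigr)+\eta_1+\eta_2$$ with bounded periodic operators $\eta_1,\eta_2$ satisfying $$\|\eta_1\|_{H^1}^2\le C h^5\|\psi\|_{H^2}^2,\qquad \|\eta_2\|_{H^1}^2\le C h^5\bigl(\|\psi\|_{H^1}^2+\|\psi\|_{H^1}^6\bigr).$$ -/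

import Mathlib

open MeasureTheory
open scoped ENNReal ContDiff FourierTransform

noncomputable section

namespace BCS

/-! ### Operators on `L²(ℝ)` -/

/-- The Hilbert space `L²(ℝ) = L²(ℝ; ℂ)`. -/
abbrev L2 : Type := Lp ℂ 2 (volume : Measure ℝ)

/-- The Hilbert space `L²(ℝ) ⊕ L²(ℝ)`. -/
abbrev L2Sum : Type := WithLp 2 (L2 × L2)

open Classical in
/-- The bounded operator on `L²(ℝ)` of multiplication by an essentially bounded function `f`
(zero by convention if `f` is not essentially bounded). -/
def mulOp (f : ℝ → ℂ) : L2 →L[ℂ] L2 :=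
  if hf : MemLp f ∞ volume then
    (ContinuousLinearMap.mul ℂ ℂ).holderL volume ∞ 2 2 (hf.toLp f)
  else 0

theorem mulOp_coeFn {f : ℝ → ℂ} (hf : MemLp f ∞ volume) (u : L2) :
    (mulOp f u : ℝ → ℂ) =ᵐ[volume] fun x => f x * u x := by
  rw [mulOp, dif_pos hf]
  refine ((ContinuousLinearMap.mul ℂ ℂ).coeFn_holder (r := 2) (hf.toLp f) u).trans ?_
  filter_upwards [hf.coeFn_toLp] with x hx
  simp [hx]

/-- The bounded function `m(-i∇)` of the momentum `-i∇`. With the normalization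
`𝓕 u ξ = ∫ e^{-2πixξ} u(x) dx` the operator `-i∇` is multiplication by `2πξ` in Fourier space. -/
def momentumOp (m : ℝ → ℂ) : L2 →L[ℂ] L2 :=
  ((Lp.fourierTransformₗᵢ ℝ ℂ).symm.toContinuousLinearEquiv : L2 →L[ℂ] L2) ∘L
    mulOp (fun ξ => m (2 * Real.pi * ξ)) ∘L
    ((Lp.fourierTransformₗᵢ ℝ ℂ).toContinuousLinearEquiv : L2 →L[ℂ] L2)

/-- The self-adjoint operator `-∇²` on `L²(ℝ)`, with domain
`H²(ℝ) = {u ∈ L²(ℝ) : (2πξ)² 𝓕u(ξ) ∈ L²(ℝ)}`. -/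
def negLaplacian : L2 →ₗ.[ℂ] L2 where
  domain :=
    { carrier := {u | MemLp (fun ξ : ℝ => ((2 * Real.pi * ξ : ℝ) : ℂ) ^ 2 * (𝓕 u : L2) ξ) 2 volume}
      zero_mem' := by
        have h : (fun ξ : ℝ => ((2 * Real.pi * ξ : ℝ) : ℂ) ^ 2 * (𝓕 (0 : L2) : L2) ξ)
            =ᵐ[volume] fun _ => 0 := by
          have h0 : (𝓕 (0 : L2) : L2) = 0 := (Lp.fourierTransformₗᵢ ℝ ℂ).map_zero
          rw [h0]
          filter_upwards [Lp.coeFn_zero ℂ 2 (volume : Measure ℝ)] with ξ hξ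
          simp
        exact (memLp_congr_ae h).2 MemLp.zero'
      add_mem' := by
        intro u v hu hv
        have h : (fun ξ : ℝ => ((2 * Real.pi * ξ : ℝ) : ℂ) ^ 2 * (𝓕 (u + v) : L2) ξ)
            =ᵐ[volume] (fun ξ : ℝ => ((2 * Real.pi * ξ : ℝ) : ℂ) ^ 2 * (𝓕 u : L2) ξ) +
              fun ξ : ℝ => ((2 * Real.pi * ξ : ℝ) : ℂ) ^ 2 * (𝓕 v : L2) ξ := by
          have h0 : (𝓕 (u + v) : L2) = 𝓕 u + 𝓕 v := (Lp.fourierTransformₗᵢ ℝ ℂ).map_add u v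
          rw [h0]
          filter_upwards [Lp.coeFn_add (𝓕 u : L2) (𝓕 v : L2)] with ξ hξ
          simp only [hξ, Pi.add_apply]
          ring
        exact (memLp_congr_ae h).2 (MemLp.add hu hv)
      smul_mem' := by
        intro c u hu
        have h : (fun ξ : ℝ => ((2 * Real.pi * ξ : ℝ) : ℂ) ^ 2 * (𝓕 (c • u) : L2) ξ)
            =ᵐ[volume] c • fun ξ : ℝ => ((2 * Real.pi * ξ : ℝ) : ℂ) ^ 2 * (𝓕 u : L2) ξ := by
          have h0 : (𝓕 (c • u) : L2) = c • 𝓕 u := (Lp.fourierTransformₗᵢ ℝ ℂ).map_smul c u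
          rw [h0]
          filter_upwards [Lp.coeFn_smul c (𝓕 u : L2)] with ξ hξ
          simp only [hξ, Pi.smul_apply, smul_eq_mul]
          ring
        exact (memLp_congr_ae h).2 (MemLp.const_smul hu c) }
  toFun :=
    { toFun := fun u => (𝓕⁻ (MemLp.toLp _ u.2 : L2) : L2)
      map_add' := by
        intro u v
        have h0 : (𝓕 ((u : L2) + v) : L2) = 𝓕 (u : L2) + 𝓕 (v : L2) :=
          (Lp.fourierTransformₗᵢ ℝ ℂ).map_add _ _
        refine Eq.trans (congrArg (Lp.fourierTransformₗᵢ ℝ ℂ).symm ?_)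
          ((Lp.fourierTransformₗᵢ ℝ ℂ).symm.map_add _ _)
        rw [← MemLp.toLp_add]
        refine MemLp.toLp_congr _ _ ?_
        simp only [Submodule.coe_add, h0]
        filter_upwards [Lp.coeFn_add (𝓕 (u : L2) : L2) (𝓕 (v : L2) : L2)] with ξ hξ
        simp only [hξ, Pi.add_apply]
        ring
      map_smul' := by
        intro c u
        have h0 : (𝓕 (c • (u : L2)) : L2) = c • 𝓕 (u : L2) :=
          (Lp.fourierTransformₗᵢ ℝ ℂ).map_smul _ _
        refine Eq.trans (congrArg (Lp.fourierTransformₗᵢ ℝ ℂ).symm ?_)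
          ((Lp.fourierTransformₗᵢ ℝ ℂ).symm.map_smul c _)
        rw [← MemLp.toLp_const_smul]
        refine MemLp.toLp_congr _ _ ?_
        simp only [Submodule.coe_smul, h0]
        filter_upwards [Lp.coeFn_smul c (𝓕 (u : L2) : L2)] with ξ hξ
        simp only [hξ, Pi.smul_apply, smul_eq_mul]
        ring }

/-- The one-particle operator `k = -h²∇² - μ + h² W(x)` with domain `H²(ℝ)`. -/
def kOp (h μ : ℝ) (W : ℝ → ℝ) : negLaplacian.domain →ₗ[ℂ] L2 :=
  ((h ^ 2 : ℝ) : ℂ) • negLaplacian.toFun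
    + (-(μ : ℂ) • LinearMap.id + ((h ^ 2 : ℝ) : ℂ) • (mulOp fun x => (W x : ℂ)).toLinearMap) ∘ₗ
      negLaplacian.domain.subtype

/-- The operator `H_Δ = (k, Δ; conj Δ, -k)` on `L²(ℝ) ⊕ L²(ℝ)`, with domain `H²(ℝ) ⊕ H²(ℝ)`. -/
def HΔ (h μ : ℝ) (W : ℝ → ℝ) (Δ : ℝ → ℂ) : L2Sum →ₗ.[ℂ] L2Sum where
  domain :=
    { carrier := {x | x.fst ∈ negLaplacian.domain ∧ x.snd ∈ negLaplacian.domain}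
      zero_mem' := ⟨Submodule.zero_mem _, Submodule.zero_mem _⟩
      add_mem' := fun hx hy => ⟨Submodule.add_mem _ hx.1 hy.1, Submodule.add_mem _ hx.2 hy.2⟩
      smul_mem' := fun c _ hx => ⟨Submodule.smul_mem _ c hx.1, Submodule.smul_mem _ c hx.2⟩ }
  toFun :=
    { toFun := fun x => WithLp.toLp 2
        (kOp h μ W ⟨x.1.fst, x.2.1⟩ + mulOp Δ x.1.snd,
          mulOp (fun y => star (Δ y)) x.1.fst - kOp h μ W ⟨x.1.snd, x.2.2⟩)
      map_add' := by
        intro x y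
        have h1 : kOp h μ W ⟨(x + y).1.fst, (x + y).2.1⟩ =
            kOp h μ W ⟨x.1.fst, x.2.1⟩ + kOp h μ W ⟨y.1.fst, y.2.1⟩ :=
          (kOp h μ W).map_add ⟨x.1.fst, x.2.1⟩ ⟨y.1.fst, y.2.1⟩
        have h2 : kOp h μ W ⟨(x + y).1.snd, (x + y).2.2⟩ =
            kOp h μ W ⟨x.1.snd, x.2.2⟩ + kOp h μ W ⟨y.1.snd, y.2.2⟩ :=
          (kOp h μ W).map_add ⟨x.1.snd, x.2.2⟩ ⟨y.1.snd, y.2.2⟩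
        rw [h1, h2, ← WithLp.toLp_add]
        simp only [Submodule.coe_add, WithLp.add_fst, WithLp.add_snd, map_add, Prod.mk_add_mk]
        congr 2 <;> abel
      map_smul' := by
        intro c x
        have h1 : kOp h μ W ⟨(c • x).1.fst, (c • x).2.1⟩ = c • kOp h μ W ⟨x.1.fst, x.2.1⟩ :=
          (kOp h μ W).map_smul c ⟨x.1.fst, x.2.1⟩
        have h2 : kOp h μ W ⟨(c • x).1.snd, (c • x).2.2⟩ = c • kOp h μ W ⟨x.1.snd, x.2.2⟩ :=
          (kOp h μ W).map_smul c ⟨x.1.snd, x.2.2⟩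
        rw [h1, h2, RingHom.id_apply, ← WithLp.toLp_smul]
        simp only [Submodule.coe_smul, WithLp.smul_fst, WithLp.smul_snd, map_smul, Prod.smul_mk,
          smul_add, smul_sub] }

/-- The entry `[B]₁₂` of an operator `B` on `L²(ℝ) ⊕ L²(ℝ)`. -/
def entry12 (B : L2Sum →L[ℂ] L2Sum) : L2 →L[ℂ] L2 :=
  WithLp.fstL 2 ℂ L2 L2 ∘L B ∘L
    ((WithLp.prodContinuousLinearEquiv 2 ℂ L2 L2).symm : L2 × L2 →L[ℂ] L2Sum) ∘L
    ContinuousLinearMap.inr ℂ L2 L2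

/-! ### Functions of an unbounded self-adjoint operator -/

section Spectral

variable {E : Type*} [NormedAddCommGroup E] [InnerProductSpace ℂ E]

/-- `ν` is the spectral measure of the self-adjoint operator `A` at the vector `v`: the finite
measure with `⟨v, (A - z)⁻¹ v⟩ = ∫ (t - z)⁻¹ dν(t)` for all nonreal `z`, that is,
`dν(t) = d⟨v, 1_{(-∞,t]}(A) v⟩`. -/
def IsSpectralMeasure (A : E →ₗ.[ℂ] E) (v : E) (ν : Measure ℝ) : Prop :=
  IsFiniteMeasure ν ∧ ∀ z : ℂ, z.im ≠ 0 →
    ∃ u : A.domain, A u - z • (u : E) = v ∧ inner ℂ v (u : E) = ∫ t : ℝ, ((t : ℂ) - z)⁻¹ ∂ν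

/-- `A` is self-adjoint and `B` is the bounded operator `f(A)` of the spectral functional calculus,
for a bounded continuous `f : ℝ → ℝ`: one has `⟨v, f(A) v⟩ = ∫ f dν_v` for every `v`, where `ν_v` is
the spectral measure of `A` at `v`. -/
def IsFunctionOf [CompleteSpace E] (A : E →ₗ.[ℂ] E) (f : ℝ → ℝ) (B : E →L[ℂ] E) : Prop :=
  IsSelfAdjoint A ∧
    ∀ v : E, ∃ ν : Measure ℝ, IsSpectralMeasure A v ν ∧ inner ℂ v (B v) = ((∫ t, f t ∂ν : ℝ) : ℂ)

end Spectral

/-! ### Periodic operators, trace per unit volume -/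

/-- Translation by one, `(τ u)(x) = u(x + 1)`. -/
def translation : L2 →L[ℂ] L2 :=
  (Lp.compMeasurePreservingₗᵢ ℂ (fun x : ℝ => x + 1)
    (measurePreserving_add_right volume (1 : ℝ))).toContinuousLinearMap

/-- A periodic operator: it commutes with translation by one. -/
def IsPeriodicOp (η : L2 →L[ℂ] L2) : Prop := ∀ u, η (translation u) = translation (η u)

/-- The quadratic form `⟨u, (1 - h²∇²) u⟩ ∈ [0, ∞]`, equal to `∞` if `u ∉ H¹(ℝ)`. -/
def h1Form (h : ℝ) (u : L2) : ℝ≥0∞ :=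
  ∫⁻ ξ : ℝ, ENNReal.ofReal (1 + h ^ 2 * (2 * Real.pi * ξ) ^ 2) * ‖(𝓕 u : L2) ξ‖ₑ ^ 2

/-- The square of the `H¹` norm of a periodic operator, `‖η‖²_{H¹} = Tr[η* (1 - h²∇²) η] ∈ [0, ∞]`,
where `Tr` is the trace per unit volume. Thus it is the usual trace of the nonnegative operator
`χ η* (1 - h²∇²) η χ`, with `χ` the characteristic function of `[0, 1]`, and the trace of a
nonnegative operator `T` is the supremum of `∑ ⟨eᵢ, T eᵢ⟩` over finite orthonormal families. -/
def h1NormSq (h : ℝ) (η : L2 →L[ℂ] L2) : ℝ≥0∞ :=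
  ⨆ (n : ℕ) (e : Fin n → L2) (_ : Orthonormal ℂ e),
    ∑ i, h1Form h (η (mulOp ((Set.Icc (0 : ℝ) 1).indicator 1) (e i)))

/-! ### Periodic functions in `H²_loc` -/

/-- `f` is locally square integrable. -/
def IsL2Loc (f : ℝ → ℂ) : Prop := ∀ K : Set ℝ, IsCompact K → MemLp f 2 (volume.restrict K)

/-- `g` is the weak derivative of `f` (for locally integrable `f` and `g`). -/
def IsWeakDeriv (f g : ℝ → ℂ) : Prop :=
  ∀ φ : ℝ → ℂ, ContDiff ℝ ∞ φ → HasCompactSupport φ →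
    ∫ x, f x * deriv φ x = -∫ x, g x * φ x

/-- `ψ` is a periodic function in `H²_loc(ℝ)`, with first and second weak derivatives `ψ'`, `ψ''`. -/
structure IsPeriodicH2 (ψ ψ' ψ'' : ℝ → ℂ) : Prop where
  periodic : Function.Periodic ψ 1
  l2loc : IsL2Loc ψ
  l2loc_deriv : IsL2Loc ψ'
  l2loc_deriv2 : IsL2Loc ψ''
  weak_deriv : IsWeakDeriv ψ ψ'
  weak_deriv2 : IsWeakDeriv ψ' ψ''

/-- The square of the `L²(𝒞)` norm on the unit interval `𝒞 = [0, 1]`. -/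
def cellNormSq (f : ℝ → ℂ) : ℝ := ∫ x in Set.Icc (0 : ℝ) 1, ‖f x‖ ^ 2

/-- The potential `W` is bounded, periodic with period one, with mean zero. -/
structure IsPotential (W : ℝ → ℝ) : Prop where
  aestronglyMeasurable : AEStronglyMeasurable W volume
  bounded : ∃ M : ℝ, ∀ x, |W x| ≤ M
  periodic : Function.Periodic W 1
  mean_zero : ∫ x in Set.Icc (0 : ℝ) 1, W x = 0

/-! ### The functions `ρ` and `g₀` -/

/-- `ρ(z) = (1 + e^z)⁻¹`. -/
def rho (z : ℝ) : ℝ := (1 + Real.exp z)⁻¹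

/-- `g₀(z) = tanh(z/2)/z`, continuously extended to `z = 0`. -/
def g0 (z : ℝ) : ℝ := if z = 0 then 1 / 2 else Real.tanh (z / 2) / z

/-- The operator `g₀(β k₀)`, where `k₀ = -h²∇² - μ`. -/
def g0Op (β h μ : ℝ) : L2 →L[ℂ] L2 :=
  momentumOp fun p => (g0 (β * (h ^ 2 * p ^ 2 - μ)) : ℂ)

end BCS

end

/-!
The operator `ρ(βH_Δ)` is expanded over the Matsubara frequencies `ω_n = (2n + 1)π/β`:
`ρ(βH) = 1/2 - β⁻¹ ∑_n ((H - iω_n)⁻¹ + (H + iω_n)⁻¹)`, as a weak limit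
(`IsSymmetricSurjective.exists_fermi`). This needs only the resolvents of `H`, the scalar expansion
of `tanh` (`hasSum_half_sub_rho`), and spectral measures, which come from the continuous functional
calculus of the normal operator `(H - i)⁻¹`. Self-adjointness of `H_Δ` follows from that of the free
operator, which is a multiplication operator in momentum space, by bounded perturbation.

Write `r = (k₀ - z)⁻¹`, `r' = (k₀ + z)⁻¹` with `z = ±iω_n`. The entries `b`, `d` of the second
column of `(H_Δ - z)⁻¹` satisfy `b = -r (h²W b + Δ d)` and `d = r' (conj Δ b - h²W d - 1)`, hence
`b = r Δ r' + r X` (`entry_expansion`), where every term of `X` has a factor `h²W` and one factor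
`Δ`, or three factors `Δ`. The sum of the terms `r X` over the frequencies is `η₂`. Its `H¹` norm is
estimated with Hilbert–Schmidt norms per unit volume: `r Δ` has square norm of order `h⁻¹ ‖Δ‖₂²`,
all the other factors are bounded in operator norm, `ψ` by the Sobolev inequality, and
`(1 + h∇) r` is bounded. Right factors are handled by cyclicity of the trace per unit volume
(`hsNormSq_comp_cell`).

The first order terms sum to `(h/β) ∑_n (r ψ r' + r' ψ r)`, whereas
`(βh/4) (ψ g₀(βk₀) + g₀(βk₀) ψ) = (h/β) ∑_n (ψ r r' + r r' ψ)` (`hasSum_g0`). The difference `η₁` is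
a sum of double commutators. On a plane wave `ψ = e^{2πilx}` it is multiplication by a symbol in
momentum space: with `a`, `b` the values of `k₀` at the momenta `p`, `p - 2πl`, the frequency `ω`
contributes `-(a - b)² / ((a² + ω²)(b² + ω²))`, which is of order `h² l²` and decays like
`(1 + h²p²)⁻¹` (`norm_sandwichSymbol_sub_le`). For fixed momentum the different plane waves are
represented by orthonormal vectors (`orthonormal_waveVec`), so the squares of the symbols sum to
`‖ψ''‖₂²` (`h1NormSq_firstOrderError_le`), and integration over momenta gives
`h² · h⁴ · h⁻¹ = h⁵`.
-/

namespace BCS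

/-! ### The Fourier transform on `L²(ℝ)` -/

theorem integral_mul_fourier (u : L2) {φ : ℝ → ℂ} (h : ContDiff ℝ ∞ φ)
    (hc : HasCompactSupport φ) :
    ∫ ξ, φ ξ * (𝓕 u : L2) ξ = ∫ x, 𝓕 φ x * u x := by
  have h1 := congrArg (fun T => T (hc.toSchwartzMap h)) (Lp.fourier_toTemperedDistribution_eq u)
  simp only [TemperedDistribution.fourier_apply, Lp.toTemperedDistribution_apply] at h1
  exact h1.symm

theorem locallyIntegrable_L2 (u : L2) : LocallyIntegrable u volume :=
  (Lp.memLp u).locallyIntegrable (by norm_num)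

/-- A locally integrable function `g` satisfying `∫ φ g = ∫ 𝓕φ u` for all test functions `φ` is
the Fourier transform of `u`. -/
theorem fourier_ae_eq_of_forall_integral {u : L2} {g : ℝ → ℂ} (hg : LocallyIntegrable g volume)
    (h : ∀ φ : ℝ → ℂ, ContDiff ℝ ∞ φ → HasCompactSupport φ →
      ∫ ξ, φ ξ * g ξ = ∫ x, 𝓕 φ x * u x) :
    ((𝓕 u : L2) : ℝ → ℂ) =ᵐ[volume] g := by
  refine ae_eq_of_integral_contDiff_smul_eq (locallyIntegrable_L2 _) hg fun φ hφ hc => ?_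
  have h1 : ContDiff ℝ ∞ (fun x => (φ x : ℂ)) := Complex.ofRealCLM.contDiff.comp hφ
  have h2 : HasCompactSupport (fun x => (φ x : ℂ)) := hc.comp_left Complex.ofReal_zero
  simpa only [Complex.real_smul] using (integral_mul_fourier u h1 h2).trans (h _ h1 h2).symm

theorem integrable_of_contDiff_hasCompactSupport {φ : ℝ → ℂ} (h : ContDiff ℝ ∞ φ)
    (hc : HasCompactSupport φ) : Integrable φ volume :=
  h.continuous.integrable_of_hasCompactSupport hc

/-- On integrable square-integrable functions, the `L²` Fourier transform is the usual integral. -/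
theorem fourier_ae_eq_integral {u : L2} (hu : Integrable u volume) :
    ((𝓕 u : L2) : ℝ → ℂ) =ᵐ[volume] 𝓕 (u : ℝ → ℂ) := by
  have hcont : Continuous (𝓕 (u : ℝ → ℂ)) :=
    VectorFourier.fourierIntegral_continuous Real.continuous_fourierChar
      (by exact continuous_inner) hu
  refine fourier_ae_eq_of_forall_integral hcont.locallyIntegrable fun φ h hc => ?_
  have := VectorFourier.integral_fourierIntegral_smul_eq_flip (L := innerₗ ℝ)
    Real.continuous_fourierChar continuous_inner (integrable_of_contDiff_hasCompactSupport h hc) hu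
  simp only [smul_eq_mul] at this
  refine Eq.trans ?_ this.symm
  simp only [flip_innerₗ]
  rfl

/-- The exponential `x ↦ e^{2πi a x}`. -/
noncomputable def cexpi (a : ℝ) (x : ℝ) : ℂ := Complex.exp (2 * Real.pi * a * x * Complex.I)

theorem norm_cexpi (a x : ℝ) : ‖cexpi a x‖ = 1 := by
  rw [cexpi, ← Complex.norm_exp_ofReal_mul_I (2 * Real.pi * a * x)]
  push_cast; rfl

theorem continuous_cexpi (a : ℝ) : Continuous (cexpi a) := by
  unfold cexpi; fun_prop

theorem contDiff_cexpi (a : ℝ) : ContDiff ℝ ∞ (cexpi a) := by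
  unfold cexpi
  exact (((contDiff_const.mul Complex.ofRealCLM.contDiff).mul contDiff_const)).cexp

theorem cexpi_add (a b x : ℝ) : cexpi (a + b) x = cexpi a x * cexpi b x := by
  unfold cexpi; rw [← Complex.exp_add]; push_cast; ring_nf

theorem cexpi_comm (a x : ℝ) : cexpi a x = cexpi x a := by
  unfold cexpi; ring_nf

theorem star_cexpi (a x : ℝ) : star (cexpi a x) = cexpi (-a) x := by
  unfold cexpi; rw [Complex.star_def, ← Complex.exp_conj]
  have : (starRingEnd ℂ) 2 = 2 := Complex.conj_ofNat 2
  simp [this]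

theorem memLp_cexpi (a : ℝ) : MemLp (cexpi a) ∞ volume :=
  memLp_top_of_bound (continuous_cexpi a).aestronglyMeasurable 1
    (.of_forall fun x => (norm_cexpi a x).le)

theorem fourier_apply_eq (f : ℝ → ℂ) (ξ : ℝ) : 𝓕 f ξ = ∫ x, cexpi (-ξ) x * f x := by
  rw [Real.fourier_real_eq_integral_exp_smul]
  refine integral_congr_ae (.of_forall fun x => ?_)
  simp only [smul_eq_mul, cexpi]
  push_cast; ring_nf

theorem translation_coeFn (u : L2) :
    (translation u : ℝ → ℂ) =ᵐ[volume] fun x => u (x + 1) :=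
  Lp.coeFn_compMeasurePreserving u (measurePreserving_add_right volume (1 : ℝ))

theorem locallyIntegrable_cexpi_mul (a : ℝ) (u : L2) :
    LocallyIntegrable (fun ξ => cexpi a ξ * u ξ) volume :=
  ((Lp.memLp u).mul (memLp_cexpi a) (r := 2)).locallyIntegrable (by norm_num)

theorem fourier_translation (u : L2) :
    ((𝓕 (translation u) : L2) : ℝ → ℂ) =ᵐ[volume] fun ξ => cexpi 1 ξ * (𝓕 u : L2) ξ := by
  refine fourier_ae_eq_of_forall_integral (locallyIntegrable_cexpi_mul _ _) fun φ h hc => ?_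
  have h1 := integral_mul_fourier u ((contDiff_cexpi 1).mul h) (hc.mul_left)
  have h2 : ∫ x, 𝓕 φ x * translation u x = ∫ x, 𝓕 φ x * u (x + 1) := by
    refine integral_congr_ae ?_
    filter_upwards [translation_coeFn u] with x hx
    rw [hx]
  rw [h2]
  rw [← integral_add_right_eq_self (fun x => _ * u x) 1] at h1
  refine Eq.trans (integral_congr_ae (.of_forall fun ξ => ?_)) (h1.trans ?_)
  · ring
  · refine integral_congr_ae (.of_forall fun x => ?_)
    simp only
    congr 1
    rw [fourier_apply_eq, fourier_apply_eq]
    refine integral_congr_ae (.of_forall fun y => ?_)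
    beta_reduce
    rw [← mul_assoc, ← cexpi_add]
    ring_nf

theorem coeFn_comp_sub_ae {f g : ℝ → ℂ} (h : f =ᵐ[volume] g) (l : ℝ) :
    (fun x => f (x - l)) =ᵐ[volume] fun x => g (x - l) :=
  (measurePreserving_sub_right volume l).quasiMeasurePreserving.ae_eq_comp h

/-- Modulation by `e^{2πilx}` translates the Fourier transform by `l`. -/
theorem fourier_modulation (l : ℝ) (u : L2) :
    ((𝓕 (mulOp (cexpi l) u) : L2) : ℝ → ℂ) =ᵐ[volume] fun ξ => (𝓕 u : L2) (ξ - l) := by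
  refine fourier_ae_eq_of_forall_integral ?_ fun φ h hc => ?_
  · exact ((Lp.memLp (𝓕 u : L2)).comp_measurePreserving
      (measurePreserving_sub_right volume l)).locallyIntegrable (by norm_num)
  have h1 := integral_mul_fourier u (φ := fun ξ => φ (ξ + l))
    (h.comp (contDiff_id.add contDiff_const)) (hc.comp_homeomorph (Homeomorph.addRight l))
  rw [← integral_sub_right_eq_self _ l] at h1
  simp only [sub_add_cancel] at h1
  rw [h1]
  refine integral_congr_ae ?_
  filter_upwards [mulOp_coeFn (memLp_cexpi l) u] with x hx
  rw [hx, ← mul_assoc]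
  congr 1
  rw [fourier_apply_eq, fourier_apply_eq,
    ← integral_add_right_eq_self (fun y => cexpi (-x) y * φ y) l,
    ← integral_mul_const]
  refine integral_congr_ae (.of_forall fun y => ?_)
  simp only
  rw [cexpi_comm (-x) (y + l), cexpi_add, cexpi_comm l x, cexpi_comm y (-x), cexpi_comm l (-x)]
  have : cexpi (-x) l * cexpi x l = 1 := by rw [← cexpi_add]; simp [cexpi]
  linear_combination (-(cexpi (-x) y) * φ (y + l)) * this

/-! ### Multiplication operators and functions of the momentum -/

theorem eq_of_fourier_ae_eq {u v : L2} (h : ((𝓕 u : L2) : ℝ → ℂ) =ᵐ[volume] (𝓕 v : L2)) : u = v :=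
  (Lp.fourierTransformₗᵢ ℝ ℂ).injective (Lp.ext h)

theorem enorm_sq_eq_lintegral (u : L2) : ‖u‖ₑ ^ 2 = ∫⁻ x, ‖u x‖ₑ ^ 2 := by
  have h := eLpNorm_nnreal_pow_eq_lintegral (f := (u : ℝ → ℂ)) (μ := volume) (p := 2) two_ne_zero
  rw [Lp.enorm_def]
  simpa using h

theorem enorm_fourier (u : L2) : ‖(𝓕 u : L2)‖ₑ = ‖u‖ₑ := by
  rw [← ofReal_norm, ← ofReal_norm, Lp.norm_fourier_eq]

theorem norm_le_of_ae_le {u v : L2} {C : ℝ} (h : ∀ᵐ x, ‖u x‖ ≤ C * ‖v x‖) :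
    ‖u‖ ≤ C * ‖v‖ :=
  Lp.norm_le_mul_norm_of_ae_le_mul h

theorem mulOp_norm_le {f : ℝ → ℂ} {C : ℝ} (hC : 0 ≤ C) (h : ∀ᵐ x, ‖f x‖ ≤ C) :
    ‖mulOp f‖ ≤ C := by
  by_cases hf : MemLp f ∞ volume
  · refine ContinuousLinearMap.opNorm_le_bound _ hC fun u => norm_le_of_ae_le ?_
    filter_upwards [mulOp_coeFn hf u, h] with x h1 h2
    rw [h1, norm_mul]
    gcongr
  · rw [mulOp, dif_neg hf, norm_zero]; exact hC

theorem eq_mulOp_apply {f : ℝ → ℂ} (hf : MemLp f ∞ volume) {u v : L2}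
    (h : (v : ℝ → ℂ) =ᵐ[volume] fun x => f x * u x) : v = mulOp f u :=
  Lp.ext (h.trans (mulOp_coeFn hf u).symm)

theorem mulOp_congr {f g : ℝ → ℂ} (h : f =ᵐ[volume] g) : mulOp f = mulOp g := by
  by_cases hf : MemLp f ∞ volume
  · have hg : MemLp g ∞ volume := (memLp_congr_ae h).1 hf
    ext1 u
    refine eq_mulOp_apply hg ?_
    filter_upwards [mulOp_coeFn hf u, h] with x h1 h2
    rw [h1, h2]
  · rw [mulOp, mulOp, dif_neg hf, dif_neg fun hg => hf ((memLp_congr_ae h).2 hg)]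

theorem mulOp_add {f g : ℝ → ℂ} (hf : MemLp f ∞ volume) (hg : MemLp g ∞ volume) :
    mulOp (fun x => f x + g x) = mulOp f + mulOp g := by
  have hfg : MemLp (fun x => f x + g x) ∞ volume := hf.add hg
  ext1 u
  symm
  refine eq_mulOp_apply hfg ?_
  filter_upwards [Lp.coeFn_add (mulOp f u) (mulOp g u), mulOp_coeFn hf u, mulOp_coeFn hg u]
    with x h0 h1 h2
  rw [add_apply, h0, Pi.add_apply, h1, h2, add_mul]

theorem mulOp_const_mul {f : ℝ → ℂ} (c : ℂ) (hf : MemLp f ∞ volume) :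
    mulOp (fun x => c * f x) = c • mulOp f := by
  have hfg : MemLp (fun x => c * f x) ∞ volume := hf.const_mul c
  ext1 u
  symm
  refine eq_mulOp_apply hfg ?_
  filter_upwards [Lp.coeFn_smul c (mulOp f u), mulOp_coeFn hf u] with x h0 h1
  rw [smul_apply, h0, Pi.smul_apply, h1, smul_eq_mul, mul_assoc]

theorem memLp_top_star {f : ℝ → ℂ} (hf : MemLp f ∞ volume) :
    MemLp (fun x => star (f x)) ∞ volume := hf.star

theorem inner_L2_eq (u v : L2) : inner ℂ u v = ∫ x, star (u x) * v x := by
  rw [L2.inner_def]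
  refine integral_congr_ae (.of_forall fun x => ?_)
  simp [RCLike.inner_apply, mul_comm]

theorem inner_mulOp_left {f : ℝ → ℂ} (hf : MemLp f ∞ volume) (u v : L2) :
    inner ℂ (mulOp f u) v = inner ℂ u (mulOp (fun x => star (f x)) v) := by
  rw [inner_L2_eq, inner_L2_eq]
  refine integral_congr_ae ?_
  filter_upwards [mulOp_coeFn hf u, mulOp_coeFn (memLp_top_star hf) v] with x h1 h2
  rw [h1, h2, star_mul']; ring

theorem adjoint_mulOp {f : ℝ → ℂ} (hf : MemLp f ∞ volume) :
    ContinuousLinearMap.adjoint (mulOp f) = mulOp fun x => star (f x) := by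
  symm
  rw [ContinuousLinearMap.eq_adjoint_iff]
  intro u v
  have := inner_mulOp_left (memLp_top_star hf) u v
  simpa using this

theorem mulOp_periodic {f : ℝ → ℂ} (hf : MemLp f ∞ volume) (hp : Function.Periodic f 1) :
    IsPeriodicOp (mulOp f) := by
  intro u
  symm
  refine eq_mulOp_apply hf ?_
  have h1 := (measurePreserving_add_right volume (1 : ℝ)).quasiMeasurePreserving.ae_eq_comp
    (mulOp_coeFn hf u)
  filter_upwards [translation_coeFn (mulOp f u), translation_coeFn u, h1] with x h2 h3 h4
  simp only [Function.comp_apply] at h4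
  rw [h2, h3, h4, hp]

theorem isPeriodicOp_iff {η : L2 →L[ℂ] L2} :
    IsPeriodicOp η ↔ η ∘L translation = translation ∘L η :=
  ⟨fun h => ContinuousLinearMap.ext h, fun h u => congrArg (fun T => T u) h⟩

theorem IsPeriodicOp.comp {η θ : L2 →L[ℂ] L2} (h1 : IsPeriodicOp η) (h2 : IsPeriodicOp θ) :
    IsPeriodicOp (η ∘L θ) := fun u => by
  simp only [ContinuousLinearMap.comp_apply, h2 u, h1 (θ u)]

theorem IsPeriodicOp.add {η θ : L2 →L[ℂ] L2} (h1 : IsPeriodicOp η) (h2 : IsPeriodicOp θ) :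
    IsPeriodicOp (η + θ) := fun u => by simp [h1 u, h2 u]

theorem IsPeriodicOp.sub {η θ : L2 →L[ℂ] L2} (h1 : IsPeriodicOp η) (h2 : IsPeriodicOp θ) :
    IsPeriodicOp (η - θ) := fun u => by simp [h1 u, h2 u]

theorem IsPeriodicOp.neg {η : L2 →L[ℂ] L2} (h1 : IsPeriodicOp η) :
    IsPeriodicOp (-η) := fun u => by simp [h1 u]

theorem IsPeriodicOp.smul {η : L2 →L[ℂ] L2} (c : ℂ) (h1 : IsPeriodicOp η) :
    IsPeriodicOp (c • η) := fun u => by simp [h1 u]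

theorem IsPeriodicOp.tsum {f : ℕ → L2 →L[ℂ] L2} (hf : Summable f) (h : ∀ n, IsPeriodicOp (f n)) :
    IsPeriodicOp (∑' n, f n) := by
  rw [isPeriodicOp_iff]
  have h1 : (∑' n, f n) ∘L translation = ∑' n, f n ∘L translation :=
    ((ContinuousLinearMap.compL ℂ L2 L2 L2).flip translation).map_tsum hf
  have h2 : translation ∘L (∑' n, f n) = ∑' n, translation ∘L f n :=
    (ContinuousLinearMap.compL ℂ L2 L2 L2 translation).map_tsum hf
  rw [h1, h2]
  exact tsum_congr fun n => isPeriodicOp_iff.1 (h n)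

/-- `m` is a bounded measurable symbol, so that `m(-i∇)` is a bounded operator. -/
structure IsSymbol (m : ℝ → ℂ) : Prop where
  measurable : Measurable m
  bounded : ∃ C, ∀ p, ‖m p‖ ≤ C

namespace IsSymbol

variable {m n : ℝ → ℂ}

theorem memLp (hm : IsSymbol m) : MemLp (fun ξ => m (2 * Real.pi * ξ)) ∞ volume := by
  obtain ⟨C, hC⟩ := hm.bounded
  exact memLp_top_of_bound (hm.measurable.comp (measurable_const_mul _)).aestronglyMeasurable C
    (.of_forall fun x => hC _)

theorem mul (hm : IsSymbol m) (hn : IsSymbol n) : IsSymbol fun p => m p * n p := by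
  obtain ⟨C, hC⟩ := hm.bounded
  obtain ⟨D, hD⟩ := hn.bounded
  refine ⟨hm.measurable.mul hn.measurable, C * D, fun p => ?_⟩
  rw [norm_mul]
  exact mul_le_mul (hC p) (hD p) (norm_nonneg _) ((norm_nonneg _).trans (hC p))

theorem add (hm : IsSymbol m) (hn : IsSymbol n) : IsSymbol fun p => m p + n p := by
  obtain ⟨C, hC⟩ := hm.bounded
  obtain ⟨D, hD⟩ := hn.bounded
  exact ⟨hm.measurable.add hn.measurable, C + D, fun p =>
    (norm_add_le _ _).trans (add_le_add (hC p) (hD p))⟩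

theorem const (c : ℂ) : IsSymbol fun _ => c := ⟨measurable_const, ‖c‖, fun _ => le_rfl⟩

theorem star (hm : IsSymbol m) : IsSymbol fun p => star (m p) := by
  obtain ⟨C, hC⟩ := hm.bounded
  exact ⟨Complex.continuous_conj.measurable.comp hm.measurable, C, fun p => by
    rw [norm_star]; exact hC p⟩

theorem comp_add (hm : IsSymbol m) (a : ℝ) : IsSymbol fun p => m (p + a) := by
  obtain ⟨C, hC⟩ := hm.bounded
  exact ⟨hm.measurable.comp (measurable_add_const a), C, fun p => hC _⟩

theorem sum {m : ℕ → ℝ → ℂ} (hm : ∀ n, IsSymbol (m n)) (N : ℕ) :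
    IsSymbol fun p => ∑ n ∈ Finset.range N, m n p := by
  induction N with
  | zero => simpa using const 0
  | succ N ih => simpa [Finset.sum_range_succ] using ih.add (hm N)

end IsSymbol

theorem fourier_momentumOp {m : ℝ → ℂ} (hm : IsSymbol m) (u : L2) :
    ((𝓕 (momentumOp m u) : L2) : ℝ → ℂ) =ᵐ[volume]
      fun ξ => m (2 * Real.pi * ξ) * (𝓕 u : L2) ξ := by
  have h : (𝓕 (momentumOp m u) : L2) = mulOp (fun ξ => m (2 * Real.pi * ξ)) (𝓕 u : L2) :=
    (Lp.fourierTransformₗᵢ ℝ ℂ).apply_symm_apply _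
  rw [h]
  exact mulOp_coeFn hm.memLp _

theorem eq_momentumOp_apply {m : ℝ → ℂ} (hm : IsSymbol m) {u v : L2}
    (h : ((𝓕 v : L2) : ℝ → ℂ) =ᵐ[volume] fun ξ => m (2 * Real.pi * ξ) * (𝓕 u : L2) ξ) :
    v = momentumOp m u :=
  eq_of_fourier_ae_eq (h.trans (fourier_momentumOp hm u).symm)

theorem fourier_add (u v : L2) : (𝓕 (u + v) : L2) = 𝓕 u + 𝓕 v :=
  (Lp.fourierTransformₗᵢ ℝ ℂ).map_add u v

theorem fourier_sub (u v : L2) : (𝓕 (u - v) : L2) = 𝓕 u - 𝓕 v :=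
  (Lp.fourierTransformₗᵢ ℝ ℂ).map_sub u v

theorem fourier_smul (c : ℂ) (u : L2) : (𝓕 (c • u) : L2) = c • 𝓕 u :=
  (Lp.fourierTransformₗᵢ ℝ ℂ).map_smul c u

theorem norm_momentumOp_le {m : ℝ → ℂ} {C : ℝ} (hC : 0 ≤ C) (h : ∀ p, ‖m p‖ ≤ C) :
    ‖momentumOp m‖ ≤ C := by
  refine ContinuousLinearMap.opNorm_le_bound _ hC fun u => ?_
  have h1 : ‖momentumOp m u‖ = ‖mulOp (fun ξ => m (2 * Real.pi * ξ)) (𝓕 u : L2)‖ :=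
    (Lp.fourierTransformₗᵢ ℝ ℂ).symm.norm_map _
  rw [h1, ← Lp.norm_fourier_eq u]
  exact ContinuousLinearMap.le_of_opNorm_le _ (mulOp_norm_le hC (.of_forall fun x => h _)) _

theorem momentumOp_mul {m n : ℝ → ℂ} (hm : IsSymbol m) (hn : IsSymbol n) :
    momentumOp (fun p => m p * n p) = momentumOp m ∘L momentumOp n := by
  ext1 u
  symm
  refine eq_momentumOp_apply (hm.mul hn) ?_
  filter_upwards [fourier_momentumOp hm (momentumOp n u), fourier_momentumOp hn u] with x h1 h2
  rw [ContinuousLinearMap.comp_apply, h1, h2]; ring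

theorem momentumOp_add {m n : ℝ → ℂ} (hm : IsSymbol m) (hn : IsSymbol n) :
    momentumOp (fun p => m p + n p) = momentumOp m + momentumOp n := by
  ext1 u
  symm
  refine eq_momentumOp_apply (hm.add hn) ?_
  rw [add_apply, fourier_add]
  filter_upwards [Lp.coeFn_add (𝓕 (momentumOp m u) : L2) (𝓕 (momentumOp n u) : L2),
    fourier_momentumOp hm u, fourier_momentumOp hn u] with x h0 h1 h2
  rw [h0, Pi.add_apply, h1, h2, add_mul]

theorem momentumOp_const (c : ℂ) : momentumOp (fun _ => c) = c • ContinuousLinearMap.id ℂ L2 := by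
  ext1 u
  symm
  refine eq_momentumOp_apply (IsSymbol.const c) ?_
  rw [smul_apply, fourier_smul]
  filter_upwards [Lp.coeFn_smul c (𝓕 u : L2)] with x h0
  simpa using h0

theorem momentumOp_const_mul {m : ℝ → ℂ} (c : ℂ) (hm : IsSymbol m) :
    momentumOp (fun p => c * m p) = c • momentumOp m := by
  rw [momentumOp_mul (IsSymbol.const c) hm, momentumOp_const]
  rfl

theorem momentumOp_sub {m n : ℝ → ℂ} (hm : IsSymbol m) (hn : IsSymbol n) :
    momentumOp (fun p => m p - n p) = momentumOp m - momentumOp n := by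
  have h := momentumOp_add hm ((IsSymbol.const (-1)).mul hn)
  rw [momentumOp_const_mul _ hn] at h
  simpa [sub_eq_add_neg] using h

theorem momentumOp_sum {m : ℕ → ℝ → ℂ} (hm : ∀ n, IsSymbol (m n)) (N : ℕ) :
    momentumOp (fun p => ∑ n ∈ Finset.range N, m n p) =
      ∑ n ∈ Finset.range N, momentumOp (m n) := by
  induction N with
  | zero => simpa using momentumOp_const 0
  | succ N ih =>
    simp only [Finset.sum_range_succ]
    rw [momentumOp_add (IsSymbol.sum hm N) (hm N), ih]

theorem adjoint_momentumOp {m : ℝ → ℂ} (hm : IsSymbol m) :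
    ContinuousLinearMap.adjoint (momentumOp m) = momentumOp fun p => star (m p) := by
  symm
  rw [ContinuousLinearMap.eq_adjoint_iff]
  intro u v
  rw [← Lp.inner_fourier_eq, ← Lp.inner_fourier_eq u, inner_L2_eq, inner_L2_eq]
  refine integral_congr_ae ?_
  filter_upwards [fourier_momentumOp hm.star u, fourier_momentumOp hm v] with x h1 h2
  rw [h1, h2, star_mul', star_star]; ring

theorem momentumOp_periodic {m : ℝ → ℂ} (hm : IsSymbol m) : IsPeriodicOp (momentumOp m) := by
  intro u
  symm
  refine eq_momentumOp_apply hm ?_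
  filter_upwards [fourier_translation (momentumOp m u), fourier_translation u,
    fourier_momentumOp hm u] with x h1 h2 h3
  rw [h1, h2, h3]; ring

/-- `m(-i∇) e^{2πilx} = e^{2πilx} m(-i∇ + 2πl)`. -/
theorem momentumOp_comp_modulation {m : ℝ → ℂ} (hm : IsSymbol m) (l : ℝ) :
    momentumOp m ∘L mulOp (cexpi l) =
      mulOp (cexpi l) ∘L momentumOp (fun p => m (p + 2 * Real.pi * l)) := by
  ext1 u
  symm
  refine eq_momentumOp_apply hm ?_
  have h3 := coeFn_comp_sub_ae (fourier_momentumOp (hm.comp_add (2 * Real.pi * l)) u) l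
  filter_upwards [fourier_modulation l (momentumOp (fun p => m (p + 2 * Real.pi * l)) u),
    fourier_modulation l u, h3] with x h1 h2 h3
  change _ = _ * (𝓕 (mulOp (cexpi l) u) : L2) x
  rw [ContinuousLinearMap.comp_apply, h1, h2, h3]
  congr 2
  ring

theorem hasSum_momentumOp {m : ℕ → ℝ → ℂ} (hm : ∀ n, IsSymbol (m n)) {b : ℕ → ℝ}
    (hb : Summable b) (h : ∀ n p, ‖m n p‖ ≤ b n) {M : ℝ → ℂ} (hM : IsSymbol M)
    (hs : ∀ p, HasSum (fun n => m n p) (M p)) :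
    HasSum (fun n => momentumOp (m n)) (momentumOp M) := by
  have hb0 : ∀ n, 0 ≤ b n := fun n => (norm_nonneg _).trans (h n 0)
  have hsum : Summable fun n => momentumOp (m n) :=
    .of_norm_bounded hb fun n => norm_momentumOp_le (hb0 n) (h n)
  rw [hsum.hasSum_iff_tendsto_nat, tendsto_iff_norm_sub_tendsto_zero]
  refine squeeze_zero (fun _ => norm_nonneg _) (fun N => ?_) (tendsto_sum_nat_add b)
  rw [← momentumOp_sum hm, ← momentumOp_sub (IsSymbol.sum hm N) hM]
  refine norm_momentumOp_le (tsum_nonneg fun i => hb0 _) fun p => ?_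
  have h1 := (hs p).summable.sum_add_tsum_nat_add N
  rw [(hs p).tsum_eq] at h1
  rw [norm_sub_rev, ← h1, add_sub_cancel_left]
  exact tsum_of_norm_bounded ((summable_nat_add_iff N).2 hb).hasSum fun i => h _ _

/-! ### Hilbert–Schmidt norms -/

theorem enorm_sq_eq_ofReal {E : Type*} [NormedAddCommGroup E] (v : E) :
    ‖v‖ₑ ^ 2 = ENNReal.ofReal (‖v‖ ^ 2) := by
  rw [ENNReal.ofReal_pow (norm_nonneg _), ofReal_norm]

theorem enorm_inner_comm {E : Type*} [NormedAddCommGroup E] [InnerProductSpace ℂ E]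
    (u v : E) : ‖(inner ℂ u v : ℂ)‖ₑ = ‖(inner ℂ v u : ℂ)‖ₑ := by
  rw [← ofReal_norm, ← ofReal_norm, norm_inner_symm]

theorem parseval_enorm {E : Type*} [NormedAddCommGroup E] [InnerProductSpace ℂ E]
    {ι : Type*} (b : HilbertBasis ι ℂ E) (v : E) :
    ‖v‖ₑ ^ 2 = ∑' i, ‖(inner ℂ (b i) v : ℂ)‖ₑ ^ 2 := by
  have h := b.hasSum_inner_mul_inner v v
  have h1 : HasSum (fun i => ‖(inner ℂ (b i) v : ℂ)‖ ^ 2) (‖v‖ ^ 2) := by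
    have h2 := Complex.hasSum_re h
    convert h2 using 1
    · ext i
      rw [← inner_conj_symm v (b i), Complex.conj_mul', ← Complex.ofReal_pow, Complex.ofReal_re]
    · exact norm_sq_eq_re_inner (𝕜 := ℂ) v
  rw [enorm_sq_eq_ofReal, ← h1.tsum_eq,
    ENNReal.ofReal_tsum_of_nonneg (fun _ => by positivity) h1.summable]
  simp only [enorm_sq_eq_ofReal]

theorem sum_inner_enorm_le {E : Type*} [NormedAddCommGroup E] [InnerProductSpace ℂ E]
    {ι : Type*} {e : ι → E} (he : Orthonormal ℂ e) (s : Finset ι) (v : E) :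
    ∑ i ∈ s, ‖(inner ℂ (e i) v : ℂ)‖ₑ ^ 2 ≤ ‖v‖ₑ ^ 2 := by
  simp only [enorm_sq_eq_ofReal]
  rw [← ENNReal.ofReal_sum_of_nonneg fun _ _ => by positivity]
  exact ENNReal.ofReal_le_ofReal (he.sum_inner_products_le v)

section HilbertSchmidt

variable {E : Type*} [NormedAddCommGroup E] [InnerProductSpace ℂ E] [CompleteSpace E]

/-- A choice of Hilbert basis, used to define the Hilbert–Schmidt norm. -/
noncomputable def someBasis (E : Type*) [NormedAddCommGroup E] [InnerProductSpace ℂ E]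
    [CompleteSpace E] : HilbertBasis (exists_hilbertBasis ℂ E).choose ℂ E :=
  (exists_hilbertBasis ℂ E).choose_spec.choose

/-- The square of the Hilbert–Schmidt norm, with values in `[0, ∞]`. -/
noncomputable def hsNormSq (T : E →L[ℂ] E) : ℝ≥0∞ := ∑' i, ‖T (someBasis E i)‖ₑ ^ 2

theorem hsNormSq_adjoint (T : E →L[ℂ] E) :
    hsNormSq (ContinuousLinearMap.adjoint T) = hsNormSq T := by
  unfold hsNormSq
  simp only [parseval_enorm (someBasis E)]
  rw [ENNReal.tsum_comm]
  refine tsum_congr fun i => tsum_congr fun j => ?_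
  rw [ContinuousLinearMap.adjoint_inner_right, enorm_inner_comm]

theorem hsNormSq_comp_left_le (A T : E →L[ℂ] E) : hsNormSq (A ∘L T) ≤ ‖A‖ₑ ^ 2 * hsNormSq T := by
  unfold hsNormSq
  rw [← ENNReal.tsum_mul_left]
  refine ENNReal.tsum_le_tsum fun i => ?_
  rw [← mul_pow]
  gcongr
  exact ContinuousLinearMap.le_opENorm A _

theorem enorm_adjoint (T : E →L[ℂ] E) : ‖ContinuousLinearMap.adjoint T‖ₑ = ‖T‖ₑ := by
  rw [← ofReal_norm, ← ofReal_norm, LinearIsometryEquiv.norm_map]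

theorem hsNormSq_comp_right_le (T A : E →L[ℂ] E) : hsNormSq (T ∘L A) ≤ hsNormSq T * ‖A‖ₑ ^ 2 := by
  rw [← hsNormSq_adjoint, ContinuousLinearMap.adjoint_comp, mul_comm, ← enorm_adjoint A,
    ← hsNormSq_adjoint T]
  exact hsNormSq_comp_left_le _ _

/-- Any orthonormal family gives a lower bound for the Hilbert–Schmidt norm; in particular the norm
does not depend on the chosen basis. -/
theorem sum_enorm_le_hsNormSq {ι : Type*} {e : ι → E} (he : Orthonormal ℂ e) (s : Finset ι)
    (T : E →L[ℂ] E) : ∑ i ∈ s, ‖T (e i)‖ₑ ^ 2 ≤ hsNormSq T := by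
  rw [← hsNormSq_adjoint]
  unfold hsNormSq
  simp only [parseval_enorm (someBasis E) (T _)]
  rw [← Summable.tsum_finsetSum fun _ _ => ENNReal.summable]
  refine ENNReal.tsum_le_tsum fun j => ?_
  refine le_trans (le_of_eq ?_) (sum_inner_enorm_le he s _)
  refine Finset.sum_congr rfl fun i _ => ?_
  rw [← ContinuousLinearMap.adjoint_inner_left, enorm_inner_comm]

theorem hsNormSq_comp_isometry_left {A : E →L[ℂ] E} (hA : ∀ u, ‖A u‖ = ‖u‖) (T : E →L[ℂ] E) :
    hsNormSq (A ∘L T) = hsNormSq T := by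
  unfold hsNormSq
  refine tsum_congr fun i => ?_
  rw [ContinuousLinearMap.comp_apply, ← ofReal_norm, hA, ofReal_norm]

/-- Minkowski's inequality for a series of Hilbert–Schmidt operators. -/
theorem hsNormSq_tsum_le {T : ℕ → E →L[ℂ] E} (hT : Summable T) {w : ℕ → ℝ}
    (hw : ∀ n, 0 < w n) (hws : Summable w) {K : ℝ≥0∞}
    (h : ∀ n, hsNormSq (T n) ≤ K * ENNReal.ofReal (w n) ^ 2) :
    hsNormSq (∑' n, T n) ≤ K * ENNReal.ofReal (∑' n, w n) ^ 2 := by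
  have h2 : ∀ m n, ∑' i, ‖T m (someBasis E i)‖ₑ * ‖T n (someBasis E i)‖ₑ ≤
      K * (ENNReal.ofReal (w m) * ENNReal.ofReal (w n)) := by
    intro m n
    -- `2ab ≤ t a² + t⁻¹ b²` with `t = w n / w m`
    set t := ENNReal.ofReal (w n / w m) with ht
    set t' := ENNReal.ofReal (w m / w n) with ht'
    have h3 : ∀ a b : E, 2 * (‖a‖ₑ * ‖b‖ₑ) ≤ t * ‖a‖ₑ ^ 2 + t' * ‖b‖ₑ ^ 2 := by
      intro a b
      have hm := hw m
      have hn := hw n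
      rw [enorm_sq_eq_ofReal, enorm_sq_eq_ofReal, ← ofReal_norm, ← ofReal_norm, ht, ht',
        ← ENNReal.ofReal_mul (by positivity), ← ENNReal.ofReal_mul (by positivity),
        ← ENNReal.ofReal_mul (by positivity), ← ENNReal.ofReal_add (by positivity) (by positivity),
        show (2 : ℝ≥0∞) = ENNReal.ofReal 2 by simp, ← ENNReal.ofReal_mul (by positivity)]
      refine ENNReal.ofReal_le_ofReal ?_
      have h4 : 0 ≤ (w n * ‖a‖ - w m * ‖b‖) ^ 2 / (w m * w n) := by positivity
      have h5 : (w n * ‖a‖ - w m * ‖b‖) ^ 2 / (w m * w n) =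
          w n / w m * ‖a‖ ^ 2 + w m / w n * ‖b‖ ^ 2 - 2 * (‖a‖ * ‖b‖) := by
        field_simp; ring
      linarith
    have h6 : 2 * ∑' i, ‖T m (someBasis E i)‖ₑ * ‖T n (someBasis E i)‖ₑ ≤
        2 * (K * (ENNReal.ofReal (w m) * ENNReal.ofReal (w n))) := by
      rw [← ENNReal.tsum_mul_left]
      calc _ ≤ ∑' i, (t * ‖T m (someBasis E i)‖ₑ ^ 2 + t' * ‖T n (someBasis E i)‖ₑ ^ 2) :=
            ENNReal.tsum_le_tsum fun i => h3 _ _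
        _ = t * hsNormSq (T m) + t' * hsNormSq (T n) := by
            rw [ENNReal.tsum_add, ENNReal.tsum_mul_left, ENNReal.tsum_mul_left]; rfl
        _ ≤ t * (K * ENNReal.ofReal (w m) ^ 2) + t' * (K * ENNReal.ofReal (w n) ^ 2) := by
            gcongr <;> exact h _
        _ = _ := by
            have hm := hw m
            have hn := hw n
            have e1 : t * ENNReal.ofReal (w m) ^ 2 =
                ENNReal.ofReal (w m) * ENNReal.ofReal (w n) := by
              rw [ht, ← ENNReal.ofReal_pow hm.le, ← ENNReal.ofReal_mul (by positivity),
                ← ENNReal.ofReal_mul hm.le]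
              congr 1; field_simp
            have e2 : t' * ENNReal.ofReal (w n) ^ 2 =
                ENNReal.ofReal (w m) * ENNReal.ofReal (w n) := by
              rw [ht', ← ENNReal.ofReal_pow hn.le, ← ENNReal.ofReal_mul (by positivity),
                ← ENNReal.ofReal_mul hm.le]
              congr 1; field_simp
            rw [mul_left_comm t, e1, mul_left_comm t', e2, two_mul]
    exact (ENNReal.mul_le_mul_iff_right two_ne_zero ENNReal.ofNat_ne_top).1 h6
  calc hsNormSq (∑' n, T n)
      ≤ ∑' i, (∑' n, ‖T n (someBasis E i)‖ₑ) ^ 2 := by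
        refine ENNReal.tsum_le_tsum fun i => ?_
        gcongr
        have h3 : (∑' n, T n) (someBasis E i) = ∑' n, T n (someBasis E i) :=
          (ContinuousLinearMap.apply ℂ E (someBasis E i)).map_tsum hT
        rw [h3]
        exact enorm_tsum_le_tsum_enorm
    _ = ∑' m, ∑' n, ∑' i, ‖T m (someBasis E i)‖ₑ * ‖T n (someBasis E i)‖ₑ := by
        simp only [sq, ← ENNReal.tsum_mul_right]
        simp only [← ENNReal.tsum_mul_left]
        rw [ENNReal.tsum_comm]
        exact tsum_congr fun m => ENNReal.tsum_comm
    _ ≤ ∑' m, ∑' n, K * (ENNReal.ofReal (w m) * ENNReal.ofReal (w n)) :=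
        ENNReal.tsum_le_tsum fun m => ENNReal.tsum_le_tsum fun n => h2 m n
    _ = K * ENNReal.ofReal (∑' n, w n) ^ 2 := by
        rw [ENNReal.ofReal_tsum_of_nonneg (fun n => (hw n).le) hws, sq]
        simp only [ENNReal.tsum_mul_left, ENNReal.tsum_mul_right]

theorem hsNormSq_add_le (S T : E →L[ℂ] E) : hsNormSq (S + T) ≤ 2 * hsNormSq S + 2 * hsNormSq T := by
  unfold hsNormSq
  rw [← ENNReal.tsum_mul_left, ← ENNReal.tsum_mul_left, ← ENNReal.tsum_add]
  refine ENNReal.tsum_le_tsum fun i => ?_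
  simp only [enorm_sq_eq_ofReal, add_apply]
  rw [show (2 : ℝ≥0∞) = ENNReal.ofReal 2 by simp, ← ENNReal.ofReal_mul (by positivity),
    ← ENNReal.ofReal_mul (by positivity), ← ENNReal.ofReal_add (by positivity) (by positivity)]
  refine ENNReal.ofReal_le_ofReal ?_
  have h1 := norm_add_le (S (someBasis E i)) (T (someBasis E i))
  nlinarith [sq_nonneg (‖S (someBasis E i)‖ - ‖T (someBasis E i)‖),
    norm_nonneg (S (someBasis E i) + T (someBasis E i))]

end HilbertSchmidt

/-! ### The trace per unit volume -/

/-- The characteristic function of the unit interval, as an operator on `L²(ℝ)`. -/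
noncomputable def cell : L2 →L[ℂ] L2 := mulOp ((Set.Icc (0 : ℝ) 1).indicator 1)

/-- Translation by an integer, `u ↦ u(· + k)`. -/
noncomputable def shift (k : ℤ) : L2 →L[ℂ] L2 :=
  (Lp.compMeasurePreservingₗᵢ ℂ (fun x : ℝ => x + k)
    (measurePreserving_add_right volume (k : ℝ))).toContinuousLinearMap

theorem shift_coeFn (k : ℤ) (u : L2) : (shift k u : ℝ → ℂ) =ᵐ[volume] fun x => u (x + k) :=
  Lp.coeFn_compMeasurePreserving u (measurePreserving_add_right volume (k : ℝ))

theorem norm_shift (k : ℤ) (u : L2) : ‖shift k u‖ = ‖u‖ :=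
  Lp.norm_compMeasurePreserving u (measurePreserving_add_right volume (k : ℝ))

theorem shift_one : shift 1 = translation := by
  ext1 u
  refine Lp.ext ?_
  filter_upwards [shift_coeFn 1 u, translation_coeFn u] with x h1 h2
  rw [h1, h2]; simp

theorem shift_add (j k : ℤ) : shift (j + k) = shift j ∘L shift k := by
  ext1 u
  refine Lp.ext ?_
  have h := (measurePreserving_add_right volume (j : ℝ)).quasiMeasurePreserving.ae_eq_comp
    (shift_coeFn k u)
  filter_upwards [shift_coeFn (j + k) u, shift_coeFn j (shift k u), h] with x h1 h2 h3
  simp only [Function.comp_apply] at h3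
  rw [ContinuousLinearMap.comp_apply, h1, h2, h3]
  push_cast; ring_nf

theorem shift_zero : shift 0 = ContinuousLinearMap.id ℂ L2 := by
  ext1 u
  refine Lp.ext ?_
  filter_upwards [shift_coeFn 0 u] with x h1
  rw [h1]; simp

theorem IsPeriodicOp.comp_shift {η : L2 →L[ℂ] L2} (h : IsPeriodicOp η) (k : ℤ) :
    η ∘L shift k = shift k ∘L η := by
  have h0 : η ∘L shift 1 = shift 1 ∘L η := by rw [shift_one]; exact isPeriodicOp_iff.1 h
  have h1 : ∀ j : ℤ, η ∘L shift j = shift j ∘L η → η ∘L shift (-j) = shift (-j) ∘L η := by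
    intro j hj
    have e1 : shift j ∘L shift (-j) = ContinuousLinearMap.id ℂ L2 := by
      rw [← shift_add, add_neg_cancel, shift_zero]
    have e2 : shift (-j) ∘L shift j = ContinuousLinearMap.id ℂ L2 := by
      rw [← shift_add, neg_add_cancel, shift_zero]
    calc η ∘L shift (-j) = (shift (-j) ∘L shift j) ∘L η ∘L shift (-j) := by
          rw [e2, ContinuousLinearMap.id_comp]
      _ = shift (-j) ∘L (η ∘L shift j) ∘L shift (-j) := by
          rw [hj]; simp only [ContinuousLinearMap.comp_assoc]
      _ = shift (-j) ∘L η ∘L (shift j ∘L shift (-j)) := by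
          simp only [ContinuousLinearMap.comp_assoc]
      _ = _ := by rw [e1, ContinuousLinearMap.comp_id]
  have h2 : ∀ n : ℕ, η ∘L shift n = shift n ∘L η := by
    intro n
    induction n with
    | zero => simp [shift_zero]
    | succ n ih =>
      rw [Nat.cast_succ, shift_add, ← ContinuousLinearMap.comp_assoc, ih,
        ContinuousLinearMap.comp_assoc, h0, ContinuousLinearMap.comp_assoc]
  obtain ⟨n, rfl | rfl⟩ := k.eq_nat_or_neg
  · exact h2 n
  · exact h1 _ (h2 n)

/-- The characteristic function of `[n, n + 1)`, as an operator on `L²(ℝ)`. -/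
noncomputable def cellAt (n : ℤ) : L2 →L[ℂ] L2 :=
  mulOp ((Set.Ico (n : ℝ) (n + 1)).indicator 1)

theorem memLp_indicator_one {s : Set ℝ} (hs : MeasurableSet s) :
    MemLp (s.indicator (1 : ℝ → ℂ)) ∞ volume :=
  memLp_top_of_bound ((measurable_one.indicator hs).aestronglyMeasurable) 1
    (.of_forall fun x => by by_cases h : x ∈ s <;> simp [h])

theorem cell_eq : cell = cellAt 0 := by
  refine mulOp_congr ?_
  have h : (Set.Icc (0 : ℝ) 1 : Set ℝ) =ᵐ[volume] Set.Ico (((0 : ℤ) : ℝ)) (((0 : ℤ) : ℝ) + 1) := by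
    simpa using (Ico_ae_eq_Icc (μ := volume) (a := (0 : ℝ)) (b := 1)).symm
  exact indicator_ae_eq_of_ae_eq_set h

theorem cellAt_coeFn (n : ℤ) (u : L2) : (cellAt n u : ℝ → ℂ) =ᵐ[volume]
    (Set.Ico (n : ℝ) (n + 1)).indicator u := by
  filter_upwards [mulOp_coeFn (memLp_indicator_one measurableSet_Ico) u] with x h
  rw [cellAt, h]
  by_cases hx : x ∈ Set.Ico (n : ℝ) (n + 1) <;> simp [hx]

theorem cellAt_comp_shift (n k : ℤ) : shift k ∘L cellAt n = cellAt (n - k) ∘L shift k := by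
  ext1 u
  refine Lp.ext ?_
  have h := (measurePreserving_add_right volume (k : ℝ)).quasiMeasurePreserving.ae_eq_comp
    (cellAt_coeFn n u)
  filter_upwards [shift_coeFn k (cellAt n u), cellAt_coeFn (n - k) (shift k u), shift_coeFn k u, h]
    with x h1 h2 h3 h4
  simp only [Function.comp_apply] at h4
  rw [ContinuousLinearMap.comp_apply, ContinuousLinearMap.comp_apply, h1, h2, h4]
  have hiff : x + k ∈ Set.Ico (n : ℝ) (n + 1) ↔
      x ∈ Set.Ico ((n - k : ℤ) : ℝ) ((n - k : ℤ) + 1) := by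
    push_cast
    simp only [Set.mem_Ico]
    constructor <;> rintro ⟨a, b⟩ <;> constructor <;> linarith
  by_cases hx : x + k ∈ Set.Ico (n : ℝ) (n + 1)
  · rw [Set.indicator_of_mem hx, Set.indicator_of_mem (hiff.1 hx), h3]
  · rw [Set.indicator_of_notMem hx, Set.indicator_of_notMem fun h' => hx (hiff.2 h')]

theorem adjoint_cellAt (n : ℤ) : ContinuousLinearMap.adjoint (cellAt n) = cellAt n := by
  rw [cellAt, adjoint_mulOp (memLp_indicator_one measurableSet_Ico)]
  congr 1
  ext x
  by_cases hx : x ∈ Set.Ico (n : ℝ) (n + 1) <;> simp [hx]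

theorem tsum_enorm_cellAt (u : L2) : ∑' n : ℤ, ‖cellAt n u‖ₑ ^ 2 = ‖u‖ₑ ^ 2 := by
  have h1 : ∀ n : ℤ, ‖cellAt n u‖ₑ ^ 2 = ∫⁻ x in Set.Ico (n : ℝ) (n + 1), ‖u x‖ₑ ^ 2 := by
    intro n
    rw [enorm_sq_eq_lintegral, ← lintegral_indicator measurableSet_Ico]
    refine lintegral_congr_ae ?_
    filter_upwards [cellAt_coeFn n u] with x h
    rw [h]
    by_cases hx : x ∈ Set.Ico (n : ℝ) (n + 1) <;> simp [hx]
  simp only [h1]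
  rw [← lintegral_iUnion (fun n => measurableSet_Ico) (Set.pairwise_disjoint_Ico_intCast ℝ),
    iUnion_Ico_intCast, setLIntegral_univ, enorm_sq_eq_lintegral]

theorem hsNormSq_eq_tsum_cellAt (T : L2 →L[ℂ] L2) :
    hsNormSq T = ∑' n : ℤ, hsNormSq (cellAt n ∘L T) := by
  unfold hsNormSq
  rw [ENNReal.tsum_comm]
  exact tsum_congr fun i => (tsum_enorm_cellAt _).symm

/-- Cyclicity of the trace per unit volume: `Tr η* η = Tr η η*` for periodic `η`. -/
theorem hsNormSq_comp_cell {η : L2 →L[ℂ] L2} (h : IsPeriodicOp η) :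
    hsNormSq (η ∘L cell) = hsNormSq (cell ∘L η) := by
  have hle : ∀ m n k : ℤ, hsNormSq (cellAt m ∘L η ∘L cellAt n) ≤
      hsNormSq (cellAt (m - k) ∘L η ∘L cellAt (n - k)) := by
    intro m n k
    have e : shift k ∘L (cellAt m ∘L η ∘L cellAt n) =
        (cellAt (m - k) ∘L η ∘L cellAt (n - k)) ∘L shift k := by
      calc _ = (shift k ∘L cellAt m) ∘L η ∘L cellAt n := by
            simp only [ContinuousLinearMap.comp_assoc]
        _ = cellAt (m - k) ∘L (shift k ∘L η) ∘L cellAt n := by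
            rw [cellAt_comp_shift]; simp only [ContinuousLinearMap.comp_assoc]
        _ = cellAt (m - k) ∘L η ∘L (shift k ∘L cellAt n) := by
            rw [← h.comp_shift]; simp only [ContinuousLinearMap.comp_assoc]
        _ = _ := by rw [cellAt_comp_shift]; simp only [ContinuousLinearMap.comp_assoc]
    rw [← hsNormSq_comp_isometry_left (norm_shift k), e]
    refine (hsNormSq_comp_right_le _ _).trans ?_
    have h1 : ‖shift k‖ₑ ≤ 1 := by
      rw [← ofReal_norm, ENNReal.ofReal_le_one]
      exact ContinuousLinearMap.opNorm_le_bound _ zero_le_one fun u => by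
        rw [norm_shift, one_mul]
    calc _ ≤ _ * (1 : ℝ≥0∞) ^ 2 := by gcongr
      _ = _ := by simp
  have heq : ∀ n : ℤ, hsNormSq (cellAt n ∘L η ∘L cellAt 0) =
      hsNormSq (cellAt 0 ∘L η ∘L cellAt (-n)) := by
    intro n
    refine le_antisymm ?_ ?_
    · simpa using hle n 0 n
    · simpa using hle 0 (-n) (-n)
  rw [cell_eq, hsNormSq_eq_tsum_cellAt, ← hsNormSq_adjoint (cellAt 0 ∘L η),
    ContinuousLinearMap.adjoint_comp, adjoint_cellAt, hsNormSq_eq_tsum_cellAt]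
  rw [← (Equiv.neg ℤ).tsum_eq fun n =>
    hsNormSq (cellAt n ∘L ContinuousLinearMap.adjoint η ∘L cellAt 0)]
  refine tsum_congr fun n => ?_
  rw [heq, ← hsNormSq_adjoint]
  simp only [ContinuousLinearMap.adjoint_comp, adjoint_cellAt, ContinuousLinearMap.comp_assoc,
    Equiv.neg_apply]

/-- `Tr η* η`, with `Tr` the trace per unit volume. -/
noncomputable def cellHS (η : L2 →L[ℂ] L2) : ℝ≥0∞ := hsNormSq (η ∘L cell)

theorem cellHS_comp_left_le (A η : L2 →L[ℂ] L2) : cellHS (A ∘L η) ≤ ‖A‖ₑ ^ 2 * cellHS η := by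
  unfold cellHS
  rw [ContinuousLinearMap.comp_assoc]
  exact hsNormSq_comp_left_le _ _

/-- For periodic operators the Hilbert–Schmidt norm per unit volume is also controlled under
composition on the right, by cyclicity of the trace per unit volume. -/
theorem cellHS_comp_right_le {η A : L2 →L[ℂ] L2} (hη : IsPeriodicOp η) (hA : IsPeriodicOp A) :
    cellHS (η ∘L A) ≤ cellHS η * ‖A‖ₑ ^ 2 := by
  unfold cellHS
  rw [hsNormSq_comp_cell hη, hsNormSq_comp_cell (hη.comp hA), ← ContinuousLinearMap.comp_assoc]
  exact hsNormSq_comp_right_le _ _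

theorem cellHS_adjoint {η : L2 →L[ℂ] L2} (hη : IsPeriodicOp η) :
    cellHS (ContinuousLinearMap.adjoint η) = cellHS η := by
  unfold cellHS
  rw [hsNormSq_comp_cell hη, ← hsNormSq_adjoint (cell ∘L η), ContinuousLinearMap.adjoint_comp,
    cell_eq, adjoint_cellAt]

/-! ### Bessel's inequality in momentum space -/

theorem memLp_waveVec {f : ℝ → ℂ} (hf : MemLp f ∞ volume) (ξ : ℝ) :
    MemLp (fun x => star (f x * cexpi (-ξ) x * (Set.Icc (0 : ℝ) 1).indicator 1 x)) 2 volume := by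
  have h1 : MemLp ((Set.Icc (0 : ℝ) 1).indicator (fun _ => (1 : ℂ))) 2 volume :=
    memLp_indicator_const 2 measurableSet_Icc 1 (Or.inr (by simp))
  have h2 : MemLp (fun x => f x * cexpi (-ξ) x) ∞ volume := (memLp_cexpi _).mul hf
  exact (h1.mul h2 (r := 2)).star

/-- The function `e^{2πiξx} conj (f x)`, cut off to the unit interval: the vector representing the
functional `u ↦ 𝓕(f χ u)(ξ)`. -/
noncomputable def waveVec {f : ℝ → ℂ} (hf : MemLp f ∞ volume) (ξ : ℝ) : L2 :=
  (memLp_waveVec hf ξ).toLp _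

/-- The functional `u ↦ 𝓕(f χ u)(ξ)` is represented by `waveVec hf ξ`. -/
theorem fourier_mulOp_cell {f : ℝ → ℂ} (hf : MemLp f ∞ volume) (u : L2) :
    ((𝓕 (mulOp f (cell u)) : L2) : ℝ → ℂ) =ᵐ[volume] fun ξ => inner ℂ (waveVec hf ξ) u := by
  have h0 : (mulOp f (cell u) : ℝ → ℂ) =ᵐ[volume]
      fun x => f x * ((Set.Icc (0 : ℝ) 1).indicator 1 x * u x) := by
    filter_upwards [mulOp_coeFn hf (cell u),
      mulOp_coeFn (memLp_indicator_one measurableSet_Icc) u] with x h1 h2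
    rw [h1, cell, h2]
  have hint : Integrable (mulOp f (cell u)) volume := by
    have h1 : MemLp ((Set.Icc (0 : ℝ) 1).indicator (fun _ => (1 : ℂ))) 2 volume :=
      memLp_indicator_const 2 measurableSet_Icc 1 (Or.inr (by simp))
    have h2 : MemLp (fun x => (Set.Icc (0 : ℝ) 1).indicator (fun _ => (1 : ℂ)) x * u x) 1 volume :=
      (Lp.memLp u).mul h1
    have h3 := memLp_one_iff_integrable.1 (h2.mul hf (r := 1))
    exact h3.congr h0.symm
  filter_upwards [fourier_ae_eq_integral hint] with ξ h1
  rw [h1, fourier_apply_eq, inner_L2_eq]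
  refine integral_congr_ae ?_
  filter_upwards [h0, (memLp_waveVec hf ξ).coeFn_toLp] with x h2 h3
  rw [h2, waveVec, h3, star_star]; ring

/-- If `u ↦ 𝓕(T u)(ξ)` is represented by a vector `g ξ` for almost every `ξ`, Bessel's inequality at
fixed `ξ` bounds weighted Hilbert–Schmidt sums of `T` by a weighted integral of `‖g ξ‖²`. -/
theorem sum_lintegral_fourier_le {T : L2 →L[ℂ] L2} {g : ℝ → L2}
    (hg : ∀ u, ((𝓕 (T u) : L2) : ℝ → ℂ) =ᵐ[volume] fun ξ => inner ℂ (g ξ) u)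
    {w : ℝ → ℝ≥0∞} (hw : Measurable w) {ι : Type*} {e : ι → L2} (he : Orthonormal ℂ e)
    (s : Finset ι) :
    ∑ i ∈ s, ∫⁻ ξ, w ξ * ‖(𝓕 (T (e i)) : L2) ξ‖ₑ ^ 2 ≤ ∫⁻ ξ, w ξ * ‖g ξ‖ₑ ^ 2 := by
  have hmeas : ∀ i ∈ s, AEMeasurable (fun ξ => w ξ * ‖(𝓕 (T (e i)) : L2) ξ‖ₑ ^ 2) volume :=
    fun i _ => hw.aemeasurable.mul ((Lp.aestronglyMeasurable _).enorm.pow_const 2)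
  rw [← lintegral_finsetSum' _ hmeas]
  refine lintegral_mono_ae ?_
  have h : ∀ᵐ ξ, ∀ i ∈ s, (𝓕 (T (e i)) : L2) ξ = inner ℂ (g ξ) (e i) :=
    (Finset.eventually_all s).2 fun i _ => hg (e i)
  filter_upwards [h] with ξ hξ
  rw [← Finset.mul_sum]
  gcongr
  refine le_trans (le_of_eq (Finset.sum_congr rfl fun i hi => ?_)) (sum_inner_enorm_le he s (g ξ))
  rw [hξ i hi, enorm_inner_comm]

theorem hsNormSq_le_lintegral {T : L2 →L[ℂ] L2} {g : ℝ → L2}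
    (hg : ∀ u, ((𝓕 (T u) : L2) : ℝ → ℂ) =ᵐ[volume] fun ξ => inner ℂ (g ξ) u) :
    hsNormSq T ≤ ∫⁻ ξ, ‖g ξ‖ₑ ^ 2 := by
  unfold hsNormSq
  rw [ENNReal.tsum_eq_iSup_sum]
  refine iSup_le fun s => ?_
  have h := sum_lintegral_fourier_le hg measurable_one (someBasis L2).orthonormal s
  simp only [Pi.one_apply, one_mul, ← enorm_sq_eq_lintegral, enorm_fourier] at h
  exact h

theorem enorm_waveVec {f : ℝ → ℂ} (hf : MemLp f ∞ volume) (ξ : ℝ) :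
    ‖waveVec hf ξ‖ₑ ^ 2 = ∫⁻ x in Set.Icc (0 : ℝ) 1, ‖f x‖ₑ ^ 2 := by
  rw [enorm_sq_eq_lintegral, ← lintegral_indicator measurableSet_Icc]
  refine lintegral_congr_ae ?_
  filter_upwards [(memLp_waveVec hf ξ).coeFn_toLp] with x h
  rw [waveVec, h]
  have h1 : ‖cexpi (-ξ) x‖ₑ = 1 := by rw [← ofReal_norm, norm_cexpi, ENNReal.ofReal_one]
  have h2 : ∀ z : ℂ, ‖star z‖ₑ = ‖z‖ₑ := fun z => by rw [← ofReal_norm, norm_star, ofReal_norm]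
  by_cases hx : x ∈ Set.Icc (0 : ℝ) 1
  · rw [h2, Set.indicator_of_mem hx, Set.indicator_of_mem hx, enorm_mul, enorm_mul, h1]; simp
  · rw [h2, Set.indicator_of_notMem hx, Set.indicator_of_notMem hx]; simp

/-- The operator `m(-i∇) f(x)` has Hilbert–Schmidt norm `‖m‖₂ ‖f‖₂` per unit volume. -/
theorem cellHS_momentumOp_mulOp_le {m f : ℝ → ℂ} (hm : IsSymbol m) (hf : MemLp f ∞ volume) :
    cellHS (momentumOp m ∘L mulOp f) ≤
      (∫⁻ ξ, ‖m (2 * Real.pi * ξ)‖ₑ ^ 2) * ∫⁻ x in Set.Icc (0 : ℝ) 1, ‖f x‖ₑ ^ 2 := by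
  have hg : ∀ u, ((𝓕 (((momentumOp m ∘L mulOp f) ∘L cell) u) : L2) : ℝ → ℂ) =ᵐ[volume]
      fun ξ => inner ℂ (star (m (2 * Real.pi * ξ)) • waveVec hf ξ) u := by
    intro u
    filter_upwards [fourier_momentumOp hm (mulOp f (cell u)), fourier_mulOp_cell hf u] with ξ h1 h2
    rw [ContinuousLinearMap.comp_apply, ContinuousLinearMap.comp_apply, h1, h2, inner_smul_left]
    simp
  refine (hsNormSq_le_lintegral hg).trans (le_of_eq ?_)
  have h2 : ∀ z : ℂ, ‖star z‖ₑ = ‖z‖ₑ := fun z => by rw [← ofReal_norm, norm_star, ofReal_norm]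
  simp only [enorm_smul, mul_pow, enorm_waveVec, h2]
  refine lintegral_mul_const _ ?_
  exact (hm.measurable.comp (measurable_const_mul _)).enorm.pow_const 2

/-! ### The `H¹` norm of periodic operators -/

theorem norm_one_add_I_mul_sq (x : ℝ) : ‖1 + (x : ℂ) * Complex.I‖ ^ 2 = 1 + x ^ 2 := by
  rw [← Complex.normSq_eq_norm_sq, Complex.normSq_apply]
  simp; ring

theorem one_le_norm_one_add_I_mul (x : ℝ) : 1 ≤ ‖1 + (x : ℂ) * Complex.I‖ := by
  have := norm_one_add_I_mul_sq x
  nlinarith [norm_nonneg (1 + (x : ℂ) * Complex.I), sq_nonneg x]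

/-- The symbol of `(1 + h∇)⁻¹`, an inverse square root of `1 - h²∇²` up to a phase. -/
noncomputable def smoothSymbol (h : ℝ) (p : ℝ) : ℂ := (1 + ((h * p : ℝ) : ℂ) * Complex.I)⁻¹

theorem isSymbol_smoothSymbol (h : ℝ) : IsSymbol (smoothSymbol h) := by
  refine ⟨by unfold smoothSymbol; fun_prop, 1, fun p => ?_⟩
  rw [smoothSymbol, norm_inv]
  exact inv_le_one_of_one_le₀ (one_le_norm_one_add_I_mul _)

/-- `(1 + h∇)⁻¹` maps `L²` isometrically into `H¹` with the form `⟨u, (1 - h²∇²) u⟩`. -/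
theorem h1Form_smooth (h : ℝ) (u : L2) : h1Form h (momentumOp (smoothSymbol h) u) = ‖u‖ₑ ^ 2 := by
  rw [h1Form, ← enorm_fourier, enorm_sq_eq_lintegral]
  refine lintegral_congr_ae ?_
  filter_upwards [fourier_momentumOp (isSymbol_smoothSymbol h) u] with ξ h1
  rw [h1, enorm_mul, mul_pow ‖_‖ₑ, ← mul_assoc, ← mul_pow h]
  have h2 : ENNReal.ofReal (1 + (h * (2 * Real.pi * ξ)) ^ 2) *
      ‖smoothSymbol h (2 * Real.pi * ξ)‖ₑ ^ 2 = 1 := by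
    rw [enorm_sq_eq_ofReal, ← ENNReal.ofReal_mul (by positivity), smoothSymbol, norm_inv, inv_pow,
      norm_one_add_I_mul_sq, mul_inv_cancel₀ (by positivity), ENNReal.ofReal_one]
  rw [h2, one_mul]

theorem h1NormSq_smooth_comp_le (h : ℝ) (T : L2 →L[ℂ] L2) :
    h1NormSq h (momentumOp (smoothSymbol h) ∘L T) ≤ cellHS T := by
  refine iSup_le fun n => iSup_le fun e => iSup_le fun he => ?_
  simp only [ContinuousLinearMap.comp_apply, h1Form_smooth]
  exact sum_enorm_le_hsNormSq he _ (T ∘L cell)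

theorem h1NormSq_le_lintegral (h : ℝ) {T : L2 →L[ℂ] L2} {g : ℝ → L2}
    (hg : ∀ u, ((𝓕 (T (cell u)) : L2) : ℝ → ℂ) =ᵐ[volume] fun ξ => inner ℂ (g ξ) u) :
    h1NormSq h T ≤ ∫⁻ ξ, ENNReal.ofReal (1 + h ^ 2 * (2 * Real.pi * ξ) ^ 2) * ‖g ξ‖ₑ ^ 2 := by
  refine iSup_le fun n => iSup_le fun e => iSup_le fun he => ?_
  exact sum_lintegral_fourier_le (T := T ∘L cell) hg
    (w := fun ξ => ENNReal.ofReal (1 + h ^ 2 * (2 * Real.pi * ξ) ^ 2)) (by fun_prop) he Finset.univ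

/-- The symbol of `1 + h∇`, cut off to `|p| ≤ K`. -/
noncomputable def cutoffSymbol (h K : ℝ) : ℝ → ℂ :=
  (Set.Icc (-K) K).indicator fun p => 1 + ((h * p : ℝ) : ℂ) * Complex.I

theorem isSymbol_cutoffSymbol (h K : ℝ) : IsSymbol (cutoffSymbol h K) := by
  refine ⟨(by fun_prop : Measurable fun p : ℝ => 1 + ((h * p : ℝ) : ℂ) * Complex.I).indicator
    measurableSet_Icc, 1 + |h| * |K|, fun p => ?_⟩
  rw [cutoffSymbol]
  by_cases hp : p ∈ Set.Icc (-K) K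
  · rw [Set.indicator_of_mem hp]
    refine (norm_add_le _ _).trans ?_
    have h1 : |p| ≤ |K| := (abs_le.2 hp).trans (le_abs_self K)
    rw [norm_one, norm_mul, Complex.norm_I, mul_one, Complex.norm_real, Real.norm_eq_abs, abs_mul]
    gcongr
  · rw [Set.indicator_of_notMem hp, norm_zero]; positivity

/-- The `H¹` form is an increasing limit of bounded quadratic forms. -/
theorem tendsto_enorm_cutoff (h : ℝ) (u : L2) :
    Filter.Tendsto (fun K : ℕ => ‖momentumOp (cutoffSymbol h K) u‖ₑ ^ 2) Filter.atTop
      (nhds (h1Form h u)) := by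
  have h1 : ∀ K : ℕ, ‖momentumOp (cutoffSymbol h K) u‖ₑ ^ 2 = ∫⁻ ξ,
      (Set.Icc (-(K : ℝ)) K).indicator
        (fun p => ENNReal.ofReal (1 + h ^ 2 * p ^ 2)) (2 * Real.pi * ξ) * ‖(𝓕 u : L2) ξ‖ₑ ^ 2 := by
    intro K
    rw [← enorm_fourier, enorm_sq_eq_lintegral]
    refine lintegral_congr_ae ?_
    filter_upwards [fourier_momentumOp (isSymbol_cutoffSymbol h K) u] with ξ h2
    rw [h2, enorm_mul, mul_pow ‖_‖ₑ, cutoffSymbol]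
    congr 1
    by_cases hp : 2 * Real.pi * ξ ∈ Set.Icc (-(K : ℝ)) K
    · rw [Set.indicator_of_mem hp, Set.indicator_of_mem hp, enorm_sq_eq_ofReal,
        norm_one_add_I_mul_sq, mul_pow h]
    · rw [Set.indicator_of_notMem hp, Set.indicator_of_notMem hp]; simp
  simp only [h1]
  refine lintegral_tendsto_of_tendsto_of_monotone (fun K => ?_) (.of_forall fun ξ => ?_)
    (.of_forall fun ξ => ?_)
  · refine AEMeasurable.mul ?_ ((Lp.aestronglyMeasurable _).enorm.pow_const 2)
    exact (((by fun_prop : Measurable fun p : ℝ => ENNReal.ofReal (1 + h ^ 2 * p ^ 2)).indicator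
      measurableSet_Icc).comp (measurable_const_mul (2 * Real.pi))).aemeasurable
  · intro K L hKL
    have h2 : (K : ℝ) ≤ L := by exact_mod_cast hKL
    have h3 : Set.Icc (-(K : ℝ)) K ⊆ Set.Icc (-(L : ℝ)) L := Set.Icc_subset_Icc (by linarith) h2
    refine mul_le_mul_left ?_ _
    exact Set.indicator_le_indicator_of_subset h3 (fun _ => zero_le) _
  · refine tendsto_const_nhds.congr' ?_
    obtain ⟨K, hK⟩ := exists_nat_ge |2 * Real.pi * ξ|
    filter_upwards [Filter.eventually_ge_atTop K] with L hL
    have h2 : (K : ℝ) ≤ L := by exact_mod_cast hL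
    have h3 : 2 * Real.pi * ξ ∈ Set.Icc (-(L : ℝ)) L := abs_le.1 (hK.trans h2)
    rw [Set.indicator_of_mem h3]

/-- The `H¹` norm is lower semicontinuous under convergence in operator norm. -/
theorem h1NormSq_le_of_tendsto (h : ℝ) {ι : Type*} {l : Filter ι} [l.NeBot]
    {T : ι → L2 →L[ℂ] L2} {S : L2 →L[ℂ] L2} (hT : Filter.Tendsto T l (nhds S))
    {a : ℝ≥0∞} (ha : ∀ n, h1NormSq h (T n) ≤ a) :
    h1NormSq h S ≤ a := by
  refine iSup_le fun n => iSup_le fun e => iSup_le fun he => ?_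
  have hle : ∀ (K : ℕ) (u : L2), ‖momentumOp (cutoffSymbol h K) u‖ₑ ^ 2 ≤ h1Form h u := by
    intro K u
    rw [← enorm_fourier, enorm_sq_eq_lintegral]
    refine lintegral_mono_ae ?_
    filter_upwards [fourier_momentumOp (isSymbol_cutoffSymbol h K) u] with ξ h2
    rw [h2, enorm_mul, mul_pow ‖_‖ₑ, cutoffSymbol]
    gcongr
    by_cases hp : 2 * Real.pi * ξ ∈ Set.Icc (-(K : ℝ)) K
    · rw [Set.indicator_of_mem hp, enorm_sq_eq_ofReal, norm_one_add_I_mul_sq, mul_pow h]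
    · rw [Set.indicator_of_notMem hp]; simp
  refine le_of_tendsto (tendsto_finsetSum _ fun i _ => tendsto_enorm_cutoff h _)
    (.of_forall fun K => ?_)
  have h1 : Filter.Tendsto (fun m => ∑ i, ‖momentumOp (cutoffSymbol h K) (T m (cell (e i)))‖ₑ ^ 2)
      l (nhds (∑ i, ‖momentumOp (cutoffSymbol h K) (S (cell (e i)))‖ₑ ^ 2)) := by
    refine tendsto_finsetSum _ fun i _ => ENNReal.Tendsto.pow ?_
    exact (((momentumOp (cutoffSymbol h K)).continuous.tendsto _).comp
      (((ContinuousLinearMap.apply ℂ L2 (cell (e i))).continuous.tendsto S).comp hT)).enorm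
  refine le_of_tendsto h1 (.of_forall fun m => ?_)
  refine le_trans ?_ (ha m)
  refine le_trans (Finset.sum_le_sum fun i _ => hle K _) ?_
  exact le_iSup_of_le n (le_iSup_of_le e (le_iSup_of_le he le_rfl))

/-! ### Resolvents of self-adjoint operators -/

section Resolvent

variable {E : Type*} [NormedAddCommGroup E] [InnerProductSpace ℂ E]

/-- `A` is symmetric and `A - z` maps its domain onto the whole space for all nonreal `z`; this is
the basic criterion for self-adjointness. -/
structure IsSymmetricSurjective (A : E →ₗ.[ℂ] E) : Prop where
  symm : ∀ u v : A.domain, (inner ℂ (A u) (v : E) : ℂ) = inner ℂ (u : E) (A v)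
  surj : ∀ z : ℂ, z.im ≠ 0 → ∀ v, ∃ u : A.domain, A u - z • (u : E) = v

theorem abs_im_mul_norm_le {A : E →ₗ.[ℂ] E}
    (hA : ∀ u v : A.domain, (inner ℂ (A u) (v : E) : ℂ) = inner ℂ (u : E) (A v)) (z : ℂ)
    (u : A.domain) : |z.im| * ‖(u : E)‖ ≤ ‖A u - z • (u : E)‖ := by
  have h1 : (inner ℂ (u : E) (A u - z • (u : E)) : ℂ).im = -(z.im * ‖(u : E)‖ ^ 2) := by
    have h2 : (inner ℂ (u : E) (A u) : ℂ).im = 0 := by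
      rw [← Complex.conj_eq_iff_im, inner_conj_symm, hA]
    rw [inner_sub_right, inner_smul_right, inner_self_eq_norm_sq_to_K, Complex.sub_im, h2]
    have h3 : ((‖(u : E)‖ : ℂ) ^ 2) = ((‖(u : E)‖ ^ 2 : ℝ) : ℂ) := by push_cast; rfl
    erw [h3]
    simp [Complex.mul_im, -Complex.ofReal_pow]
  have h4 := (Complex.abs_im_le_norm _).trans
    (norm_inner_le_norm (𝕜 := ℂ) (u : E) (A u - z • (u : E)))
  rw [h1, abs_neg, abs_mul, abs_of_nonneg (sq_nonneg ‖(u : E)‖)] at h4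
  rcases (norm_nonneg (u : E)).eq_or_lt with h | h
  · rw [← h]; simp
  · refine le_of_mul_le_mul_left ?_ h
    nlinarith

namespace IsSymmetricSurjective

variable {A : E →ₗ.[ℂ] E} (hA : IsSymmetricSurjective A)

include hA in
theorem injective {z : ℂ} (hz : z.im ≠ 0) {u v : A.domain}
    (h : A u - z • (u : E) = A v - z • (v : E)) : u = v := by
  have h1 := abs_im_mul_norm_le hA.symm z (u - v)
  have h2 : A (u - v) - z • ((u - v : A.domain) : E) = 0 := by
    rw [A.map_sub, Submodule.coe_sub, smul_sub, ← sub_eq_zero.2 h]; abel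
  rw [h2, norm_zero] at h1
  have h3 : ‖((u - v : A.domain) : E)‖ = 0 := by
    by_contra h4
    have h5 : 0 < |z.im| * ‖((u - v : A.domain) : E)‖ :=
      mul_pos (abs_pos.2 hz) (lt_of_le_of_ne (norm_nonneg _) (Ne.symm h4))
    linarith
  have h4 := norm_eq_zero.1 h3
  rw [Submodule.coe_sub, sub_eq_zero] at h4
  exact Subtype.ext h4

open Classical in
/-- The resolvent `(A - z)⁻¹` (zero by convention for real `z`). -/
noncomputable def resolvent (z : ℂ) : E →L[ℂ] E :=
  if hz : z.im ≠ 0 then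
    LinearMap.mkContinuous
      { toFun := fun v => ((hA.surj z hz v).choose : E)
        map_add' := fun v w => by
          rw [← Submodule.coe_add]
          congr 1
          refine hA.injective hz ?_
          rw [(hA.surj z hz (v + w)).choose_spec, A.map_add, Submodule.coe_add, smul_add,
            add_sub_add_comm, (hA.surj z hz v).choose_spec, (hA.surj z hz w).choose_spec]
        map_smul' := fun c v => by
          rw [← Submodule.coe_smul]
          congr 1
          refine hA.injective hz ?_
          rw [(hA.surj z hz (c • v)).choose_spec, A.map_smul, RingHom.id_apply, Submodule.coe_smul,
            smul_comm z c, ← smul_sub, (hA.surj z hz v).choose_spec] }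
      |z.im|⁻¹ fun v => by
        have h := abs_im_mul_norm_le hA.symm z (hA.surj z hz v).choose
        rw [(hA.surj z hz v).choose_spec] at h
        rwa [LinearMap.coe_mk, AddHom.coe_mk, inv_mul_eq_div, le_div_iff₀' (abs_pos.2 hz)]
  else 0

theorem exists_eq_resolvent {z : ℂ} (hz : z.im ≠ 0) (v : E) :
    ∃ u : A.domain, (u : E) = hA.resolvent z v ∧ A u - z • (u : E) = v := by
  refine ⟨(hA.surj z hz v).choose, ?_, (hA.surj z hz v).choose_spec⟩
  rw [resolvent, dif_pos hz]; rfl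

theorem resolvent_eq {z : ℂ} (hz : z.im ≠ 0) (u : A.domain) :
    hA.resolvent z (A u - z • (u : E)) = u := by
  obtain ⟨w, h1, h2⟩ := hA.exists_eq_resolvent hz (A u - z • (u : E))
  rw [← h1, hA.injective hz h2]

theorem norm_resolvent_le {z : ℂ} (hz : z.im ≠ 0) : ‖hA.resolvent z‖ ≤ |z.im|⁻¹ := by
  rw [resolvent, dif_pos hz]
  exact LinearMap.mkContinuous_norm_le _ (by positivity) _

theorem resolvent_sub {z w : ℂ} (hz : z.im ≠ 0) (hw : w.im ≠ 0) :
    hA.resolvent z - hA.resolvent w = (z - w) • (hA.resolvent z * hA.resolvent w) := by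
  ext1 v
  obtain ⟨a, ha, ha'⟩ := hA.exists_eq_resolvent hw v
  -- `v = (A - z) a + (z - w) a`
  have h1 : v = (A a - z • (a : E)) + (z - w) • (a : E) := by rw [← ha', sub_smul]; abel
  change hA.resolvent z v - hA.resolvent w v = (z - w) • hA.resolvent z (hA.resolvent w v)
  rw [← ha]
  nth_rewrite 1 [h1]
  rw [map_add, hA.resolvent_eq hz, map_smul, add_sub_cancel_left]

theorem commute_resolvent {z w : ℂ} (hz : z.im ≠ 0) (hw : w.im ≠ 0) :
    hA.resolvent z * hA.resolvent w = hA.resolvent w * hA.resolvent z := by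
  rcases eq_or_ne z w with rfl | h
  · rfl
  have h1 := hA.resolvent_sub hz hw
  have h2 := hA.resolvent_sub hw hz
  rw [← neg_sub, h2, ← neg_smul, neg_sub] at h1
  exact (smul_right_injective _ (sub_ne_zero.2 h) h1).symm

theorem inner_resolvent {z : ℂ} (hz : z.im ≠ 0) (u v : E) :
    (inner ℂ (hA.resolvent (star z) u) v : ℂ) = inner ℂ u (hA.resolvent z v) := by
  have hz' : (star z).im ≠ 0 := by simpa using hz
  obtain ⟨a, ha, ha'⟩ := hA.exists_eq_resolvent hz' u
  obtain ⟨b, hb, hb'⟩ := hA.exists_eq_resolvent hz v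
  rw [← ha, ← hb, ← ha', ← hb', inner_sub_right, inner_sub_left, hA.symm, inner_smul_left,
    inner_smul_right]
  simp

theorem adjoint_resolvent [CompleteSpace E] {z : ℂ} (hz : z.im ≠ 0) :
    ContinuousLinearMap.adjoint (hA.resolvent z) = hA.resolvent (star z) := by
  symm
  rw [ContinuousLinearMap.eq_adjoint_iff]
  exact hA.inner_resolvent hz

include hA in
theorem dense_domain [CompleteSpace E] : Dense (A.domain : Set E) := by
  rw [Submodule.dense_iff_topologicalClosure_eq_top, Submodule.topologicalClosure_eq_top_iff,
    Submodule.eq_bot_iff]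
  intro v hv
  obtain ⟨u, hu⟩ := hA.surj Complex.I (by simp) v
  have hmI : (-Complex.I).im ≠ 0 := by simp
  -- `u` is orthogonal to the range of `A + i`, which is everything
  obtain ⟨w, hw⟩ := hA.surj (-Complex.I) hmI u
  have h1 : (inner ℂ (u : E) (u : E) : ℂ) = 0 := by
    nth_rewrite 2 [← hw]
    rw [inner_sub_right, ← hA.symm, inner_smul_right]
    have h2 : (inner ℂ v (w : E) : ℂ) = 0 := Submodule.inner_left_of_mem_orthogonal w.2 hv
    rw [← hu, inner_sub_left, inner_smul_left] at h2
    simpa using h2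
  have h3 : u = 0 := Subtype.ext (inner_self_eq_zero.1 h1)
  rw [← hu, h3]; simp

include hA in
theorem isSelfAdjoint [CompleteSpace E] : IsSelfAdjoint A := by
  rw [LinearPMap.isSelfAdjoint_def]
  have hd := hA.dense_domain
  have hle : A ≤ A.adjoint := LinearPMap.IsFormalAdjoint.le_adjoint hd hA.symm
  refine (LinearPMap.eq_of_le_of_domain_eq hle (le_antisymm hle.1 fun y hy => ?_)).symm
  obtain ⟨u, hu⟩ := hA.surj Complex.I (by simp) (A.adjoint ⟨y, hy⟩ - Complex.I • y)
  have hf := LinearPMap.adjoint_isFormalAdjoint hd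
  obtain ⟨w, hw⟩ := hA.surj (-Complex.I) (by simp) (y - u)
  have h1 : (inner ℂ (y - u : E) (y - u : E) : ℂ) = 0 := by
    nth_rewrite 2 [← hw]
    have h2 : (inner ℂ (A.adjoint ⟨y, hy⟩ - Complex.I • y - (A u - Complex.I • (u : E)))
        (w : E) : ℂ) = 0 := by
      rw [hu, sub_self, inner_zero_left]
    rw [inner_sub_left, inner_sub_left, inner_sub_left, hf ⟨y, hy⟩ w, hA.symm, inner_smul_left,
      inner_smul_left] at h2
    rw [inner_sub_right, inner_smul_right, inner_sub_left, inner_sub_left]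
    simp only [Complex.conj_I] at h2
    linear_combination h2
  have h3 : y = u := sub_eq_zero.1 (inner_self_eq_zero.1 h1)
  rw [h3]; exact u.2

end IsSymmetricSurjective

end Resolvent

/-! ### Spectral measures -/

open scoped CompactlySupported

section SpectralMeasure

variable {E : Type*} [NormedAddCommGroup E] [InnerProductSpace ℂ E]

/-- The spectral measure of a bounded normal operator at a vector, from the continuous functional
calculus and the Riesz–Markov–Kakutani theorem. -/
theorem exists_measure_cfcHom [CompleteSpace E] {N : E →L[ℂ] E} (hN : IsStarNormal N) (v : E) :
    ∃ μ : Measure (spectrum ℂ N), IsFiniteMeasure μ ∧ ∀ f : C(spectrum ℂ N, ℂ),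
      (inner ℂ v (cfcHom (R := ℂ) hN f v) : ℂ) = ∫ w, f w ∂μ := by
  let toC : C(spectrum ℂ N, ℝ) → C(spectrum ℂ N, ℂ) := fun f => ⟨fun w => (f w : ℂ), by fun_prop⟩
  let L : C_c(spectrum ℂ N, ℝ) →ₗ[ℝ] ℝ :=
    { toFun := fun f => (inner ℂ v (cfcHom (R := ℂ) hN (toC f) v) : ℂ).re
      map_add' := fun f g => by
        have h : toC ((f + g : C_c(spectrum ℂ N, ℝ)) : C(spectrum ℂ N, ℝ)) = toC f + toC g := by
          ext w; simp [toC]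
        rw [h, map_add, add_apply, inner_add_right, Complex.add_re]
      map_smul' := fun c f => by
        have h : toC ((c • f : C_c(spectrum ℂ N, ℝ)) : C(spectrum ℂ N, ℝ)) = (c : ℂ) • toC f := by
          ext w; simp [toC]
        rw [h, map_smul, smul_apply, inner_smul_right, Complex.re_ofReal_mul]
        rfl }
  have hpos : ∀ f : C(spectrum ℂ N, ℝ), 0 ≤ f →
      0 ≤ (inner ℂ v (cfcHom (R := ℂ) hN (toC f) v) : ℂ).re := by
    intro f hf
    let s : C(spectrum ℂ N, ℂ) := ⟨fun w => (Real.sqrt (f w) : ℂ), by fun_prop⟩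
    have h : toC f = star s * s := by
      ext w
      simp only [toC, s, ContinuousMap.mul_apply, ContinuousMap.star_apply, ContinuousMap.coe_mk,
        Complex.star_def, Complex.conj_ofReal]
      rw [← Complex.ofReal_mul, Real.mul_self_sqrt (show 0 ≤ f w from hf w)]
    rw [h, map_mul, map_star, ContinuousLinearMap.star_eq_adjoint]
    change 0 ≤ (inner ℂ v (ContinuousLinearMap.adjoint (cfcHom (R := ℂ) hN s)
      (cfcHom (R := ℂ) hN s v)) : ℂ).re
    rw [ContinuousLinearMap.adjoint_inner_right]
    exact inner_self_nonneg (𝕜 := ℂ)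
  let P : C_c(spectrum ℂ N, ℝ) →ₚ[ℝ] ℝ := PositiveLinearMap.mk₀ L fun f hf => hpos f fun w => hf w
  have : CompactSpace (spectrum ℂ N) := isCompact_iff_compactSpace.1 (spectrum.isCompact N)
  have hreal : ∀ f : C(spectrum ℂ N, ℝ), ∫ w, f w ∂(RealRMK.rieszMeasure P) =
      (inner ℂ v (cfcHom (R := ℂ) hN (toC f) v) : ℂ).re := fun f =>
    RealRMK.integral_rieszMeasure P (CompactlySupportedContinuousMap.continuousMapEquiv f)
  have hfin : IsFiniteMeasure (RealRMK.rieszMeasure P) :=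
    CompactSpace.isFiniteMeasure
  have hself : ∀ f : C(spectrum ℂ N, ℝ), (inner ℂ v (cfcHom (R := ℂ) hN (toC f) v) : ℂ).im = 0 := by
    intro f
    have h : star (toC f) = toC f := by
      ext w; simp [toC]
    rw [← Complex.conj_eq_iff_im, inner_conj_symm, ← ContinuousLinearMap.adjoint_inner_right,
      ← ContinuousLinearMap.star_eq_adjoint, ← map_star, h]
  refine ⟨RealRMK.rieszMeasure P, hfin, fun f => ?_⟩
  let fr : C(spectrum ℂ N, ℝ) := ⟨fun w => (f w).re, by fun_prop⟩
  let fi : C(spectrum ℂ N, ℝ) := ⟨fun w => (f w).im, by fun_prop⟩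
  have hf : f = toC fr + Complex.I • toC fi := by
    ext w
    simp only [toC, fr, fi, ContinuousMap.add_apply, ContinuousMap.smul_apply, smul_eq_mul,
      ContinuousMap.coe_mk]
    rw [mul_comm, Complex.re_add_im]
  have hint : Integrable f (RealRMK.rieszMeasure P) :=
    f.continuous.integrable_of_hasCompactSupport (HasCompactSupport.of_compactSpace _)
  have h1 : ∀ g : C(spectrum ℂ N, ℝ), (inner ℂ v (cfcHom (R := ℂ) hN (toC g) v) : ℂ) =
      ((∫ w, g w ∂(RealRMK.rieszMeasure P) : ℝ) : ℂ) := fun g => by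
    rw [hreal]
    exact Complex.ext rfl (by rw [hself, Complex.ofReal_im])
  conv_lhs => rw [hf]
  rw [map_add, map_smul, add_apply, smul_apply, inner_add_right, inner_smul_right, h1, h1,
    ← integral_re_add_im hint, mul_comm]
  rfl

namespace IsSymmetricSurjective

variable {A : E →ₗ.[ℂ] E} (hA : IsSymmetricSurjective A)

theorem resolvent_mul_one_add {z w : ℂ} (hz : z.im ≠ 0) (hw : w.im ≠ 0) :
    hA.resolvent z * (1 + (w - z) • hA.resolvent w) = hA.resolvent w := by
  rw [mul_add, mul_one, mul_smul_comm, ← neg_sub z w, neg_smul, ← hA.resolvent_sub hz hw]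
  abel

theorem isStarNormal_resolvent [CompleteSpace E] {z : ℂ} (hz : z.im ≠ 0) :
    IsStarNormal (hA.resolvent z) := by
  refine ⟨?_⟩
  rw [ContinuousLinearMap.star_eq_adjoint, hA.adjoint_resolvent hz]
  exact hA.commute_resolvent (by simpa using hz) hz

/-- A nonzero point `w` of the spectrum of `(A - i)⁻¹` has the form `(t - i)⁻¹` with `t` real. -/
theorem im_eq_zero_of_mem_spectrum {w : ℂ} (hw : w ∈ spectrum ℂ (hA.resolvent Complex.I))
    (hw0 : w ≠ 0) : (Complex.I + w⁻¹).im = 0 := by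
  by_contra hz
  set z := Complex.I + w⁻¹ with hzdef
  have hI : Complex.I.im ≠ 0 := by simp
  have hsub := hA.resolvent_sub hz hI
  rw [show z - Complex.I = w⁻¹ by rw [hzdef]; ring] at hsub
  have hcomm := hA.commute_resolvent hz hI
  refine hw ?_
  rw [spectrum.mem_resolventSet_iff, isUnit_iff_exists]
  refine ⟨w⁻¹ • (1 + w⁻¹ • hA.resolvent z), ?_, ?_⟩
  · rw [Algebra.algebraMap_eq_smul_one, mul_smul_comm, sub_mul, mul_add, mul_add, mul_smul_comm,
      mul_smul_comm, ← hcomm, ← hsub]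
    simp only [mul_one, smul_mul_assoc, one_mul]
    rw [smul_smul w⁻¹ w, inv_mul_cancel₀ hw0, one_smul, add_sub_cancel, add_sub_cancel_right,
      smul_smul, inv_mul_cancel₀ hw0, one_smul]
  · rw [Algebra.algebraMap_eq_smul_one, smul_mul_assoc, mul_sub, add_mul, add_mul, smul_mul_assoc,
      smul_mul_assoc, ← hsub]
    simp only [mul_one, mul_smul_comm, one_mul]
    rw [smul_smul w⁻¹ w, inv_mul_cancel₀ hw0, one_smul, add_sub_cancel, add_sub_cancel_right,
      smul_smul, inv_mul_cancel₀ hw0, one_smul]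

include hA in
/-- Every vector has a spectral measure. -/
theorem exists_isSpectralMeasure [CompleteSpace E] (v : E) :
    ∃ ν : Measure ℝ, IsSpectralMeasure A v ν := by
  have hI : Complex.I.im ≠ 0 := by simp
  set N := hA.resolvent Complex.I with hNdef
  have hN : IsStarNormal N := hA.isStarNormal_resolvent hI
  obtain ⟨μ, hμ, hμf⟩ := exists_measure_cfcHom hN v
  -- the spectral measure of `(A - i)⁻¹`, transported by `w = (t - i)⁻¹`; the point `w = 0`, which
  -- corresponds to `t = ∞`, is removed
  let t : spectrum ℂ N → ℝ := fun w => (Complex.I + (w : ℂ)⁻¹).re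
  have ht : Measurable t := by
    have h1 : Measurable fun w : spectrum ℂ N => (w : ℂ) := measurable_subtype_coe
    exact Complex.measurable_re.comp (measurable_const.add h1.inv)
  let S : Set (spectrum ℂ N) := {w | (w : ℂ) ≠ 0}
  have hS : MeasurableSet S := by
    have h1 : Measurable fun w : spectrum ℂ N => (w : ℂ) := measurable_subtype_coe
    exact h1 (measurableSet_singleton (0 : ℂ)).compl
  refine ⟨(μ.restrict S).map t, Measure.isFiniteMeasure_map _ _, fun z hz => ?_⟩
  obtain ⟨u, hu, hu'⟩ := hA.exists_eq_resolvent hz v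
  refine ⟨u, hu', ?_⟩
  have hden : ∀ w ∈ spectrum ℂ N, 1 + (Complex.I - z) * w ≠ 0 := by
    intro w hw h0
    have hw0 : w ≠ 0 := by rintro rfl; simp at h0
    have h1 : Complex.I + w⁻¹ = z := by
      field_simp
      linear_combination h0
    exact hz (h1 ▸ hA.im_eq_zero_of_mem_spectrum hw hw0)
  have hcont : ContinuousOn (fun w : ℂ => w / (1 + (Complex.I - z) * w)) (spectrum ℂ N) :=
    ContinuousOn.div (by fun_prop) (by fun_prop) hden
  have hcfc : cfc (fun w : ℂ => w / (1 + (Complex.I - z) * w)) N = hA.resolvent z := by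
    set D : E →L[ℂ] E := 1 + (Complex.I - z) • N with hD
    have h1 : cfc (fun w : ℂ => w / (1 + (Complex.I - z) * w)) N * D = N := by
      have h2 : cfc (fun w : ℂ => 1 + (Complex.I - z) * w) N = D := by
        rw [cfc_const_add (1 : ℂ) (fun w => (Complex.I - z) * w) N,
          cfc_const_mul_id _ N hN, map_one]
      rw [← h2, ← cfc_mul _ _ N hcont (by fun_prop)]
      conv_rhs => rw [← cfc_id' ℂ N]
      refine cfc_congr fun w hw => ?_
      exact div_mul_cancel₀ _ (hden w hw)
    have h3 : hA.resolvent z * D = N := hA.resolvent_mul_one_add hz hI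
    have h4 : D * (1 + (z - Complex.I) • hA.resolvent z) = 1 := by
      have h5 : N * (1 + (z - Complex.I) • hA.resolvent z) = hA.resolvent z :=
        hA.resolvent_mul_one_add hI hz
      rw [hD, add_mul, one_mul, smul_mul_assoc, h5, add_assoc, ← add_smul]
      simp
    calc _ = cfc (fun w : ℂ => w / (1 + (Complex.I - z) * w)) N * D *
          (1 + (z - Complex.I) • hA.resolvent z) := by rw [mul_assoc, h4, mul_one]
      _ = hA.resolvent z * D * (1 + (z - Complex.I) • hA.resolvent z) := by rw [h1, h3]
      _ = _ := by rw [mul_assoc, h4, mul_one]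
  rw [hu, ← hcfc, cfc_apply _ N hN hcont, hμf, integral_map ht.aemeasurable,
    ← integral_indicator hS]
  · refine integral_congr_ae (.of_forall fun w => ?_)
    by_cases hw : w ∈ S
    · rw [Set.indicator_of_mem hw]
      have h1 : ((t w : ℝ) : ℂ) = Complex.I + (w : ℂ)⁻¹ :=
        Complex.ext rfl (hA.im_eq_zero_of_mem_spectrum w.2 hw).symm
      have h2 := hden w w.2
      have h3 : (w : ℂ) ≠ 0 := hw
      have h4 : 1 + (Complex.I - z) * w = (Complex.I + (w : ℂ)⁻¹ - z) * w := by
        field_simp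
        ring
      simp only [ContinuousMap.coe_mk, Set.domRestrict_apply]
      rw [h1, h4, div_mul_cancel_right₀ h3]
    · rw [Set.indicator_of_notMem hw]
      have h3 : (w : ℂ) = 0 := not_not.1 hw
      simp [h3]
  · refine (Measurable.aestronglyMeasurable ?_)
    fun_prop

/-- A spectral measure determines the quadratic form of the resolvent. -/
theorem inner_resolvent_eq_integral {v : E} {ν : Measure ℝ} (hν : IsSpectralMeasure A v ν) {z : ℂ}
    (hz : z.im ≠ 0) : (inner ℂ v (hA.resolvent z v) : ℂ) = ∫ t : ℝ, ((t : ℂ) - z)⁻¹ ∂ν := by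
  obtain ⟨u, hu, hu'⟩ := hν.2 z hz
  rw [← hu', ← hA.resolvent_eq hz u, hu]

/-- `-iy (A - iy)⁻¹ v → v` as `y → ∞`. -/
theorem tendsto_smul_resolvent [CompleteSpace E] (v : E) : Filter.Tendsto
    (fun n : ℕ => (-((n + 1 : ℝ) : ℂ) * Complex.I) • hA.resolvent (((n + 1 : ℝ) : ℂ) * Complex.I) v)
    Filter.atTop (nhds v) := by
  have him : ∀ n : ℕ, ((((n + 1 : ℝ) : ℂ) * Complex.I)).im = n + 1 := fun n => by
    rw [Complex.im_ofReal_mul, Complex.I_im, mul_one]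
  have him0 : ∀ n : ℕ, ((((n + 1 : ℝ) : ℂ) * Complex.I)).im ≠ 0 := fun n => by
    rw [him]; positivity
  have hb : ∀ (n : ℕ) (w : E), ‖(-((n + 1 : ℝ) : ℂ) * Complex.I) •
      hA.resolvent (((n + 1 : ℝ) : ℂ) * Complex.I) w‖ ≤ ‖w‖ := by
    intro n w
    have h1 := (hA.resolvent (((n + 1 : ℝ) : ℂ) * Complex.I)).le_of_opNorm_le
      (hA.norm_resolvent_le (him0 n)) w
    have hn : (0 : ℝ) < n + 1 := by positivity
    rw [him, abs_of_pos hn] at h1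
    rw [norm_smul, norm_mul, norm_neg, Complex.norm_I, mul_one, Complex.norm_real,
      Real.norm_of_nonneg hn.le]
    rwa [inv_mul_eq_div, le_div_iff₀' hn] at h1
  rw [Metric.tendsto_atTop]
  intro ε hε
  -- on the domain the difference is `(A - iy)⁻¹ A w`
  obtain ⟨w, hw, hvw⟩ := Metric.dense_iff.1 hA.dense_domain v (ε / 4) (by positivity)
  rw [Metric.mem_ball, dist_eq_norm] at hw
  let w' : A.domain := ⟨w, hvw⟩
  obtain ⟨M, hM⟩ := exists_nat_gt (‖A w'‖ / (ε / 4))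
  refine ⟨M, fun n hn => ?_⟩
  have hn0 : (0 : ℝ) < n + 1 := by positivity
  have h1 : (-((n + 1 : ℝ) : ℂ) * Complex.I) • hA.resolvent (((n + 1 : ℝ) : ℂ) * Complex.I) w - w =
      -hA.resolvent (((n + 1 : ℝ) : ℂ) * Complex.I) (A w') := by
    have h2 := hA.resolvent_eq (him0 n) w'
    rw [map_sub, map_smul] at h2
    have h3 : (w' : E) = w := rfl
    rw [h3] at h2
    nth_rewrite 2 [← h2]
    rw [neg_mul, neg_smul]
    abel
  have h4 : ‖hA.resolvent (((n + 1 : ℝ) : ℂ) * Complex.I) (A w')‖ < ε / 4 := by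
    have h5 := (hA.resolvent (((n + 1 : ℝ) : ℂ) * Complex.I)).le_of_opNorm_le
      (hA.norm_resolvent_le (him0 n)) (A w')
    rw [him, abs_of_pos hn0] at h5
    refine h5.trans_lt ?_
    rw [inv_mul_eq_div, div_lt_iff₀' hn0]
    rw [div_lt_iff₀ (by positivity)] at hM
    have h6 : (M : ℝ) ≤ n := by exact_mod_cast hn
    nlinarith
  have h7 := hb n (v - w)
  rw [dist_eq_norm]
  have h8 : (-((n + 1 : ℝ) : ℂ) * Complex.I) • hA.resolvent (((n + 1 : ℝ) : ℂ) * Complex.I) v - v =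
      (-((n + 1 : ℝ) : ℂ) * Complex.I) • hA.resolvent (((n + 1 : ℝ) : ℂ) * Complex.I) (v - w) +
      ((-((n + 1 : ℝ) : ℂ) * Complex.I) • hA.resolvent (((n + 1 : ℝ) : ℂ) * Complex.I) w - w) +
      (w - v) := by
    rw [map_sub, smul_sub]; abel
  rw [h8, h1]
  rw [← norm_neg, neg_sub] at hw
  calc _ ≤ ‖v - w‖ + ε / 4 + ‖w - v‖ := by
        refine (norm_add₃_le).trans ?_
        rw [norm_neg]
        gcongr
    _ < ε := by rw [norm_sub_rev w v]; linarith

include hA in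
/-- The total mass of the spectral measure at `v` is `‖v‖²`. -/
theorem integral_one_spectralMeasure [CompleteSpace E] {v : E} {ν : Measure ℝ}
    (hν : IsSpectralMeasure A v ν) : ∫ _ : ℝ, (1 : ℂ) ∂ν = inner ℂ v v := by
  have := hν.1
  have him0 : ∀ n : ℕ, ((((n + 1 : ℝ) : ℂ) * Complex.I)).im ≠ 0 := fun n => by
    rw [Complex.im_ofReal_mul, Complex.I_im, mul_one]; positivity
  -- apply `-iy (A - iy)⁻¹ → 1` to both sides of the resolvent formula
  have h1 : Filter.Tendsto (fun n : ℕ => ∫ t : ℝ, (-((n + 1 : ℝ) : ℂ) * Complex.I) *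
      ((t : ℂ) - ((n + 1 : ℝ) : ℂ) * Complex.I)⁻¹ ∂ν) Filter.atTop
      (nhds (∫ _ : ℝ, (1 : ℂ) ∂ν)) := by
    refine tendsto_integral_of_dominated_convergence (fun _ => 1) (fun n => ?_)
      (integrable_const _) (fun n => .of_forall fun t => ?_) (.of_forall fun t => ?_)
    · exact (by fun_prop : Measurable fun t : ℝ => (-((n + 1 : ℝ) : ℂ) * Complex.I) *
        ((t : ℂ) - ((n + 1 : ℝ) : ℂ) * Complex.I)⁻¹).aestronglyMeasurable
    · have hn : (0 : ℝ) < n + 1 := by positivity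
      rw [norm_mul, norm_inv, norm_mul, norm_neg, Complex.norm_I, mul_one, Complex.norm_real,
        Real.norm_of_nonneg hn.le, ← div_eq_mul_inv]
      refine div_le_one_of_le₀ ?_ (norm_nonneg _)
      have h2 := Complex.abs_im_le_norm ((t : ℂ) - ((n + 1 : ℝ) : ℂ) * Complex.I)
      rw [Complex.sub_im, Complex.ofReal_im, Complex.im_ofReal_mul, Complex.I_im, mul_one, zero_sub,
        abs_neg, abs_of_pos hn] at h2
      exact h2
    · -- `-iy / (t - iy) = (1 + i t / y)⁻¹`
      have h2 : ∀ n : ℕ, (-((n + 1 : ℝ) : ℂ) * Complex.I) *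
          ((t : ℂ) - ((n + 1 : ℝ) : ℂ) * Complex.I)⁻¹ =
          (1 + ((t * (1 / (n + 1 : ℝ)) : ℝ) : ℂ) * Complex.I)⁻¹ := by
        intro n
        have hn : ((n : ℂ) + 1) ≠ 0 := by exact_mod_cast n.succ_ne_zero
        have h3 : (t : ℂ) - ((n + 1 : ℝ) : ℂ) * Complex.I ≠ 0 := by
          intro h4
          have h5 := congrArg Complex.im h4
          simp only [Complex.sub_im, Complex.ofReal_im, Complex.im_ofReal_mul, Complex.I_im,
            Complex.zero_im] at h5
          have : (0 : ℝ) < n + 1 := by positivity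
          linarith
        have h4 : (1 + ((t * (1 / (n + 1 : ℝ)) : ℝ) : ℂ) * Complex.I) *
            (-((n + 1 : ℝ) : ℂ) * Complex.I) = (t : ℂ) - ((n + 1 : ℝ) : ℂ) * Complex.I := by
          push_cast
          field_simp
          linear_combination -(t : ℂ) * Complex.I_sq
        refine eq_inv_of_mul_eq_one_right ?_
        rw [← mul_assoc, h4, mul_inv_cancel₀ h3]
      simp only [h2]
      have h3 : Filter.Tendsto (fun n : ℕ => t * (1 / (n + 1 : ℝ))) Filter.atTop (nhds (t * 0)) :=
        tendsto_one_div_add_atTop_nhds_zero_nat.const_mul t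
      have h4 : Filter.Tendsto (fun n : ℕ => (1 + ((t * (1 / (n + 1 : ℝ)) : ℝ) : ℂ) * Complex.I)⁻¹)
          Filter.atTop (nhds ((1 + ((t * 0 : ℝ) : ℂ) * Complex.I)⁻¹)) := by
        refine Filter.Tendsto.inv₀ (tendsto_const_nhds.add
          (((Complex.continuous_ofReal.tendsto _).comp h3).mul_const _)) (by simp)
      simpa using h4
  refine tendsto_nhds_unique h1 ?_
  have h2 : Filter.Tendsto (fun n : ℕ => (inner ℂ v ((-((n + 1 : ℝ) : ℂ) * Complex.I) •
      hA.resolvent (((n + 1 : ℝ) : ℂ) * Complex.I) v) : ℂ)) Filter.atTop (nhds (inner ℂ v v)) :=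
    tendsto_const_nhds.inner (hA.tendsto_smul_resolvent v)
  refine h2.congr fun n => ?_
  rw [inner_smul_right, hA.inner_resolvent_eq_integral hν (him0 n), integral_const_mul]

end IsSymmetricSurjective

end SpectralMeasure

/-! ### The Matsubara expansion of the Fermi function -/

theorem summable_inv_sq_add_half : Summable fun n : ℕ => 1 / ((n : ℝ) + 1 / 2) ^ 2 := by
  have h1 : Summable fun n : ℕ => 4 * (1 / ((n + 1 : ℕ) : ℝ) ^ 2) :=
    ((summable_nat_add_iff 1).2 (Real.summable_one_div_nat_pow.2 one_lt_two)).mul_left 4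
  refine h1.of_nonneg_of_le (fun n => by positivity) fun n => ?_
  push_cast
  rw [mul_one_div, div_le_div_iff₀ (by positivity) (by positivity)]
  have : (0 : ℝ) ≤ n := n.cast_nonneg
  nlinarith

theorem hasSum_of_eq {ι : Type*} {f g : ι → ℝ} {a b : ℝ} (h : HasSum g b) (hf : ∀ n, f n = g n)
    (ha : a = b) : HasSum f a := by
  rw [funext hf, ha]; exact h

/-- The Mittag-Leffler expansion of the hyperbolic tangent. -/
theorem hasSum_pi_mul_tanh (s : ℝ) :
    HasSum (fun n : ℕ => 2 * s / (s ^ 2 + ((n : ℝ) + 1 / 2) ^ 2))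
      (Real.pi * Real.tanh (Real.pi * s)) := by
  have hsum : Summable fun n : ℕ => 2 * s / (s ^ 2 + ((n : ℝ) + 1 / 2) ^ 2) := by
    refine .of_norm_bounded (summable_inv_sq_add_half.mul_left |2 * s|) fun n => ?_
    rw [norm_div, Real.norm_eq_abs, Real.norm_of_nonneg (by positivity), mul_one_div]
    gcongr
    exact le_add_of_nonneg_left (sq_nonneg s)
  rw [hsum.hasSum_iff_tendsto_nat]
  -- the expansion of `π cot (π x)` at `x = 1/2 + i s`
  set x : ℂ := 1 / 2 + s * Complex.I with hx
  have hxmem : x ∈ Complex.integerComplement := by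
    rw [Complex.mem_integerComplement_iff]
    rintro ⟨n, hn⟩
    have h1 := congrArg Complex.re hn
    simp [hx] at h1
    have h2 : (2 * n : ℝ) = 1 := by linarith
    have h3 : (2 * n : ℤ) = 1 := by exact_mod_cast h2
    omega
  have hne : ∀ a : ℝ, a ≠ 0 → (a : ℂ) + s * Complex.I ≠ 0 := by
    intro a ha h
    have := congrArg Complex.re h
    simp at this
    exact ha this
  have hpair : ∀ a : ℝ, a ≠ 0 → 1 / ((a : ℂ) + s * Complex.I) - 1 / ((a : ℂ) + s * (-Complex.I)) =
      -Complex.I * ((2 * s / (s ^ 2 + a ^ 2) : ℝ) : ℂ) := by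
    intro a ha
    have n1 := hne a ha
    have n2 : (a : ℂ) + s * (-Complex.I) ≠ 0 := by
      intro h
      have := congrArg Complex.re h
      simp at this
      exact ha this
    have e4 : ((s : ℂ) ^ 2 + (a : ℂ) ^ 2) =
        ((a : ℂ) + s * Complex.I) * ((a : ℂ) + s * (-Complex.I)) := by
      linear_combination ((s : ℂ) ^ 2) * Complex.I_sq
    rw [div_sub_div _ _ n1 n2, Complex.ofReal_div, Complex.ofReal_add, Complex.ofReal_pow,
      Complex.ofReal_pow, e4, ← mul_div_assoc]
    congr 1
    push_cast; ring
  have hpartial : ∀ N : ℕ, 1 / x + ∑ j ∈ Finset.range N, cotTerm x j =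
      -Complex.I * ((∑ n ∈ Finset.range N, 2 * s / (s ^ 2 + ((n : ℝ) + 1 / 2) ^ 2) : ℝ) : ℂ) +
        1 / ((((N : ℝ) + 1 / 2 : ℝ) : ℂ) + s * Complex.I) := by
    intro N
    induction N with
    | zero => simp [hx]
    | succ N ih =>
      rw [Finset.sum_range_succ, ← add_assoc, ih, Finset.sum_range_succ]
      have hN : (0 : ℝ) ≤ N := N.cast_nonneg
      have e1 : x - (N + 1) = -((((N : ℝ) + 1 / 2 : ℝ) : ℂ) + s * (-Complex.I)) := by
        rw [hx]; push_cast; ring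
      have e2 : x + (N + 1) = ((((N + 1 : ℕ) : ℝ) + 1 / 2 : ℝ) : ℂ) + s * Complex.I := by
        rw [hx]; push_cast; ring
      have e3 := hpair ((N : ℝ) + 1 / 2) (by positivity)
      rw [cotTerm, e1, e2, Complex.ofReal_add (Finset.sum _ _), mul_add, ← e3,
        one_div_neg_eq_neg_one_div]
      ring
  have hlim := (tendsto_logDeriv_euler_cot_sub hxmem).const_add (1 / x)
  have hcot : 1 / x + (Real.pi * Complex.cot (Real.pi * x) - 1 / x) =
      -Complex.I * ((Real.pi * Real.tanh (Real.pi * s) : ℝ) : ℂ) := by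
    rw [add_sub_cancel, Complex.cot]
    have e1 : (Real.pi : ℂ) * x = (Real.pi * s : ℝ) * Complex.I + Real.pi / 2 := by
      rw [hx]; push_cast; ring
    rw [e1, Complex.sin_add_pi_div_two, Complex.cos_add_pi_div_two, Complex.sin_mul_I,
      Complex.cos_mul_I, Real.tanh_eq_sinh_div_cosh]
    push_cast
    ring
  rw [hcot] at hlim
  simp only [hpartial] at hlim
  have hz : Filter.Tendsto (fun N : ℕ => 1 / ((((N : ℝ) + 1 / 2 : ℝ) : ℂ) + s * Complex.I))
      Filter.atTop (nhds 0) := by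
    rw [tendsto_zero_iff_norm_tendsto_zero]
    refine squeeze_zero (fun _ => norm_nonneg _) (fun N => ?_)
      ((tendsto_one_div_add_atTop_nhds_zero_nat (𝕜 := ℝ)).const_mul 2 |>.trans (by simp))
    have hN : (0 : ℝ) ≤ N := N.cast_nonneg
    rw [norm_div, norm_one, mul_one_div, div_le_div_iff₀
      (norm_pos_iff.2 (hne _ (by positivity))) (by positivity)]
    have h1 := Complex.abs_re_le_norm ((((N : ℝ) + 1 / 2 : ℝ) : ℂ) + s * Complex.I)
    rw [Complex.add_re, Complex.ofReal_re, Complex.re_ofReal_mul, Complex.I_re, mul_zero, add_zero,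
      abs_of_nonneg (by positivity)] at h1
    linarith
  have h2 := hlim.sub hz
  simp only [add_sub_cancel_right, sub_zero] at h2
  have h3 := (Complex.continuous_im.tendsto _).comp h2
  have h4 : ∀ r : ℝ, (-Complex.I * (r : ℂ)).im = -r := fun r => by simp
  simp only [Function.comp_def, h4] at h3
  simpa using h3.neg

/-- The Matsubara frequencies `ω_n = (2n + 1)π / β`. -/
noncomputable def matsubara (β : ℝ) (n : ℕ) : ℝ := (2 * n + 1) * Real.pi / β

theorem matsubara_eq (β : ℝ) (n : ℕ) : matsubara β n = 2 * Real.pi / β * ((n : ℝ) + 1 / 2) := by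
  unfold matsubara; ring

theorem matsubara_pos {β : ℝ} (hβ : 0 < β) (n : ℕ) : 0 < matsubara β n := by
  have := Real.pi_pos
  unfold matsubara; positivity

theorem matsubara_zero_le {β : ℝ} (hβ : 0 < β) (n : ℕ) : Real.pi / β ≤ matsubara β n := by
  unfold matsubara
  have := Real.pi_pos
  gcongr
  have : (0 : ℝ) ≤ n := n.cast_nonneg
  nlinarith

theorem summable_inv_matsubara_sq (β : ℝ) : Summable fun n => 1 / matsubara β n ^ 2 := by
  simp only [matsubara_eq, mul_pow, ← one_div_mul_one_div]
  exact summable_inv_sq_add_half.mul_left _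

theorem half_sub_rho (x : ℝ) : 1 / 2 - rho x = Real.tanh (x / 2) / 2 := by
  have h : Real.exp x = Real.exp (x / 2) * Real.exp (x / 2) := by
    rw [← Real.exp_add]; ring_nf
  rw [rho, h, Real.tanh_eq_sinh_div_cosh, Real.sinh_eq, Real.cosh_eq, Real.exp_neg]
  have := Real.exp_pos (x / 2)
  field_simp
  ring

/-- The Matsubara expansion of the Fermi function. -/
theorem hasSum_half_sub_rho {β : ℝ} (hβ : 0 < β) (t : ℝ) :
    HasSum (fun n => 1 / β * (2 * t / (t ^ 2 + matsubara β n ^ 2))) (1 / 2 - rho (β * t)) := by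
  have hπ := Real.pi_pos
  have h := (hasSum_pi_mul_tanh (β * t / (2 * Real.pi))).mul_left (1 / (2 * Real.pi))
  refine hasSum_of_eq h (fun n => ?_) ?_
  · rw [matsubara_eq]
    have : (β * t / (2 * Real.pi)) ^ 2 + ((n : ℝ) + 1 / 2) ^ 2 =
      (β / (2 * Real.pi)) ^ 2 * (t ^ 2 + (2 * Real.pi / β * ((n : ℝ) + 1 / 2)) ^ 2) := by
      field_simp
    rw [this]
    have h1 : 0 < t ^ 2 + (2 * Real.pi / β * ((n : ℝ) + 1 / 2)) ^ 2 := by positivity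
    field_simp
  · rw [half_sub_rho]
    have : Real.pi * (β * t / (2 * Real.pi)) = β * t / 2 := by field_simp
    rw [this]
    field_simp

/-- The Matsubara expansion of `g₀`, which is `∑_n |t - iω_n|⁻²` up to a constant. -/
theorem hasSum_g0 {β : ℝ} (hβ : 0 < β) (t : ℝ) :
    HasSum (fun n => 4 / β ^ 2 * (1 / (t ^ 2 + matsubara β n ^ 2))) (g0 (β * t)) := by
  have hπ := Real.pi_pos
  rcases eq_or_ne t 0 with rfl | ht
  · -- `∑ (2n + 1)⁻² = π² / 8`
    have hodd : HasSum (fun n : ℕ => 1 / ((2 * n + 1 : ℕ) : ℝ) ^ 2) (Real.pi ^ 2 / 8) := by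
      have h1 := hasSum_zeta_two
      have h2 : HasSum (fun n : ℕ => 1 / ((2 * n : ℕ) : ℝ) ^ 2) (1 / 4 * (Real.pi ^ 2 / 6)) := by
        refine hasSum_of_eq (h1.mul_left (1 / 4)) (fun n => ?_) rfl
        push_cast
        rw [mul_pow, one_div_mul_one_div]; norm_num
      have hinj : Function.Injective fun n : ℕ => 2 * n + 1 := fun a b h => by dsimp at h; omega
      have h3 := h1.summable.comp_injective hinj
      simp only [Function.comp_def] at h3
      have h4 := HasSum.even_add_odd (f := fun n : ℕ => 1 / (n : ℝ) ^ 2) h2 h3.hasSum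
      have h5 := h4.unique h1
      have h6 : ∑' n : ℕ, 1 / ((2 * n + 1 : ℕ) : ℝ) ^ 2 = Real.pi ^ 2 / 8 := by linarith
      exact h6 ▸ h3.hasSum
    refine hasSum_of_eq (hodd.mul_left (4 / Real.pi ^ 2)) (fun n => ?_) ?_
    · unfold matsubara
      push_cast
      field_simp
      ring
    · simp [g0]
      field_simp
      norm_num
  · refine hasSum_of_eq ((hasSum_half_sub_rho hβ t).mul_left (2 / (β * t))) (fun n => ?_) ?_
    · have h1 : 0 < t ^ 2 + matsubara β n ^ 2 := by positivity
      field_simp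
      ring
    · rw [half_sub_rho, g0, if_neg (by positivity)]
      field_simp

/-! ### The Fermi function of a self-adjoint operator -/

section Fermi

variable {E : Type*} [NormedAddCommGroup E] [InnerProductSpace ℂ E]

/-- A sequence of operators whose quadratic forms converge converges weakly. -/
theorem exists_weak_limit [CompleteSpace E] {F : ℕ → E →L[ℂ] E}
    (hF : ∀ v, ∃ a : ℂ, Filter.Tendsto (fun N => (inner ℂ v (F N v) : ℂ)) Filter.atTop (nhds a)) :
    ∃ R : E →L[ℂ] E, ∀ u v,
      Filter.Tendsto (fun N => (inner ℂ u (F N v) : ℂ)) Filter.atTop (nhds (inner ℂ u (R v))) := by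
  have hpol : ∀ u v, ∃ a : ℂ,
      Filter.Tendsto (fun N => (inner ℂ u (F N v) : ℂ)) Filter.atTop (nhds a) := by
    intro u v
    have hconj : ∀ w, ∃ a : ℂ,
        Filter.Tendsto (fun N => (inner ℂ (F N w) w : ℂ)) Filter.atTop (nhds a) := by
      intro w
      obtain ⟨a, ha⟩ := hF w
      refine ⟨_, ((Complex.continuous_conj.tendsto a).comp ha).congr fun N => ?_⟩
      exact inner_conj_symm _ _
    obtain ⟨a, ha⟩ := hconj (u + v)
    obtain ⟨b, hb⟩ := hconj (u - v)
    obtain ⟨c, hc⟩ := hconj (u + Complex.I • v)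
    obtain ⟨d, hd⟩ := hconj (u - Complex.I • v)
    have h1 : Filter.Tendsto (fun N => (inner ℂ (F N v) u : ℂ)) Filter.atTop
        (nhds ((a - b + Complex.I * c - Complex.I * d) / 4)) := by
      refine ((((ha.sub hb).add (hc.const_mul _)).sub (hd.const_mul _)).div_const 4).congr
        fun N => ?_
      exact (inner_map_polarization (F N : E →ₗ[ℂ] E) u v).symm
    refine ⟨_, ((Complex.continuous_conj.tendsto _).comp h1).congr fun N => ?_⟩
    exact inner_conj_symm _ _
  choose B hB using hpol
  have hbdd : ∃ C, ∀ N, ‖F N‖ ≤ C := by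
    refine banach_steinhaus fun v => ?_
    have h1 : ∃ C, ∀ N, ‖innerSL ℂ (F N v)‖ ≤ C := by
      refine banach_steinhaus fun u => ?_
      obtain ⟨C, hC⟩ := (hB u v).norm.bddAbove_range
      refine ⟨C, fun N => ?_⟩
      rw [innerSL_apply_apply, norm_inner_symm]
      exact hC ⟨N, rfl⟩
    simpa only [innerSL_apply_norm] using h1
  obtain ⟨C, hC⟩ := hbdd
  let L : E →ₗ⋆[ℂ] E →ₗ[ℂ] ℂ := LinearMap.mk₂'ₛₗ (starRingEnd ℂ) (RingHom.id ℂ) B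
    (fun u u' v => tendsto_nhds_unique (hB (u + u') v) (((hB u v).add (hB u' v)).congr fun N =>
      (inner_add_left _ _ _).symm))
    (fun c u v => tendsto_nhds_unique (hB (c • u) v) (((hB u v).const_mul _).congr fun N =>
      (inner_smul_left _ _ _).symm))
    (fun u v v' => tendsto_nhds_unique (hB u (v + v')) (((hB u v).add (hB u v')).congr fun N => by
      rw [map_add, inner_add_right]))
    (fun c u v => tendsto_nhds_unique (hB u (c • v)) (((hB u v).const_mul c).congr fun N => by
      rw [map_smul, inner_smul_right]))
  have hL : ∀ u v, ‖L u v‖ ≤ C * ‖u‖ * ‖v‖ := by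
    intro u v
    refine le_of_tendsto (hB u v).norm (.of_forall fun N => ?_)
    calc _ ≤ ‖u‖ * ‖F N v‖ := norm_inner_le_norm _ _
      _ ≤ ‖u‖ * (C * ‖v‖) := by
          gcongr
          exact (F N).le_of_opNorm_le (hC N) v
      _ = _ := by ring
  let R' := InnerProductSpace.continuousLinearMapOfBilin (LinearMap.mkContinuous₂ L C hL)
  refine ⟨ContinuousLinearMap.adjoint R', fun u v => ?_⟩
  rw [ContinuousLinearMap.adjoint_inner_right,
    InnerProductSpace.continuousLinearMapOfBilin_apply]
  exact hB u v

namespace IsSymmetricSurjective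

variable {A : E →ₗ.[ℂ] E} (hA : IsSymmetricSurjective A)

/-- The partial sums `1/2 - β⁻¹ ∑_{n<N} ((A - iω_n)⁻¹ + (A + iω_n)⁻¹)` of the Matsubara expansion
of `ρ(βA)`. -/
noncomputable def fermiPartial (β : ℝ) (N : ℕ) : E →L[ℂ] E :=
  (1 / 2 : ℂ) • ContinuousLinearMap.id ℂ E - (1 / β : ℂ) • ∑ n ∈ Finset.range N,
    (hA.resolvent (matsubara β n * Complex.I) + hA.resolvent (-(matsubara β n * Complex.I)))

theorem inv_sub_add_inv_add {w : ℝ} (hw : w ≠ 0) (t : ℝ) :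
    ((t : ℂ) - w * Complex.I)⁻¹ + ((t : ℂ) - -(w * Complex.I))⁻¹ =
      ((2 * t / (t ^ 2 + w ^ 2) : ℝ) : ℂ) := by
  have h1 : (t : ℂ) - w * Complex.I ≠ 0 := by
    intro h
    have := congrArg Complex.im h
    simp at this
    exact hw this
  have h2 : (t : ℂ) - -(w * Complex.I) ≠ 0 := by
    intro h
    have := congrArg Complex.im h
    simp at this
    exact hw this
  have h3 : ((t : ℂ) ^ 2 + (w : ℂ) ^ 2) = (t - w * Complex.I) * (t - -(w * Complex.I)) := by
    linear_combination (w : ℂ) ^ 2 * Complex.I_sq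
  rw [inv_add_inv h1 h2, Complex.ofReal_div, Complex.ofReal_add, Complex.ofReal_pow,
    Complex.ofReal_pow, h3]
  congr 1
  push_cast; ring

theorem matsubara_mul_I_im {β : ℝ} (hβ : 0 < β) (n : ℕ) :
    ((matsubara β n : ℂ) * Complex.I).im ≠ 0 ∧ (-((matsubara β n : ℂ) * Complex.I)).im ≠ 0 := by
  have := matsubara_pos hβ n
  constructor
  · rw [Complex.im_ofReal_mul, Complex.I_im, mul_one]; exact this.ne'
  · rw [Complex.neg_im, Complex.im_ofReal_mul, Complex.I_im, mul_one]
    exact neg_ne_zero.2 this.ne'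

theorem integrable_inv_sub {ν : Measure ℝ} [IsFiniteMeasure ν] {z : ℂ} (hz : z.im ≠ 0) :
    Integrable (fun t : ℝ => ((t : ℂ) - z)⁻¹) ν := by
  refine Integrable.of_bound (C := |z.im|⁻¹)
    (by fun_prop : Measurable fun t : ℝ => ((t : ℂ) - z)⁻¹).aestronglyMeasurable
    (.of_forall fun t => ?_)
  rw [norm_inv]
  refine inv_anti₀ (abs_pos.2 hz) ?_
  have h := Complex.abs_im_le_norm ((t : ℂ) - z)
  rwa [Complex.sub_im, Complex.ofReal_im, zero_sub, abs_neg] at h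

theorem inner_fermiPartial [CompleteSpace E] {β : ℝ} (hβ : 0 < β) (N : ℕ) {v : E} {ν : Measure ℝ}
    (hν : IsSpectralMeasure A v ν) : (inner ℂ v (hA.fermiPartial β N v) : ℂ) =
      ((∫ t, (1 / 2 - ∑ n ∈ Finset.range N, 1 / β * (2 * t / (t ^ 2 + matsubara β n ^ 2))) ∂ν : ℝ) :
        ℂ) := by
  have := hν.1
  have hint : ∀ n, Integrable (fun t : ℝ => ((t : ℂ) - matsubara β n * Complex.I)⁻¹ +
      ((t : ℂ) - -(matsubara β n * Complex.I))⁻¹) ν := fun n =>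
    (integrable_inv_sub (matsubara_mul_I_im hβ n).1).add
      (integrable_inv_sub (matsubara_mul_I_im hβ n).2)
  have h1 : (inner ℂ v (hA.fermiPartial β N v) : ℂ) = 1 / 2 * ∫ _, (1 : ℂ) ∂ν -
      1 / β * ∑ n ∈ Finset.range N, ∫ t : ℝ, (((t : ℂ) - matsubara β n * Complex.I)⁻¹ +
        ((t : ℂ) - -(matsubara β n * Complex.I))⁻¹) ∂ν := by
    rw [hA.integral_one_spectralMeasure hν, fermiPartial, sub_apply, smul_apply, smul_apply,
      ContinuousLinearMap.id_apply, inner_sub_right, inner_smul_right, inner_smul_right, sum_apply,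
      inner_sum]
    congr 2
    refine Finset.sum_congr rfl fun n _ => ?_
    rw [add_apply, inner_add_right,
      hA.inner_resolvent_eq_integral hν (matsubara_mul_I_im hβ n).1,
      hA.inner_resolvent_eq_integral hν (matsubara_mul_I_im hβ n).2, ← integral_add
      (integrable_inv_sub (matsubara_mul_I_im hβ n).1)
      (integrable_inv_sub (matsubara_mul_I_im hβ n).2)]
  rw [h1, ← integral_finsetSum _ fun n _ => hint n, ← integral_const_mul, ← integral_const_mul,
    ← integral_sub ((integrable_const _).const_mul _)
      ((integrable_finsetSum _ fun n _ => hint n).const_mul _), ← integral_complex_ofReal]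
  refine integral_congr_ae (.of_forall fun t => ?_)
  simp only [inv_sub_add_inv_add (matsubara_pos hβ _).ne']
  rw [← Finset.mul_sum]
  push_cast
  ring

theorem tendsto_inner_fermiPartial [CompleteSpace E] {β : ℝ} (hβ : 0 < β) {v : E} {ν : Measure ℝ}
    (hν : IsSpectralMeasure A v ν) : Filter.Tendsto
      (fun N => (inner ℂ v (hA.fermiPartial β N v) : ℂ)) Filter.atTop
      (nhds ((∫ t, rho (β * t) ∂ν : ℝ) : ℂ)) := by
  have := hν.1
  simp only [hA.inner_fermiPartial hβ _ hν]
  refine (Complex.continuous_ofReal.tendsto _).comp ?_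
  refine tendsto_integral_of_dominated_convergence (fun _ => 1) (fun N => ?_) (integrable_const _)
    (fun N => .of_forall fun t => ?_) (.of_forall fun t => ?_)
  · refine Measurable.aestronglyMeasurable ?_
    fun_prop
  · -- the terms of the series all have the sign of `t`, and `|1/2 - ρ| ≤ 1/2`
    have hs := hasSum_half_sub_rho hβ t
    have hrho : 0 < rho (β * t) ∧ rho (β * t) < 1 := by
      have := Real.exp_pos (β * t)
      unfold rho
      exact ⟨by positivity, inv_lt_one_of_one_lt₀ (by linarith)⟩
    have hpos : ∀ n, 0 < t ^ 2 + matsubara β n ^ 2 := fun n => by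
      have := matsubara_pos hβ n
      positivity
    rcases le_total 0 t with ht | ht
    · have h1 := hs.summable.sum_le_tsum (Finset.range N) fun n _ => by
        have := hpos n; positivity
      have h2 : 0 ≤ ∑ n ∈ Finset.range N, 1 / β * (2 * t / (t ^ 2 + matsubara β n ^ 2)) :=
        Finset.sum_nonneg fun n _ => by have := hpos n; positivity
      rw [hs.tsum_eq] at h1
      rw [Real.norm_eq_abs, abs_le]
      constructor <;> linarith
    · have hneg : ∀ n, 1 / β * (2 * t / (t ^ 2 + matsubara β n ^ 2)) ≤ 0 := fun n =>
        mul_nonpos_of_nonneg_of_nonpos (by positivity)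
          (div_nonpos_of_nonpos_of_nonneg (by linarith) (hpos n).le)
      have h1 := hs.neg.summable.sum_le_tsum (Finset.range N) fun n _ => neg_nonneg.2 (hneg n)
      have h2 := Finset.sum_nonpos (s := Finset.range N) fun n _ => hneg n
      rw [hs.neg.tsum_eq, Finset.sum_neg_distrib] at h1
      rw [Real.norm_eq_abs, abs_le]
      constructor <;> linarith
  · have h := (hasSum_half_sub_rho hβ t).tendsto_sum_nat.const_sub (1 / 2)
    simpa using h

/-- The operator `ρ(βA)` exists, is unique, and is the weak limit of its Matsubara expansion. -/
theorem exists_fermi [CompleteSpace E] {β : ℝ} (hβ : 0 < β) : ∃ R : E →L[ℂ] E,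
    (∀ R' : E →L[ℂ] E, IsFunctionOf A (fun t => rho (β * t)) R' ↔ R' = R) ∧
    ∀ u v, Filter.Tendsto (fun N => (inner ℂ u (hA.fermiPartial β N v) : ℂ)) Filter.atTop
      (nhds (inner ℂ u (R v))) := by
  obtain ⟨R, hR⟩ := exists_weak_limit (F := hA.fermiPartial β) fun v => by
    obtain ⟨ν, hν⟩ := hA.exists_isSpectralMeasure v
    exact ⟨_, hA.tendsto_inner_fermiPartial hβ hν⟩
  refine ⟨R, fun R' => ⟨fun h => ?_, ?_⟩, hR⟩
  · have h1 : ∀ v, (inner ℂ (R' v) v : ℂ) = inner ℂ (R v) v := by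
      intro v
      obtain ⟨ν, hν, hv⟩ := h.2 v
      rw [← inner_conj_symm, ← inner_conj_symm (R v), hv,
        tendsto_nhds_unique (hR v v) (hA.tendsto_inner_fermiPartial hβ hν)]
    ext v
    exact congrArg (fun T : E →ₗ[ℂ] E => T v)
      ((ext_inner_map (R' : E →ₗ[ℂ] E) (R : E →ₗ[ℂ] E)).1 h1)
  · rintro rfl
    refine ⟨hA.isSelfAdjoint, fun v => ?_⟩
    obtain ⟨ν, hν⟩ := hA.exists_isSpectralMeasure v
    exact ⟨ν, hν, tendsto_nhds_unique (hR v v) (hA.tendsto_inner_fermiPartial hβ hν)⟩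

end IsSymmetricSurjective

end Fermi

/-! ### Bounded perturbations of self-adjoint operators -/

section Perturbation

variable {E : Type*} [NormedAddCommGroup E] [InnerProductSpace ℂ E]

theorem surjective_add_of_norm_lt [CompleteSpace E] {D : Submodule ℂ E} {L : D →ₗ[ℂ] E} {c : ℝ}
    (hc : 0 < c) (hL : Function.Surjective L) (hLc : ∀ u : D, c * ‖(u : E)‖ ≤ ‖L u‖) {T : E →L[ℂ] E}
    (hT : ‖T‖ < c) (v : E) : ∃ u : D, L u + T u = v := by
  have hinj : Function.Injective L := by
    rw [← LinearMap.ker_eq_bot, LinearMap.ker_eq_bot']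
    intro u hu
    have h1 := hLc u
    rw [hu, norm_zero] at h1
    have h2 : ‖(u : E)‖ ≤ 0 := by
      by_contra! h
      nlinarith
    exact Subtype.ext (norm_le_zero_iff.1 h2)
  let e := LinearEquiv.ofBijective L ⟨hinj, hL⟩
  have he : ∀ w, L (e.symm w) = w := fun w => e.apply_symm_apply w
  let S : E →L[ℂ] E := (D.subtype ∘ₗ (e.symm : E →ₗ[ℂ] D)).mkContinuous c⁻¹ fun w => by
    have h := hLc (e.symm w)
    rw [he] at h
    rw [inv_mul_eq_div, le_div_iff₀' hc]
    exact h
  have hS : ‖S‖ ≤ c⁻¹ := LinearMap.mkContinuous_norm_le _ (by positivity) _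
  have hTS : ‖-(T * S)‖ < 1 := by
    rw [norm_neg]
    calc ‖T * S‖ ≤ ‖T‖ * ‖S‖ := norm_mul_le _ _
      _ ≤ ‖T‖ * c⁻¹ := by gcongr
      _ < c * c⁻¹ := by gcongr
      _ = 1 := mul_inv_cancel₀ hc.ne'
  obtain ⟨U, hU⟩ := isUnit_one_sub_of_norm_lt_one hTS
  refine ⟨e.symm ((↑U⁻¹ : E →L[ℂ] E) v), ?_⟩
  have h1 : (U : E →L[ℂ] E) ((↑U⁻¹ : E →L[ℂ] E) v) = v :=
    congrArg (fun f : E →L[ℂ] E => f v) U.mul_inv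
  rw [hU, sub_neg_eq_add] at h1
  rw [he]
  exact h1

/-- Self-adjointness is stable under bounded symmetric perturbations. -/
theorem IsSymmetricSurjective.add_bounded [CompleteSpace E] {A B : E →ₗ.[ℂ] E}
    (hA : IsSymmetricSurjective A) {V : E →L[ℂ] E}
    (hV : ∀ u v, (inner ℂ (V u) v : ℂ) = inner ℂ u (V v)) (hdom : A.domain = B.domain)
    (hB : ∀ u : E, ∀ h : u ∈ A.domain, ∀ h' : u ∈ B.domain, B ⟨u, h'⟩ = A ⟨u, h⟩ + V u) :
    IsSymmetricSurjective B := by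
  have hsymm : ∀ u v : B.domain, (inner ℂ (B u) (v : E) : ℂ) = inner ℂ (u : E) (B v) := by
    rintro ⟨u, hu⟩ ⟨v, hv⟩
    have hu' : u ∈ A.domain := hdom ▸ hu
    have hv' : v ∈ A.domain := hdom ▸ hv
    rw [hB u hu' hu, hB v hv' hv, inner_add_left, inner_add_right, hV]
    exact congrArg (· + _) (hA.symm ⟨u, hu'⟩ ⟨v, hv'⟩)
  refine ⟨hsymm, fun z hz => ?_⟩
  -- `B - z₀` is onto for `|Im z₀| > ‖V‖`, and then so is `B - z` for `|z - z₀| < |Im z₀|`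
  obtain ⟨z₀, h1, h2⟩ : ∃ z₀ : ℂ, ‖V‖ < |z₀.im| ∧ ‖z₀ - z‖ < |z₀.im| := by
    have hV0 := norm_nonneg V
    rcases lt_or_gt_of_ne hz with h | h
    · refine ⟨z - ((‖V‖ + 1 : ℝ) : ℂ) * Complex.I, ?_, ?_⟩
      · rw [Complex.sub_im, Complex.im_ofReal_mul, Complex.I_im, mul_one, abs_of_neg] <;> linarith
      · rw [sub_sub_cancel_left, norm_neg, norm_mul, Complex.norm_I, Complex.norm_real,
          Real.norm_eq_abs, mul_one, abs_of_pos (by positivity), Complex.sub_im,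
          Complex.im_ofReal_mul,
          Complex.I_im, mul_one, abs_of_neg (by linarith)]; linarith
    · refine ⟨z + ((‖V‖ + 1 : ℝ) : ℂ) * Complex.I, ?_, ?_⟩
      · rw [Complex.add_im, Complex.im_ofReal_mul, Complex.I_im, mul_one, abs_of_pos] <;> linarith
      · rw [add_sub_cancel_left, norm_mul, Complex.norm_I, Complex.norm_real,
          Real.norm_eq_abs, mul_one, abs_of_pos (by positivity), Complex.add_im,
          Complex.im_ofReal_mul,
          Complex.I_im, mul_one, abs_of_pos (by linarith)]; linarith
  have h3 : 0 < |z₀.im| := (norm_nonneg V).trans_lt h1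
  have hz₀ : z₀.im ≠ 0 := abs_pos.1 h3
  have hsurj₀ : ∀ v, ∃ u : B.domain, B u - z₀ • (u : E) = v := by
    intro v
    obtain ⟨u, hu⟩ := surjective_add_of_norm_lt (L := A.toFun - z₀ • A.domain.subtype) h3
      (fun v => hA.surj z₀ hz₀ v) (abs_im_mul_norm_le hA.symm z₀) h1 v
    refine ⟨⟨u, hdom ▸ u.2⟩, ?_⟩
    rw [hB u u.2, ← hu]
    change A u + V u - z₀ • (u : E) = A u - z₀ • (u : E) + V u
    abel
  intro v
  have hT : ‖(z₀ - z) • ContinuousLinearMap.id ℂ E‖ < |z₀.im| := by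
    refine lt_of_le_of_lt ?_ h2
    rw [norm_smul]
    exact mul_le_of_le_one_right (norm_nonneg _) ContinuousLinearMap.norm_id_le
  obtain ⟨u, hu⟩ := surjective_add_of_norm_lt (L := B.toFun - z₀ • B.domain.subtype) h3
    hsurj₀ (abs_im_mul_norm_le hsymm z₀) hT v
  refine ⟨u, ?_⟩
  rw [← hu]
  change B u - z • (u : E) = B u - z₀ • (u : E) + (z₀ - z) • (u : E)
  rw [sub_smul]; abel

end Perturbation

/-! ### The free resolvent -/

theorem fourier_negLaplacian (u : negLaplacian.domain) :
    (𝓕 (negLaplacian u) : L2) =ᵐ[volume]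
      fun ξ => ((2 * Real.pi * ξ : ℝ) : ℂ) ^ 2 * (𝓕 (u : L2) : L2) ξ := by
  have h : (𝓕 (negLaplacian u) : L2) = MemLp.toLp _ u.2 :=
    (Lp.fourierTransformₗᵢ ℝ ℂ).apply_symm_apply _
  rw [h]
  exact MemLp.coeFn_toLp _

theorem inner_negLaplacian (u v : negLaplacian.domain) :
    (inner ℂ (negLaplacian u) (v : L2) : ℂ) = inner ℂ (u : L2) (negLaplacian v) := by
  rw [← (Lp.fourierTransformₗᵢ ℝ ℂ).inner_map_map, ← (Lp.fourierTransformₗᵢ ℝ ℂ).inner_map_map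
    (u : L2), inner_L2_eq, inner_L2_eq]
  refine integral_congr_ae ?_
  filter_upwards [fourier_negLaplacian u, fourier_negLaplacian v] with ξ h1 h2
  change star ((𝓕 (negLaplacian u) : L2) ξ) * (𝓕 (v : L2) : L2) ξ =
    star ((𝓕 (u : L2) : L2) ξ) * (𝓕 (negLaplacian v) : L2) ξ
  rw [h1, h2]
  simp
  ring

/-- The symbol `(h²p² - μ - z)⁻¹` of the resolvent of `k₀ = -h²∇² - μ`. -/
noncomputable def resSymbol (h μ : ℝ) (z : ℂ) (p : ℝ) : ℂ := (((h ^ 2 * p ^ 2 - μ : ℝ) : ℂ) - z)⁻¹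

/-- The resolvent `(k₀ - z)⁻¹` of `k₀ = -h²∇² - μ`. -/
noncomputable def freeResolvent (h μ : ℝ) (z : ℂ) : L2 →L[ℂ] L2 := momentumOp (resSymbol h μ z)

section FreeResolvent

variable {h μ : ℝ} {z : ℂ}

theorem ofReal_sub_ne_zero (hz : z.im ≠ 0) (t : ℝ) : (t : ℂ) - z ≠ 0 := fun h0 => hz (by
  have := congrArg Complex.im h0
  simpa using this)

theorem norm_resSymbol_le (h μ : ℝ) (hz : z.im ≠ 0) (p : ℝ) : ‖resSymbol h μ z p‖ ≤ |z.im|⁻¹ := by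
  rw [resSymbol, norm_inv]
  refine inv_anti₀ (abs_pos.2 hz) ?_
  have h := Complex.abs_im_le_norm (((h ^ 2 * p ^ 2 - μ : ℝ) : ℂ) - z)
  rwa [Complex.sub_im, Complex.ofReal_im, zero_sub, abs_neg] at h

theorem isSymbol_resSymbol (h μ : ℝ) (hz : z.im ≠ 0) : IsSymbol (resSymbol h μ z) :=
  ⟨by unfold resSymbol; fun_prop, _, norm_resSymbol_le h μ hz⟩

theorem norm_freeResolvent_le (h μ : ℝ) (hz : z.im ≠ 0) : ‖freeResolvent h μ z‖ ≤ |z.im|⁻¹ :=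
  norm_momentumOp_le (by positivity) (norm_resSymbol_le h μ hz)

theorem adjoint_freeResolvent (h μ : ℝ) (hz : z.im ≠ 0) :
    ContinuousLinearMap.adjoint (freeResolvent h μ z) = freeResolvent h μ (star z) := by
  rw [freeResolvent, adjoint_momentumOp (isSymbol_resSymbol h μ hz), freeResolvent]
  congr 1
  funext p
  simp [resSymbol]

/-- `(k₀ - z)u = f` if and only if `u = (k₀ - z)⁻¹ f`. -/
theorem eq_freeResolvent_iff (hh : h ≠ 0) (hz : z.im ≠ 0) {u f : L2} :
    u = freeResolvent h μ z f ↔ ∃ hu : u ∈ negLaplacian.domain,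
      ((h ^ 2 : ℝ) : ℂ) • negLaplacian ⟨u, hu⟩ - (μ : ℂ) • u - z • u = f := by
  have hsym := isSymbol_resSymbol h μ hz
  have hsub : ∀ hu : u ∈ negLaplacian.domain,
      (𝓕 (((h ^ 2 : ℝ) : ℂ) • negLaplacian ⟨u, hu⟩ - (μ : ℂ) • u - z • u) : L2) =ᵐ[volume]
        fun ξ => (((h ^ 2 * (2 * Real.pi * ξ) ^ 2 - μ : ℝ) : ℂ) - z) * (𝓕 u : L2) ξ := by
    intro hu
    rw [fourier_sub, fourier_sub, fourier_smul, fourier_smul, fourier_smul]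
    filter_upwards [fourier_negLaplacian ⟨u, hu⟩,
      Lp.coeFn_sub (((h ^ 2 : ℝ) : ℂ) • (𝓕 (negLaplacian ⟨u, hu⟩) : L2) - (μ : ℂ) • (𝓕 u : L2))
        (z • (𝓕 u : L2)),
      Lp.coeFn_sub (((h ^ 2 : ℝ) : ℂ) • (𝓕 (negLaplacian ⟨u, hu⟩) : L2)) ((μ : ℂ) • (𝓕 u : L2)),
      Lp.coeFn_smul ((h ^ 2 : ℝ) : ℂ) (𝓕 (negLaplacian ⟨u, hu⟩) : L2),
      Lp.coeFn_smul (μ : ℂ) (𝓕 u : L2), Lp.coeFn_smul z (𝓕 u : L2)] with ξ h1 h2 h3 h4 h5 h6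
    rw [h2, Pi.sub_apply, h3, Pi.sub_apply, h4, h5, h6]
    simp only [Pi.smul_apply, smul_eq_mul]
    rw [h1]
    push_cast
    ring
  constructor
  · intro hu
    have hF : (𝓕 u : L2) =ᵐ[volume] fun ξ => resSymbol h μ z (2 * Real.pi * ξ) * (𝓕 f : L2) ξ := by
      rw [hu]; exact fourier_momentumOp hsym f
    have hmem : u ∈ negLaplacian.domain := by
      -- `p² (h²p² - μ - z)⁻¹ = h⁻² (1 + (μ + z) (h²p² - μ - z)⁻¹)` is bounded
      have h1 : IsSymbol fun p => ((h ^ 2 : ℝ) : ℂ)⁻¹ * (1 + (μ + z) * resSymbol h μ z p) :=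
        (IsSymbol.const _).mul ((IsSymbol.const _).add ((IsSymbol.const _).mul hsym))
      refine (memLp_congr_ae ?_).2 (Lp.memLp (𝓕 (momentumOp (fun p =>
        ((h ^ 2 : ℝ) : ℂ)⁻¹ * (1 + (μ + z) * resSymbol h μ z p)) f) : L2))
      filter_upwards [hF, fourier_momentumOp h1 f] with ξ h2 h3
      rw [h2, h3, ← mul_assoc]
      congr 1
      have h4 := ofReal_sub_ne_zero hz (h ^ 2 * (2 * Real.pi * ξ) ^ 2 - μ)
      have h5 : ((h ^ 2 : ℝ) : ℂ) ≠ 0 := by exact_mod_cast pow_ne_zero 2 hh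
      have h6 : ((h ^ 2 : ℝ) : ℂ) * ((2 * Real.pi * ξ : ℝ) : ℂ) ^ 2 =
          ((h ^ 2 * (2 * Real.pi * ξ) ^ 2 - μ : ℝ) : ℂ) - z + (μ + z) := by
        push_cast
        ring
      rw [resSymbol, eq_inv_mul_iff_mul_eq₀ h5, ← mul_assoc, h6, add_mul, mul_inv_cancel₀ h4]
    refine ⟨hmem, eq_of_fourier_ae_eq ((hsub hmem).trans ?_)⟩
    filter_upwards [hF] with ξ h1
    rw [h1, ← mul_assoc, resSymbol, mul_inv_cancel₀ (ofReal_sub_ne_zero hz _), one_mul]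
  · rintro ⟨hu, rfl⟩
    refine eq_of_fourier_ae_eq (((fourier_momentumOp hsym _).trans ?_).symm)
    filter_upwards [hsub hu] with ξ h1
    rw [h1, ← mul_assoc, resSymbol, inv_mul_cancel₀ (ofReal_sub_ne_zero hz _), one_mul]

end FreeResolvent

/-! ### Self-adjointness and resolvent of `H_Δ` -/

theorem kOp_apply (h μ : ℝ) (W : ℝ → ℝ) (u : L2) (hu : u ∈ negLaplacian.domain) :
    kOp h μ W ⟨u, hu⟩ = ((h ^ 2 : ℝ) : ℂ) • negLaplacian ⟨u, hu⟩ - (μ : ℂ) • u +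
      ((h ^ 2 : ℝ) : ℂ) • mulOp (fun x => (W x : ℂ)) u := by
  have h1 : kOp h μ W ⟨u, hu⟩ = ((h ^ 2 : ℝ) : ℂ) • negLaplacian ⟨u, hu⟩ + (-(μ : ℂ) • u +
      ((h ^ 2 : ℝ) : ℂ) • mulOp (fun x => (W x : ℂ)) u) := rfl
  rw [h1, neg_smul]; abel

theorem mulOp_zero : mulOp (fun _ => (0 : ℂ)) = 0 := by
  have h : ‖mulOp (fun _ => (0 : ℂ))‖ ≤ 0 := mulOp_norm_le le_rfl (.of_forall fun _ => by simp)
  exact norm_le_zero_iff.1 h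

theorem inner_L2Sum (x y : L2Sum) :
    (inner ℂ x y : ℂ) = inner ℂ x.fst y.fst + inner ℂ x.snd y.snd :=
  WithLp.prod_inner_apply x y

section HΔ

variable {h μ : ℝ} {W : ℝ → ℝ} {Δ : ℝ → ℂ}

/-- The diagonal operator `H_0 = (k₀, 0; 0, -k₀)`. -/
theorem isSymmetricSurjective_HΔ_zero (hh : h ≠ 0) (μ : ℝ) :
    IsSymmetricSurjective (HΔ h μ (fun _ => 0) fun _ => 0) := by
  have hW : mulOp (fun _ => ((0 : ℝ) : ℂ)) = 0 := by simpa using mulOp_zero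
  have hst : mulOp (fun _ => star (0 : ℂ)) = 0 := by simpa using mulOp_zero
  have hval : ∀ (x : L2Sum) (h1 : x.fst ∈ negLaplacian.domain) (h2 : x.snd ∈ negLaplacian.domain),
      HΔ h μ (fun _ => 0) (fun _ => 0) ⟨x, h1, h2⟩ = WithLp.toLp 2
        (((h ^ 2 : ℝ) : ℂ) • negLaplacian ⟨x.fst, h1⟩ - (μ : ℂ) • x.fst,
          -(((h ^ 2 : ℝ) : ℂ) • negLaplacian ⟨x.snd, h2⟩ - (μ : ℂ) • x.snd)) := by
    intro x h1 h2
    change WithLp.toLp 2 (kOp h μ (fun _ => 0) ⟨x.fst, h1⟩ + mulOp (fun _ => 0) x.snd,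
      mulOp (fun _ => star (0 : ℂ)) x.fst - kOp h μ (fun _ => 0) ⟨x.snd, h2⟩) = _
    rw [kOp_apply, kOp_apply, hW, hst, mulOp_zero]
    simp
  have hk : ∀ u v : negLaplacian.domain,
      (inner ℂ (((h ^ 2 : ℝ) : ℂ) • negLaplacian u - (μ : ℂ) • (u : L2)) (v : L2) : ℂ) =
        inner ℂ (u : L2) (((h ^ 2 : ℝ) : ℂ) • negLaplacian v - (μ : ℂ) • (v : L2)) := by
    intro u v
    rw [inner_sub_left, inner_sub_right, inner_smul_left, inner_smul_left, inner_smul_right,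
      inner_smul_right, inner_negLaplacian, Complex.conj_ofReal, Complex.conj_ofReal]
  refine ⟨?_, fun z hz v => ?_⟩
  · rintro ⟨u, hu1, hu2⟩ ⟨v, hv1, hv2⟩
    rw [hval u hu1 hu2, hval v hv1 hv2, inner_L2Sum, inner_L2Sum]
    change inner ℂ (_ - _) v.fst + inner ℂ (-(_ - _)) v.snd =
      inner ℂ u.fst (_ - _) + inner ℂ u.snd (-(_ - _))
    rw [inner_neg_left, inner_neg_right, hk ⟨u.fst, hu1⟩ ⟨v.fst, hv1⟩,
      hk ⟨u.snd, hu2⟩ ⟨v.snd, hv2⟩]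
  · have hz' : (-z).im ≠ 0 := by simpa using hz
    obtain ⟨a, ha, ha'⟩ : ∃ a, ∃ ha : a ∈ negLaplacian.domain,
        ((h ^ 2 : ℝ) : ℂ) • negLaplacian ⟨a, ha⟩ - (μ : ℂ) • a - z • a = v.fst :=
      ⟨_, (eq_freeResolvent_iff (μ := μ) hh hz (f := v.fst)).1 rfl⟩
    obtain ⟨b, hb, hb'⟩ : ∃ b, ∃ hb : b ∈ negLaplacian.domain,
        ((h ^ 2 : ℝ) : ℂ) • negLaplacian ⟨b, hb⟩ - (μ : ℂ) • b - (-z) • b = -v.snd :=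
      ⟨_, (eq_freeResolvent_iff (μ := μ) hh hz' (f := -v.snd)).1 rfl⟩
    refine ⟨⟨WithLp.toLp 2 (a, b), ha, hb⟩, ?_⟩
    rw [hval (WithLp.toLp 2 (a, b)) ha hb]
    change WithLp.toLp 2 (((h ^ 2 : ℝ) : ℂ) • negLaplacian ⟨a, ha⟩ - (μ : ℂ) • a,
      -(((h ^ 2 : ℝ) : ℂ) • negLaplacian ⟨b, hb⟩ - (μ : ℂ) • b)) - z • WithLp.toLp 2 (a, b) = v
    rw [← WithLp.toLp_smul, ← WithLp.toLp_sub, Prod.smul_mk, Prod.mk_sub_mk, ha']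
    rw [← neg_eq_iff_eq_neg] at hb'
    have h1 : -(((h ^ 2 : ℝ) : ℂ) • negLaplacian ⟨b, hb⟩ - (μ : ℂ) • b) - z • b = v.snd := by
      rw [← hb', neg_smul]
      abel
    rw [h1]
    rfl

/-- The potential and the pairing function are essentially bounded. -/
structure IsBoundedData (W : ℝ → ℝ) (Δ : ℝ → ℂ) : Prop where
  memLp_W : MemLp (fun x => (W x : ℂ)) ∞ volume
  memLp_Δ : MemLp Δ ∞ volume

/-- The bounded part `(h²W, Δ; conj Δ, -h²W)` of `H_Δ`. -/
noncomputable def boundedPart (h : ℝ) (W : ℝ → ℝ) (Δ : ℝ → ℂ) : L2Sum →L[ℂ] L2Sum :=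
  ((WithLp.prodContinuousLinearEquiv 2 ℂ L2 L2).symm : L2 × L2 →L[ℂ] L2Sum) ∘L
    ContinuousLinearMap.prod
      (((h ^ 2 : ℝ) : ℂ) • mulOp (fun x => (W x : ℂ)) ∘L WithLp.fstL 2 ℂ L2 L2 +
        mulOp Δ ∘L WithLp.sndL 2 ℂ L2 L2)
      (mulOp (fun y => star (Δ y)) ∘L WithLp.fstL 2 ℂ L2 L2 -
        ((h ^ 2 : ℝ) : ℂ) • mulOp (fun x => (W x : ℂ)) ∘L WithLp.sndL 2 ℂ L2 L2)

theorem isSymmetricSurjective_HΔ (hh : h ≠ 0) (μ : ℝ) (hd : IsBoundedData W Δ) :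
    IsSymmetricSurjective (HΔ h μ W Δ) := by
  refine (isSymmetricSurjective_HΔ_zero hh μ).add_bounded (V := boundedPart h W Δ) ?_ rfl ?_
  · intro u v
    have hWs : ∀ a b : L2, (inner ℂ (mulOp (fun x => (W x : ℂ)) a) b : ℂ) =
        inner ℂ a (mulOp (fun x => (W x : ℂ)) b) := by
      intro a b
      rw [inner_mulOp_left hd.memLp_W]
      simp
    have e1 : ∀ w, boundedPart h W Δ w = WithLp.toLp 2
        (((h ^ 2 : ℝ) : ℂ) • mulOp (fun x => (W x : ℂ)) w.fst + mulOp Δ w.snd,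
        mulOp (fun y => star (Δ y)) w.fst -
          ((h ^ 2 : ℝ) : ℂ) • mulOp (fun x => (W x : ℂ)) w.snd) := fun w => rfl
    rw [e1, e1, inner_L2Sum, inner_L2Sum]
    change inner ℂ (_ + _) v.fst + inner ℂ (_ - _) v.snd =
      inner ℂ u.fst (_ + _) + inner ℂ u.snd (_ - _)
    simp only [inner_add_left, inner_add_right, inner_sub_left, inner_sub_right, inner_smul_left,
      inner_smul_right, Complex.conj_ofReal, hWs]
    rw [inner_mulOp_left hd.memLp_Δ, inner_mulOp_left (memLp_top_star hd.memLp_Δ)]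
    simp only [star_star]
    ring
  · intro u h1 h2
    have hW : mulOp (fun _ => ((0 : ℝ) : ℂ)) = 0 := by simpa using mulOp_zero
    have hst : mulOp (fun _ => star (0 : ℂ)) = 0 := by simpa using mulOp_zero
    change WithLp.toLp 2 (kOp h μ W ⟨u.fst, h1.1⟩ + mulOp Δ u.snd,
      mulOp (fun y => star (Δ y)) u.fst - kOp h μ W ⟨u.snd, h1.2⟩) =
      WithLp.toLp 2 (kOp h μ (fun _ => 0) ⟨u.fst, h1.1⟩ + mulOp (fun _ => 0) u.snd,
      mulOp (fun _ => star (0 : ℂ)) u.fst - kOp h μ (fun _ => 0) ⟨u.snd, h1.2⟩) + WithLp.toLp 2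
        (((h ^ 2 : ℝ) : ℂ) • mulOp (fun x => (W x : ℂ)) u.fst + mulOp Δ u.snd,
        mulOp (fun y => star (Δ y)) u.fst -
          ((h ^ 2 : ℝ) : ℂ) • mulOp (fun x => (W x : ℂ)) u.snd)
    rw [← WithLp.toLp_add, kOp_apply, kOp_apply, kOp_apply, kOp_apply, hW, hst, mulOp_zero]
    congr 1
    refine Prod.ext ?_ ?_
    · change _ - _ + _ + _ = _ - _ + _ • (0 : L2) + (0 : L2) + (_ + _)
      rw [smul_zero]
      abel
    · change _ - (_ - _ + _) = (0 : L2) - (_ - _ + _ • (0 : L2)) + (_ - _)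
      rw [smul_zero]
      abel

/-- The resolvent equation for `H_Δ`, written as a system of fixed point equations in terms of the
free resolvent. -/
theorem eq_resolvent_HΔ_iff (hh : h ≠ 0) (hA : IsSymmetricSurjective (HΔ h μ W Δ)) {z : ℂ}
    (hz : z.im ≠ 0) (x y : L2Sum) :
    x = hA.resolvent z y ↔
      x.fst = freeResolvent h μ z (y.fst - ((h ^ 2 : ℝ) : ℂ) • mulOp (fun x => (W x : ℂ)) x.fst -
        mulOp Δ x.snd) ∧
      x.snd = freeResolvent h μ (-z) (mulOp (fun y => star (Δ y)) x.fst -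
        ((h ^ 2 : ℝ) : ℂ) • mulOp (fun x => (W x : ℂ)) x.snd - y.snd) := by
  have hz' : (-z).im ≠ 0 := by simpa using hz
  rw [eq_freeResolvent_iff hh hz, eq_freeResolvent_iff hh hz']
  constructor
  · intro hx
    obtain ⟨u, hu, hu'⟩ := hA.exists_eq_resolvent hz y
    obtain ⟨u, hu1, hu2⟩ := u
    rw [← hx] at hu
    change u = x at hu
    subst hu
    have h1 : kOp h μ W ⟨u.fst, hu1⟩ + mulOp Δ u.snd - z • u.fst = y.fst :=
      congrArg (fun w : L2Sum => w.fst) hu'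
    have h2 : mulOp (fun y => star (Δ y)) u.fst - kOp h μ W ⟨u.snd, hu2⟩ - z • u.snd = y.snd :=
      congrArg (fun w : L2Sum => w.snd) hu'
    refine ⟨⟨hu1, ?_⟩, hu2, ?_⟩
    · rw [← h1, kOp_apply]; abel
    · rw [← h2, kOp_apply, neg_smul]; abel
  · rintro ⟨⟨hu1, h1⟩, hu2, h2⟩
    have h3 := hA.resolvent_eq hz ⟨x, hu1, hu2⟩
    have h4 : HΔ h μ W Δ ⟨x, hu1, hu2⟩ - z • x = y := by
      refine (WithLp.ofLp_injective 2) (Prod.ext ?_ ?_)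
      · change kOp h μ W ⟨x.fst, hu1⟩ + mulOp Δ x.snd - z • x.fst = y.fst
        rw [kOp_apply]
        rw [eq_sub_iff_add_eq, eq_sub_iff_add_eq] at h1
        rw [← h1]; abel
      · change mulOp (fun y => star (Δ y)) x.fst - kOp h μ W ⟨x.snd, hu2⟩ - z • x.snd = y.snd
        rw [kOp_apply]
        rw [neg_smul, eq_sub_iff_add_eq, ← eq_sub_iff_add_eq'] at h2
        rw [h2]; abel
    change hA.resolvent z (HΔ h μ W Δ ⟨x, hu1, hu2⟩ - z • x) = x at h3
    rw [h4] at h3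
    exact h3.symm

/-- The entry `[B]₂₂` of an operator `B` on `L²(ℝ) ⊕ L²(ℝ)`. -/
noncomputable def entry22 (B : L2Sum →L[ℂ] L2Sum) : L2 →L[ℂ] L2 :=
  WithLp.sndL 2 ℂ L2 L2 ∘L B ∘L
    ((WithLp.prodContinuousLinearEquiv 2 ℂ L2 L2).symm : L2 × L2 →L[ℂ] L2Sum) ∘L
    ContinuousLinearMap.inr ℂ L2 L2

theorem entry12_apply (B : L2Sum →L[ℂ] L2Sum) (u : L2) :
    entry12 B u = (B (WithLp.toLp 2 (0, u))).fst := rfl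

theorem entry22_apply (B : L2Sum →L[ℂ] L2Sum) (u : L2) :
    entry22 B u = (B (WithLp.toLp 2 (0, u))).snd := rfl

theorem norm_toLp_zero (u : L2) : ‖(WithLp.toLp 2 (0, u) : L2Sum)‖ = ‖u‖ := by
  rw [WithLp.prod_norm_eq_of_L2]
  simp

theorem norm_snd_le (x : L2Sum) : ‖x.snd‖ ≤ ‖x‖ := by
  rw [WithLp.prod_norm_eq_of_L2]
  exact Real.le_sqrt_of_sq_le (by nlinarith [sq_nonneg ‖x.fst‖])

theorem norm_entry22_le (B : L2Sum →L[ℂ] L2Sum) : ‖entry22 B‖ ≤ ‖B‖ := by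
  refine ContinuousLinearMap.opNorm_le_bound _ (norm_nonneg _) fun u => ?_
  rw [entry22_apply]
  refine (norm_snd_le _).trans ((B.le_opNorm _).trans_eq ?_)
  rw [norm_toLp_zero]

section Entries

variable (hh : h ≠ 0) (hA : IsSymmetricSurjective (HΔ h μ W Δ)) {z : ℂ} (hz : z.im ≠ 0)

include hh hz in
theorem entry12_resolvent_eq :
    entry12 (hA.resolvent z) = -(freeResolvent h μ z ∘L
      (((h ^ 2 : ℝ) : ℂ) • mulOp (fun x => (W x : ℂ)) ∘L entry12 (hA.resolvent z) +
        mulOp Δ ∘L entry22 (hA.resolvent z))) := by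
  ext1 u
  have h1 := ((eq_resolvent_HΔ_iff hh hA hz _ (WithLp.toLp 2 (0, u))).1 rfl).1
  rw [← entry12_apply, ← entry22_apply] at h1
  rw [neg_apply, ContinuousLinearMap.comp_apply, ← map_neg]
  refine h1.trans (congrArg _ ?_)
  change (0 : L2) - _ - _ = -(_ + _)
  abel

include hh hz in
theorem entry22_resolvent_eq :
    entry22 (hA.resolvent z) = freeResolvent h μ (-z) ∘L
      (mulOp (fun y => star (Δ y)) ∘L entry12 (hA.resolvent z) -
        ((h ^ 2 : ℝ) : ℂ) • mulOp (fun x => (W x : ℂ)) ∘L entry22 (hA.resolvent z) -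
        ContinuousLinearMap.id ℂ L2) := by
  ext1 u
  have h1 := ((eq_resolvent_HΔ_iff hh hA hz _ (WithLp.toLp 2 (0, u))).1 rfl).2
  rw [← entry12_apply, ← entry22_apply] at h1
  exact h1

include hh hz in
theorem resolvent_HΔ_periodic (hd : IsBoundedData W Δ) (hW : Function.Periodic W 1)
    (hΔ : Function.Periodic Δ 1) :
    IsPeriodicOp (entry12 (hA.resolvent z)) ∧ IsPeriodicOp (entry22 (hA.resolvent z)) := by
  have hz' : (-z).im ≠ 0 := by simpa using hz
  have hr : IsPeriodicOp (freeResolvent h μ z) := momentumOp_periodic (isSymbol_resSymbol h μ hz)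
  have hr' : IsPeriodicOp (freeResolvent h μ (-z)) :=
    momentumOp_periodic (isSymbol_resSymbol h μ hz')
  have hWp : IsPeriodicOp (mulOp fun x => (W x : ℂ)) :=
    mulOp_periodic hd.memLp_W fun x => by simp only [hW x]
  have hΔp : IsPeriodicOp (mulOp Δ) := mulOp_periodic hd.memLp_Δ hΔ
  have hΔs : IsPeriodicOp (mulOp fun x => star (Δ x)) :=
    mulOp_periodic (memLp_top_star hd.memLp_Δ) fun x => by simp only [hΔ x]
  have key : ∀ u : L2, (WithLp.toLp 2 (translation (entry12 (hA.resolvent z) u),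
      translation (entry22 (hA.resolvent z) u)) : L2Sum) =
      hA.resolvent z (WithLp.toLp 2 (0, translation u)) := by
    intro u
    rw [eq_resolvent_HΔ_iff hh hA hz]
    have h1 := (eq_resolvent_HΔ_iff hh hA hz _ (WithLp.toLp 2 (0, u))).1 rfl
    rw [← entry12_apply, ← entry22_apply] at h1
    refine ⟨(congrArg translation h1.1).trans ?_, (congrArg translation h1.2).trans ?_⟩
    · rw [← hr]
      refine congrArg (freeResolvent h μ z) ?_
      rw [map_sub, map_sub, map_smul, ← hWp, ← hΔp]
      change translation 0 - _ - _ = 0 - _ - _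
      rw [map_zero]
      rfl
    · rw [← hr']
      refine congrArg (freeResolvent h μ (-z)) ?_
      rw [map_sub, map_sub, map_smul, ← hWp, ← hΔs]
      rfl
  refine ⟨fun u => ?_, fun u => ?_⟩
  · rw [entry12_apply, ← key]; rfl
  · rw [entry22_apply, ← key]; rfl

end Entries

end HΔ

/-! ### Fourier series of periodic functions -/

/-- The Fourier coefficient `∫₀¹ e^{-2πilx} f(x) dx`. -/
noncomputable def coeff (f : ℝ → ℂ) (l : ℤ) : ℂ := ∫ x in Set.Icc (0 : ℝ) 1, cexpi (-l) x * f x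

theorem coeff_eq_fourierCoeffOn (f : ℝ → ℂ) (l : ℤ) :
    coeff f l = fourierCoeffOn (zero_lt_one (α := ℝ)) f l := by
  rw [fourierCoeffOn_eq_integral, coeff, integral_Icc_eq_integral_Ioc,
    intervalIntegral.integral_of_le zero_le_one]
  simp only [sub_zero, div_one, one_smul]
  refine integral_congr_ae (.of_forall fun x => ?_)
  simp only [smul_eq_mul]
  rw [fourier_coe_apply, cexpi]
  congr 2
  push_cast
  ring

theorem hasSum_sq_coeff {f : ℝ → ℂ} (hf : MemLp f 2 (volume.restrict (Set.Icc 0 1))) :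
    HasSum (fun l => ‖coeff f l‖ ^ 2) (cellNormSq f) := by
  have h0 : volume.restrict (Set.Ioc (0 : ℝ) 1) = volume.restrict (Set.Icc 0 1) :=
    Measure.restrict_congr_set Ioc_ae_eq_Icc
  have h1 := hasSum_sq_fourierCoeffOn (zero_lt_one (α := ℝ)) (f := f) (by rwa [h0])
  simp only [← coeff_eq_fourierCoeffOn] at h1
  rw [intervalIntegral.integral_of_le zero_le_one, h0] at h1
  simpa [cellNormSq] using h1

theorem cexpi_add_one (l : ℤ) (x : ℝ) : cexpi l (x + 1) = cexpi l x := by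
  have h1 : cexpi l 1 = 1 := by
    have h := Complex.exp_int_mul_two_pi_mul_I l
    rw [cexpi, ← h]
    congr 1
    push_cast
    ring
  rw [cexpi_comm, cexpi_add, cexpi_comm 1, h1, mul_one, cexpi_comm]

theorem integral_cexpi (l : ℤ) :
    ∫ x in Set.Icc (0 : ℝ) 1, cexpi l x = if l = 0 then 1 else 0 := by
  split_ifs with hl
  · simp [hl, cexpi]
  · have hc : (2 * Real.pi * l * Complex.I : ℂ) ≠ 0 := by
      simp [Real.pi_ne_zero, hl]
    have h1 : ∀ x : ℝ, cexpi l x = Complex.exp (2 * Real.pi * l * Complex.I * x) := by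
      intro x
      rw [cexpi]
      push_cast
      ring_nf
    rw [integral_Icc_eq_integral_Ioc, ← intervalIntegral.integral_of_le zero_le_one]
    simp only [h1]
    rw [integral_exp_mul_complex hc]
    have h2 := h1 1
    have h3 := cexpi_add_one l 0
    rw [zero_add, h2] at h3
    rw [h3]
    simp [cexpi]

theorem ae_eq_zero_of_coeff_eq_zero {f : ℝ → ℂ} (hf : MemLp f 2 (volume.restrict (Set.Icc 0 1)))
    (h : ∀ l, coeff f l = 0) : ∀ᵐ x ∂(volume.restrict (Set.Icc (0 : ℝ) 1)), f x = 0 := by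
  have h1 := hasSum_sq_coeff hf
  simp only [h, norm_zero, ne_eq, OfNat.ofNat_ne_zero, not_false_eq_true, zero_pow] at h1
  have h2 : ∫ x in Set.Icc (0 : ℝ) 1, ‖f x‖ ^ 2 = 0 := h1.unique hasSum_zero
  rw [integral_eq_zero_iff_of_nonneg (fun x => sq_nonneg _) hf.integrable_norm_pow'] at h2
  filter_upwards [h2] with x hx
  simpa using hx

theorem ae_of_ae_restrict_of_periodic {p : ℝ → Prop} (hp : ∀ x, p (x + 1) ↔ p x)
    (h : ∀ᵐ x ∂(volume.restrict (Set.Icc (0 : ℝ) 1)), p x) : ∀ᵐ x, p x := by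
  have hint : ∀ (n : ℤ) x, p (x + n) ↔ p x := by
    intro n
    induction n using Int.induction_on with
    | zero => simp
    | succ i ih =>
      intro x
      rw [← ih x, ← hp (x + (i : ℤ))]
      push_cast
      rw [add_assoc]
    | pred i ih =>
      intro x
      rw [← ih x, ← hp]
      push_cast
      ring_nf
  have h1 : ∀ᵐ x, x ∈ Set.Icc (0 : ℝ) 1 → p x := (ae_restrict_iff' measurableSet_Icc).1 h
  have h2 : ∀ n : ℤ, ∀ᵐ x : ℝ, x + n ∈ Set.Icc (0 : ℝ) 1 → p (x + n) := fun n =>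
    (measurePreserving_add_right volume (n : ℝ)).quasiMeasurePreserving.ae h1
  filter_upwards [ae_all_iff.2 h2] with x hx
  rw [← hint (-⌊x⌋) x]
  refine hx _ ?_
  push_cast
  exact ⟨by linarith [Int.floor_le x], by linarith [Int.lt_floor_add_one x]⟩

/-- A periodic function with absolutely summable Fourier coefficients is the sum of its Fourier
series. -/
theorem ae_eq_fourier_series {f : ℝ → ℂ} (hf : MemLp f 2 (volume.restrict (Set.Icc 0 1)))
    (hp : Function.Periodic f 1) (hs : Summable fun l => ‖coeff f l‖) :
    ∀ᵐ x, f x = ∑' l : ℤ, coeff f l * cexpi l x := by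
  have hnorm : ∀ (l : ℤ) x, ‖coeff f l * cexpi l x‖ = ‖coeff f l‖ := fun l x => by
    rw [norm_mul, norm_cexpi, mul_one]
  set G : ℝ → ℂ := fun x => ∑' l : ℤ, coeff f l * cexpi l x with hG
  have hGc : Continuous G :=
    continuous_tsum (fun l => (continuous_cexpi l).const_mul _) hs fun l x => (hnorm l x).le
  have hGb : ∀ x, ‖G x‖ ≤ ∑' l, ‖coeff f l‖ := fun x => by
    refine (norm_tsum_le_tsum_norm (by simpa only [hnorm] using hs)).trans_eq ?_
    simp only [hnorm]
  have hGm : MemLp G 2 (volume.restrict (Set.Icc (0 : ℝ) 1)) :=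
    MemLp.of_bound hGc.aestronglyMeasurable _ (.of_forall hGb)
  have hcoeff : ∀ m, coeff (fun x => f x - G x) m = 0 := by
    intro m
    have hcm : Continuous (cexpi (-m)) := continuous_cexpi _
    have hfi : Integrable (fun x => cexpi (-m) x * f x) (volume.restrict (Set.Icc (0 : ℝ) 1)) :=
      (hf.integrable (by norm_num)).bdd_mul hcm.aestronglyMeasurable
        (.of_forall fun x => (norm_cexpi _ x).le)
    have hGi : Integrable (fun x => cexpi (-m) x * G x) (volume.restrict (Set.Icc (0 : ℝ) 1)) :=
      (hGm.integrable (by norm_num)).bdd_mul hcm.aestronglyMeasurable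
        (.of_forall fun x => (norm_cexpi _ x).le)
    have h1 : coeff (fun x => f x - G x) m = coeff f m - coeff G m := by
      simp only [coeff, mul_sub]
      exact integral_sub hfi hGi
    have h2 : HasSum (fun l : ℤ => ∫ x in Set.Icc (0 : ℝ) 1,
        cexpi (-m) x * (coeff f l * cexpi l x))
        (∫ x in Set.Icc (0 : ℝ) 1, ∑' l : ℤ, cexpi (-m) x * (coeff f l * cexpi l x)) := by
      refine hasSum_integral_of_summable_integral_norm (fun l => ?_) ?_
      · exact (hcm.mul ((continuous_cexpi l).const_mul _)).continuousOn.integrableOn_compact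
          isCompact_Icc
      · simpa [norm_mul, norm_cexpi] using hs
    have h3 : ∀ l : ℤ, ∫ x in Set.Icc (0 : ℝ) 1, cexpi (-m) x * (coeff f l * cexpi l x) =
        if l = m then coeff f m else 0 := by
      intro l
      have h4 : ∀ x, cexpi (-m) x * (coeff f l * cexpi l x) =
          coeff f l * cexpi ((l - m : ℤ) : ℝ) x := by
        intro x
        push_cast
        rw [sub_eq_add_neg, cexpi_add]
        ring
      simp only [h4]
      rw [integral_const_mul, integral_cexpi]
      by_cases hlm : l = m
      · simp [hlm]
      · simp [hlm, sub_eq_zero]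
    simp only [h3, tsum_mul_left] at h2
    rw [h1, sub_eq_zero]
    exact (hasSum_ite_eq m (coeff f m)).unique h2
  refine ae_of_ae_restrict_of_periodic (fun x => ?_) ?_
  · simp only [hp x, cexpi_add_one]
  · filter_upwards [ae_eq_zero_of_coeff_eq_zero (hf.sub hGm) hcoeff] with x hx
    exact sub_eq_zero.1 hx

/-! ### Fourier coefficients of weak derivatives -/

theorem IsL2Loc.locallyIntegrable {f : ℝ → ℂ} (hf : IsL2Loc f) : LocallyIntegrable f volume := by
  rw [locallyIntegrable_iff]
  intro K hK
  have : IsFiniteMeasure (volume.restrict K) := ⟨by simpa using hK.measure_lt_top⟩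
  exact (hf K hK).integrable (by norm_num)

theorem integrable_mul_of_compactSupport {f φ : ℝ → ℂ} (hf : LocallyIntegrable f volume)
    (hφ : Continuous φ) (hc : HasCompactSupport φ) : Integrable (fun x => f x * φ x) volume := by
  simpa [mul_comm] using hf.integrable_smul_left_of_hasCompactSupport hφ hc

theorem IsWeakDeriv.ae_periodic {f g : ℝ → ℂ} (hf : ∀ᵐ x, f (x + 1) = f x)
    (hg : LocallyIntegrable g volume) (hfg : IsWeakDeriv f g) : ∀ᵐ x, g (x + 1) = g x := by
  have hg' : LocallyIntegrable (fun x => g (x + 1)) volume := by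
    rw [locallyIntegrable_iff] at hg ⊢
    intro K hK
    have h1 := hg ((Homeomorph.addRight (1 : ℝ)) '' K) (hK.image (Homeomorph.continuous _))
    rw [← (measurePreserving_add_right volume (1 : ℝ)).integrableOn_comp_preimage
      (Homeomorph.addRight (1 : ℝ)).measurableEmbedding] at h1
    have h2 : (fun x : ℝ => x + 1) ⁻¹' ((Homeomorph.addRight (1 : ℝ)) '' K) = K :=
      (Homeomorph.addRight (1 : ℝ)).preimage_image K
    rwa [h2] at h1
  refine ae_eq_of_integral_contDiff_smul_eq hg' hg fun φ hφ hc => ?_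
  set Φ : ℝ → ℂ := fun x => (φ x : ℂ) with hΦ
  have hΦd : ContDiff ℝ ∞ Φ := Complex.ofRealCLM.contDiff.comp hφ
  have hΦc : HasCompactSupport Φ := hc.comp_left (g := fun x : ℝ => (x : ℂ)) Complex.ofReal_zero
  have h1 := hfg Φ hΦd hΦc
  have h2 := hfg (fun x => Φ (x - 1)) (hΦd.comp (contDiff_id.sub contDiff_const))
    (hΦc.comp_homeomorph (Homeomorph.subRight (1 : ℝ)))
  have h3 : ∀ x, deriv (fun x => Φ (x - 1)) x = deriv Φ (x - 1) := fun x =>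
    deriv_comp_sub_const Φ 1 x
  simp only [h3] at h2
  rw [← integral_add_right_eq_self (fun x => f x * _) (1 : ℝ),
    ← integral_add_right_eq_self (fun x => g x * _) (1 : ℝ)] at h2
  simp only [add_sub_cancel_right] at h2
  have h4 : ∫ x, f (x + 1) * deriv Φ x = ∫ x, f x * deriv Φ x := by
    refine integral_congr_ae ?_
    filter_upwards [hf] with x hx
    rw [hx]
  rw [h4, h1, neg_inj] at h2
  simp only [Complex.real_smul]
  simpa only [mul_comm] using h2.symm

/-- A smooth function with support in `[-1, 1]` whose integer translates sum to one. -/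
noncomputable def bump (x : ℝ) : ℂ :=
  (Real.smoothTransition (x + 1) : ℂ) - (Real.smoothTransition x : ℂ)

theorem contDiff_smoothTransition : ContDiff ℝ ∞ fun x => (Real.smoothTransition x : ℂ) :=
  Complex.ofRealCLM.contDiff.comp Real.smoothTransition.contDiff

theorem contDiff_bump : ContDiff ℝ ∞ bump :=
  (contDiff_smoothTransition.comp (contDiff_id.add contDiff_const)).sub contDiff_smoothTransition

theorem bump_eq_zero {x : ℝ} (hx : x ∉ Set.Icc (-1 : ℝ) 1) : bump x = 0 := by
  rw [Set.mem_Icc, not_and_or, not_le, not_le] at hx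
  rcases hx with h | h
  · rw [bump, Real.smoothTransition.zero_of_nonpos (by linarith),
      Real.smoothTransition.zero_of_nonpos (by linarith), sub_self]
  · rw [bump, Real.smoothTransition.one_of_one_le (by linarith),
      Real.smoothTransition.one_of_one_le (by linarith), sub_self]

theorem hasCompactSupport_bump : HasCompactSupport bump :=
  HasCompactSupport.intro isCompact_Icc fun _ hx => bump_eq_zero hx

/-- Pairing with `bump` integrates a periodic function over a period; this turns the test function
formulation of weak derivatives into one on the circle. -/
theorem integral_mul_bump {F : ℝ → ℂ} (hF : LocallyIntegrable F volume)
    (hp : ∀ᵐ x, F (x + 1) = F x) : ∫ x, F x * bump x = ∫ x in Set.Icc (0 : ℝ) 1, F x := by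
  have hii : ∀ a b : ℝ, IntervalIntegrable F volume a b := fun a b =>
    (hF.integrableOn_isCompact isCompact_uIcc).intervalIntegrable
  have hs : Continuous fun x => (Real.smoothTransition x : ℂ) :=
    contDiff_smoothTransition.continuous
  have h0 : ∫ x, F x * bump x = ∫ x in (-1 : ℝ)..1, F x * bump x := by
    rw [intervalIntegral.integral_of_le (by norm_num), ← integral_Icc_eq_integral_Ioc]
    refine (setIntegral_eq_integral_of_forall_compl_eq_zero fun x hx => ?_).symm
    rw [bump_eq_zero hx, mul_zero]
  have hint : ∀ a b : ℝ, IntervalIntegrable (fun x => F x * bump x) volume a b := fun a b =>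
    (hii a b).mul_continuousOn contDiff_bump.continuous.continuousOn
  have h1 : ∫ x in (-1 : ℝ)..0, F x * bump x =
      ∫ x in (0 : ℝ)..1, F x * (Real.smoothTransition x : ℂ) := by
    have h2 := intervalIntegral.integral_comp_add_right
      (fun x => F x * (Real.smoothTransition x : ℂ)) (a := -1) (b := 0) 1
    rw [neg_add_cancel, zero_add] at h2
    rw [← h2]
    refine intervalIntegral.integral_congr_ae ?_
    filter_upwards [hp] with x hx hmem
    rw [Set.uIoc_of_le (by norm_num)] at hmem
    rw [hx, bump, Real.smoothTransition.zero_of_nonpos hmem.2, Complex.ofReal_zero, sub_zero]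
  have h3 : ∫ x in (0 : ℝ)..1, F x * bump x =
      ∫ x in (0 : ℝ)..1, (F x - F x * (Real.smoothTransition x : ℂ)) := by
    refine intervalIntegral.integral_congr_ae (.of_forall fun x hmem => ?_)
    rw [Set.uIoc_of_le (by norm_num)] at hmem
    rw [bump, Real.smoothTransition.one_of_one_le (by linarith [hmem.1]), Complex.ofReal_one]
    ring
  rw [h0, ← intervalIntegral.integral_add_adjacent_intervals (hint (-1) 0) (hint 0 1), h1, h3,
    intervalIntegral.integral_sub (hii 0 1) ((hii 0 1).mul_continuousOn hs.continuousOn),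
    add_sub_cancel, intervalIntegral.integral_of_le zero_le_one, integral_Icc_eq_integral_Ioc]

theorem integral_mul_deriv_bump {F : ℝ → ℂ} (hF : LocallyIntegrable F volume)
    (hp : ∀ᵐ x, F (x + 1) = F x) : ∫ x, F x * deriv bump x = 0 := by
  set S : ℝ → ℂ := fun x => (Real.smoothTransition x : ℂ) with hS
  have hSd : ContDiff ℝ ∞ S := contDiff_smoothTransition
  have hSdiff : Differentiable ℝ S := hSd.differentiable (by simp)
  have hSc : HasCompactSupport (deriv S) := by
    refine HasCompactSupport.intro (isCompact_Icc (a := (0 : ℝ)) (b := 1)) fun x hx => ?_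
    rw [Set.mem_Icc, not_and_or, not_le, not_le] at hx
    rcases hx with h | h
    · have h1 : S =ᶠ[nhds x] fun _ => 0 := by
        filter_upwards [Iio_mem_nhds h] with y hy
        rw [hS]
        simp only
        rw [Real.smoothTransition.zero_of_nonpos (le_of_lt hy), Complex.ofReal_zero]
      rw [h1.deriv_eq, deriv_const]
    · have h1 : S =ᶠ[nhds x] fun _ => 1 := by
        filter_upwards [Ioi_mem_nhds h] with y hy
        rw [hS]
        simp only
        rw [Real.smoothTransition.one_of_one_le (le_of_lt hy), Complex.ofReal_one]
      rw [h1.deriv_eq, deriv_const]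
  have hScont : Continuous (deriv S) := hSd.continuous_deriv (by simp)
  have hd : ∀ x, deriv bump x = deriv S (x + 1) - deriv S x := by
    intro x
    have h1 : bump = fun x => S (x + 1) - S x := rfl
    have h2 : DifferentiableAt ℝ (fun x => S (x + 1)) x :=
      (hSdiff.comp (differentiable_id.add_const 1)) x
    rw [h1, deriv_fun_sub h2 (hSdiff x), deriv_comp_add_const]
  have hi : Integrable (fun x => F x * deriv S x) volume :=
    integrable_mul_of_compactSupport hF hScont hSc
  have hi' : Integrable (fun x => F x * deriv S (x + 1)) volume :=
    integrable_mul_of_compactSupport hF (hScont.comp (continuous_add_const 1))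
      (hSc.comp_homeomorph (Homeomorph.addRight (1 : ℝ)))
  simp only [hd, mul_sub]
  rw [integral_sub hi' hi, ← integral_add_right_eq_self (fun x => F x * deriv S x) (1 : ℝ),
    sub_eq_zero]
  refine integral_congr_ae ?_
  filter_upwards [hp] with x hx
  rw [hx]

theorem locallyIntegrable_mul_cexpi {f : ℝ → ℂ} (hf : LocallyIntegrable f volume) (a : ℝ) :
    LocallyIntegrable (fun x => cexpi a x * f x) volume := by
  rw [locallyIntegrable_iff] at hf ⊢
  exact fun K hK => (hf K hK).bdd_mul (continuous_cexpi a).aestronglyMeasurable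
    (.of_forall fun x => (norm_cexpi a x).le)

theorem hasDerivAt_cexpi (a x : ℝ) :
    HasDerivAt (cexpi a) (2 * Real.pi * a * Complex.I * cexpi a x) x := by
  have h1 : HasDerivAt (fun y : ℝ => 2 * Real.pi * a * (y : ℂ) * Complex.I)
      (2 * Real.pi * a * 1 * Complex.I) x :=
    ((Complex.ofRealCLM.hasDerivAt (x := x)).const_mul _).mul_const _
  have h2 := h1.cexp
  rw [mul_one, mul_comm (Complex.exp _)] at h2
  exact h2

/-- The test function `e^{-2πilx} bump x` gives the Fourier coefficients of a weak derivative. -/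
theorem coeff_weakDeriv {f g : ℝ → ℂ} (hf : LocallyIntegrable f volume)
    (hg : LocallyIntegrable g volume) (hp : ∀ᵐ x, f (x + 1) = f x) (hfg : IsWeakDeriv f g)
    (l : ℤ) : coeff g l = 2 * Real.pi * l * Complex.I * coeff f l := by
  have hpg := hfg.ae_periodic hp hg
  have hcp : ∀ x, cexpi (-l) (x + 1) = cexpi (-l) x := fun x => by
    have := cexpi_add_one (-l) x
    push_cast at this
    exact this
  have hF := locallyIntegrable_mul_cexpi hf (-l)
  have hG := locallyIntegrable_mul_cexpi hg (-l)
  have hFp : ∀ᵐ x, cexpi (-l) (x + 1) * f (x + 1) = cexpi (-l) x * f x := by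
    filter_upwards [hp] with x hx
    rw [hx, hcp]
  have hGp : ∀ᵐ x, cexpi (-l) (x + 1) * g (x + 1) = cexpi (-l) x * g x := by
    filter_upwards [hpg] with x hx
    rw [hx, hcp]
  have hbd : Differentiable ℝ bump := contDiff_bump.differentiable (by simp)
  have hd : ∀ x, deriv (fun x => cexpi (-l) x * bump x) x =
      -(2 * Real.pi * l * Complex.I) * cexpi (-l) x * bump x + cexpi (-l) x * deriv bump x := by
    intro x
    rw [((hasDerivAt_cexpi (-l) x).fun_mul (hbd x).hasDerivAt).deriv]
    push_cast
    ring
  have hb : Continuous (deriv bump) := contDiff_bump.continuous_deriv (by simp)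
  have h1 := hfg (fun x => cexpi (-l) x * bump x) ((contDiff_cexpi _).mul contDiff_bump)
    hasCompactSupport_bump.mul_left
  have h2 : ∀ x, f x * deriv (fun x => cexpi (-l) x * bump x) x =
      -(2 * Real.pi * l * Complex.I) * ((cexpi (-l) x * f x) * bump x) +
        (cexpi (-l) x * f x) * deriv bump x := by
    intro x
    rw [hd]
    ring
  simp only [h2] at h1
  rw [integral_add ((integrable_mul_of_compactSupport hF contDiff_bump.continuous
      hasCompactSupport_bump).const_mul _)
    (integrable_mul_of_compactSupport hF hb hasCompactSupport_bump.deriv),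
    integral_mul_deriv_bump hF hFp, integral_const_mul, integral_mul_bump hF hFp] at h1
  have h3 : ∫ x, g x * (cexpi (-l) x * bump x) = coeff g l := by
    rw [coeff, ← integral_mul_bump hG hGp]
    refine integral_congr_ae (.of_forall fun x => ?_)
    simp only
    ring
  rw [h3] at h1
  change _ * coeff f l + 0 = _ at h1
  linear_combination h1

/-! ### Fourier series of the pairing function -/

theorem summable_inv_one_add_sq : Summable fun l : ℤ => (1 + (2 * Real.pi * l) ^ 2 : ℝ)⁻¹ := by
  have h1 : Summable fun l : ℤ => 1 / (l : ℝ) ^ 2 := Real.summable_one_div_int_pow.2 one_lt_two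
  refine .of_norm_bounded_eventually h1 ?_
  filter_upwards [Filter.eventually_cofinite_ne (0 : ℤ)] with l hl
  have h2 : (0 : ℝ) < (l : ℝ) ^ 2 := by positivity
  rw [Real.norm_of_nonneg (by positivity), one_div]
  refine inv_anti₀ h2 ?_
  have h3 : 1 ≤ (2 * Real.pi) ^ 2 := by nlinarith [Real.pi_gt_three]
  rw [mul_pow]
  nlinarith

/-- The constant `(∑_l (1 + (2πl)²)⁻¹)^{1/2}` of the Sobolev inequality `‖ψ‖_∞ ≤ K ‖ψ‖_{H¹}`. -/
noncomputable def sobolevConst : ℝ := √(∑' l : ℤ, (1 + (2 * Real.pi * l) ^ 2 : ℝ)⁻¹)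

theorem sobolevConst_nonneg : 0 ≤ sobolevConst := Real.sqrt_nonneg _

theorem cellNormSq_nonneg (f : ℝ → ℂ) : 0 ≤ cellNormSq f := integral_nonneg fun _ => sq_nonneg _

theorem norm_two_pi_mul_I_sq (l : ℤ) :
    ‖(2 * Real.pi * l * Complex.I : ℂ)‖ ^ 2 = (2 * Real.pi * l) ^ 2 := by
  have h1 : (2 * Real.pi * l : ℂ) = ((2 * Real.pi * l : ℝ) : ℂ) := by push_cast; rfl
  rw [norm_mul, Complex.norm_I, mul_one, h1, Complex.norm_real, Real.norm_eq_abs, sq_abs]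

namespace IsPeriodicH2

variable {ψ ψ' ψ'' : ℝ → ℂ} (hψ : IsPeriodicH2 ψ ψ' ψ'')

include hψ

theorem hasSum_sq_coeff : HasSum (fun l => ‖coeff ψ l‖ ^ 2) (cellNormSq ψ) :=
  BCS.hasSum_sq_coeff (hψ.l2loc _ isCompact_Icc)

theorem coeff_deriv (l : ℤ) : coeff ψ' l = 2 * Real.pi * l * Complex.I * coeff ψ l :=
  coeff_weakDeriv hψ.l2loc.locallyIntegrable hψ.l2loc_deriv.locallyIntegrable
    (.of_forall hψ.periodic) hψ.weak_deriv l

theorem coeff_deriv2 (l : ℤ) : coeff ψ'' l = 2 * Real.pi * l * Complex.I * coeff ψ' l :=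
  coeff_weakDeriv hψ.l2loc_deriv.locallyIntegrable hψ.l2loc_deriv2.locallyIntegrable
    (hψ.weak_deriv.ae_periodic (.of_forall hψ.periodic) hψ.l2loc_deriv.locallyIntegrable)
    hψ.weak_deriv2 l

theorem hasSum_sq_coeff_deriv :
    HasSum (fun l : ℤ => (2 * Real.pi * l) ^ 2 * ‖coeff ψ l‖ ^ 2) (cellNormSq ψ') := by
  refine hasSum_of_eq (BCS.hasSum_sq_coeff (hψ.l2loc_deriv _ isCompact_Icc)) (fun l => ?_) rfl
  rw [hψ.coeff_deriv, norm_mul, mul_pow ‖_‖, norm_two_pi_mul_I_sq]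

theorem hasSum_sq_coeff_deriv2 :
    HasSum (fun l : ℤ => (2 * Real.pi * l) ^ 4 * ‖coeff ψ l‖ ^ 2) (cellNormSq ψ'') := by
  refine hasSum_of_eq (BCS.hasSum_sq_coeff (hψ.l2loc_deriv2 _ isCompact_Icc)) (fun l => ?_) rfl
  rw [hψ.coeff_deriv2, hψ.coeff_deriv, norm_mul, mul_pow ‖_‖, norm_mul _ (coeff ψ l), mul_pow ‖_‖,
    norm_two_pi_mul_I_sq]
  ring

/-- The Cauchy–Schwarz inequality with the weights `(1 + (2πl)²)^{±1/2}`. -/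
theorem sum_norm_coeff_le (s : Finset ℤ) :
    ∑ l ∈ s, ‖coeff ψ l‖ ≤ sobolevConst * √(cellNormSq ψ + cellNormSq ψ') := by
  have h1 : (∑ l ∈ s, ‖coeff ψ l‖) ^ 2 ≤
      (∑ l ∈ s, (1 + (2 * Real.pi * l) ^ 2 : ℝ)⁻¹) *
        ∑ l ∈ s, (1 + (2 * Real.pi * l) ^ 2 : ℝ) * ‖coeff ψ l‖ ^ 2 := by
    refine Finset.sum_sq_le_sum_mul_sum_of_sq_le_mul s (fun l _ => by positivity)
      (fun l _ => by positivity) fun l _ => le_of_eq ?_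
    rw [← mul_assoc, inv_mul_cancel₀ (by positivity), one_mul]
  have h2 := summable_inv_one_add_sq.sum_le_tsum s fun l _ => by positivity
  have h3 := sum_le_hasSum s (fun l _ => by positivity)
    (hψ.hasSum_sq_coeff.add hψ.hasSum_sq_coeff_deriv)
  have h4 : ∑ l ∈ s, (1 + (2 * Real.pi * l) ^ 2 : ℝ) * ‖coeff ψ l‖ ^ 2 ≤
      cellNormSq ψ + cellNormSq ψ' := by
    refine le_of_eq_of_le (Finset.sum_congr rfl fun l _ => ?_) h3
    ring
  rw [sobolevConst, ← Real.sqrt_mul (tsum_nonneg fun l => by positivity)]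
  refine Real.le_sqrt_of_sq_le (h1.trans ?_)
  exact mul_le_mul h2 h4 (Finset.sum_nonneg fun l _ => by positivity)
    (tsum_nonneg fun l => by positivity)

theorem summable_norm_coeff : Summable fun l => ‖coeff ψ l‖ :=
  summable_of_sum_le (fun _ => norm_nonneg _) hψ.sum_norm_coeff_le

theorem ae_eq_tsum : ∀ᵐ x, ψ x = ∑' l : ℤ, coeff ψ l * cexpi l x :=
  ae_eq_fourier_series (hψ.l2loc _ isCompact_Icc) hψ.periodic hψ.summable_norm_coeff

theorem aestronglyMeasurable : AEStronglyMeasurable ψ volume :=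
  hψ.l2loc.locallyIntegrable.aestronglyMeasurable

/-- The Sobolev inequality `‖ψ‖_∞ ≤ K ‖ψ‖_{H¹}`. -/
theorem ae_norm_le : ∀ᵐ x, ‖ψ x‖ ≤ sobolevConst * √(cellNormSq ψ + cellNormSq ψ') := by
  filter_upwards [hψ.ae_eq_tsum] with x hx
  have hn : ∀ l : ℤ, ‖coeff ψ l * cexpi l x‖ = ‖coeff ψ l‖ := fun l => by
    rw [norm_mul, norm_cexpi, mul_one]
  rw [hx]
  refine (norm_tsum_le_tsum_norm (by simpa only [hn] using hψ.summable_norm_coeff)).trans ?_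
  simp only [hn]
  exact hψ.summable_norm_coeff.tsum_le_of_sum_le hψ.sum_norm_coeff_le

theorem memLp_top : MemLp ψ ∞ volume :=
  memLp_top_of_bound hψ.aestronglyMeasurable _ hψ.ae_norm_le

/-- The Fourier series of `ψ` converges in operator norm. -/
theorem hasSum_mulOp : HasSum (fun l : ℤ => coeff ψ l • mulOp (cexpi l)) (mulOp ψ) := by
  have hs := hψ.summable_norm_coeff
  have hpart : ∀ s : Finset ℤ, MemLp (fun x => ∑ l ∈ s, coeff ψ l * cexpi l x) ∞ volume := fun s =>
    memLp_finsetSum _ fun l _ => (memLp_cexpi l).const_mul _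
  have hsum : ∀ s : Finset ℤ, mulOp (fun x => ∑ l ∈ s, coeff ψ l * cexpi l x) =
      ∑ l ∈ s, coeff ψ l • mulOp (cexpi l) := by
    intro s
    induction s using Finset.induction_on with
    | empty => simpa using norm_le_zero_iff.1 (mulOp_norm_le le_rfl (.of_forall fun _ => by simp))
    | insert a s ha ih =>
      simp only [Finset.sum_insert ha]
      rw [mulOp_add ((memLp_cexpi _).const_mul _) (hpart s), ih, mulOp_const_mul _ (memLp_cexpi _)]
  rw [HasSum, tendsto_iff_norm_sub_tendsto_zero]
  refine squeeze_zero (fun _ => norm_nonneg _) (fun s => ?_)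
    (tendsto_tsum_compl_atTop_zero fun l => ‖coeff ψ l‖)
  rw [← hsum, ← norm_neg, neg_sub]
  have h1 : mulOp ψ - mulOp (fun x => ∑ l ∈ s, coeff ψ l * cexpi l x) =
      mulOp fun x => ψ x - ∑ l ∈ s, coeff ψ l * cexpi l x := by
    have h := mulOp_add hψ.memLp_top ((hpart s).const_mul (-1))
    rw [mulOp_const_mul _ (hpart s), neg_one_smul, ← sub_eq_add_neg] at h
    rw [← h]
    congr 1
    funext x
    ring
  rw [h1]
  refine mulOp_norm_le (tsum_nonneg fun _ => norm_nonneg _) ?_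
  filter_upwards [hψ.ae_eq_tsum] with x hx
  have hn : ∀ l : ℤ, ‖coeff ψ l * cexpi l x‖ = ‖coeff ψ l‖ := fun l => by
    rw [norm_mul, norm_cexpi, mul_one]
  have hsx : Summable fun l : ℤ => coeff ψ l * cexpi l x :=
    .of_norm (by simpa only [hn] using hs)
  rw [hx, ← hsx.sum_add_tsum_subtype_compl s, add_sub_cancel_left]
  have hs' : Summable fun l : {l // l ∉ s} => ‖coeff ψ l‖ := hs.subtype _
  refine (norm_tsum_le_tsum_norm (by simpa only [hn] using hs')).trans_eq ?_
  simp only [hn]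

end IsPeriodicH2

/-! ### Quantitative bounds on the free resolvent -/

/-- The constant `C₀` in `1 + h²p² ≤ C₀ |h²p² - μ ± iω|` for `ω ≥ π/β`. -/
noncomputable def symbolConst (β μ : ℝ) : ℝ := 1 + (1 + |μ|) * (β / Real.pi)

theorem one_le_symbolConst {β : ℝ} (hβ : 0 < β) (μ : ℝ) : 1 ≤ symbolConst β μ := by
  have := Real.pi_pos
  rw [symbolConst]
  have : 0 ≤ (1 + |μ|) * (β / Real.pi) := by positivity
  linarith

/-- `z` is purely imaginary and at least as far from the real axis as the lowest Matsubara
frequencies `±iπ/β`. -/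
structure IsMatsubaraLike (β : ℝ) (z : ℂ) : Prop where
  re_eq : z.re = 0
  le_abs_im : Real.pi / β ≤ |z.im|

section MatsubaraLike

variable {β μ h : ℝ} {z : ℂ}

theorem IsMatsubaraLike.neg (hz : IsMatsubaraLike β z) : IsMatsubaraLike β (-z) :=
  ⟨by simp [hz.re_eq], by simpa using hz.le_abs_im⟩

theorem IsMatsubaraLike.star_eq (hz : IsMatsubaraLike β z) : star z = -z := by
  apply Complex.ext <;> simp [hz.re_eq]

theorem IsMatsubaraLike.abs_im_pos (hβ : 0 < β) (hz : IsMatsubaraLike β z) : 0 < |z.im| :=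
  (div_pos Real.pi_pos hβ).trans_le hz.le_abs_im

theorem IsMatsubaraLike.im_ne_zero (hβ : 0 < β) (hz : IsMatsubaraLike β z) : z.im ≠ 0 :=
  abs_pos.1 (hz.abs_im_pos hβ)

theorem isMatsubaraLike_matsubara (hβ : 0 < β) (n : ℕ) :
    IsMatsubaraLike β (matsubara β n * Complex.I) := by
  refine ⟨by simp, ?_⟩
  rw [Complex.im_ofReal_mul, Complex.I_im, mul_one, abs_of_pos (matsubara_pos hβ n)]
  exact matsubara_zero_le hβ n

theorem abs_im_matsubara (hβ : 0 < β) (n : ℕ) :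
    |((matsubara β n : ℂ) * Complex.I).im| = matsubara β n := by
  rw [Complex.im_ofReal_mul, Complex.I_im, mul_one, abs_of_pos (matsubara_pos hβ n)]

theorem one_add_sq_mul_norm_resSymbol_le (hβ : 0 < β) (hz : IsMatsubaraLike β z) (h μ p : ℝ) :
    (1 + (h * p) ^ 2) * ‖resSymbol h μ z p‖ ≤ symbolConst β μ := by
  set a : ℝ := h ^ 2 * p ^ 2 - μ with ha
  have h0 := ofReal_sub_ne_zero (hz.im_ne_zero hβ) a
  have h1 : |a| ≤ ‖(a : ℂ) - z‖ := by
    have := Complex.abs_re_le_norm ((a : ℂ) - z)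
    rwa [Complex.sub_re, Complex.ofReal_re, hz.re_eq, sub_zero] at this
  have h2 : |z.im| ≤ ‖(a : ℂ) - z‖ := by
    have := Complex.abs_im_le_norm ((a : ℂ) - z)
    rwa [Complex.sub_im, Complex.ofReal_im, zero_sub, abs_neg] at this
  have h3 : 1 ≤ β / Real.pi * ‖(a : ℂ) - z‖ := by
    have h4 := hz.le_abs_im.trans h2
    calc (1 : ℝ) = β / Real.pi * (Real.pi / β) := by
          have := Real.pi_pos
          field_simp
      _ ≤ _ := by
        have := Real.pi_pos
        gcongr
  have h5 : (h * p) ^ 2 ≤ |μ| + |a| := by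
    have : (h * p) ^ 2 = μ + a := by rw [ha]; ring
    rw [this]
    exact add_le_add (le_abs_self _) (le_abs_self _)
  rw [resSymbol, norm_inv, ← div_eq_mul_inv, div_le_iff₀ (norm_pos_iff.2 h0), symbolConst]
  have h6 : (1 + |μ|) * 1 ≤ (1 + |μ|) * (β / Real.pi * ‖(a : ℂ) - z‖) := by gcongr
  nlinarith

theorem sq_norm_resSymbol_le (hβ : 0 < β) (hz : IsMatsubaraLike β z) (h μ p : ℝ) :
    (1 + (h * p) ^ 2) * ‖resSymbol h μ z p‖ ^ 2 ≤ symbolConst β μ * |z.im|⁻¹ := by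
  rw [pow_two ‖_‖, ← mul_assoc]
  exact mul_le_mul (one_add_sq_mul_norm_resSymbol_le hβ hz h μ p)
    (norm_resSymbol_le h μ (hz.im_ne_zero hβ) p) (norm_nonneg _)
    (zero_le_one.trans (one_le_symbolConst hβ μ))

theorem lintegral_inv_one_add_sq (hh : 0 < h) :
    ∫⁻ ξ : ℝ, ENNReal.ofReal (1 + (h * (2 * Real.pi * ξ)) ^ 2)⁻¹ =
      ENNReal.ofReal (1 / (2 * h)) := by
  have hc : 2 * Real.pi * h ≠ 0 := by positivity
  have h0 : ∀ ξ : ℝ, (1 + (h * (2 * Real.pi * ξ)) ^ 2)⁻¹ = (1 + (2 * Real.pi * h * ξ) ^ 2)⁻¹ :=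
    fun ξ => by ring_nf
  simp only [h0]
  rw [← ofReal_integral_eq_lintegral_ofReal (integrable_inv_one_add_sq.comp_mul_left' hc)
    (.of_forall fun ξ => by positivity),
    Measure.integral_comp_mul_left (fun x : ℝ => (1 + x ^ 2)⁻¹), integral_univ_inv_one_add_sq,
    abs_of_pos (by positivity), smul_eq_mul]
  congr 1
  field_simp

/-- The integral of `|h²p² - μ - z|⁻²` over momenta is of order `h⁻¹`. -/
theorem lintegral_sq_resSymbol_le (hβ : 0 < β) (hz : IsMatsubaraLike β z) (hh : 0 < h) (μ : ℝ) :
    ∫⁻ ξ : ℝ, ‖resSymbol h μ z (2 * Real.pi * ξ)‖ₑ ^ 2 ≤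
      ENNReal.ofReal (symbolConst β μ * |z.im|⁻¹ * (1 / (2 * h))) := by
  have hC : 0 ≤ symbolConst β μ * |z.im|⁻¹ :=
    mul_nonneg (zero_le_one.trans (one_le_symbolConst hβ μ)) (by positivity)
  rw [ENNReal.ofReal_mul hC, ← lintegral_inv_one_add_sq hh, ← lintegral_const_mul]
  · refine lintegral_mono fun ξ => ?_
    rw [enorm_sq_eq_ofReal, ← ENNReal.ofReal_mul hC]
    refine ENNReal.ofReal_le_ofReal ?_
    rw [← div_eq_mul_inv, le_div_iff₀ (by positivity), mul_comm]
    exact sq_norm_resSymbol_le hβ hz h μ _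
  · fun_prop

/-- The symbol `(1 + ihp) (h²p² - μ - z)⁻¹`, so that the free resolvent is `(1 + h∇)⁻¹` times the
corresponding operator. -/
noncomputable def weightedResSymbol (h μ : ℝ) (z : ℂ) (p : ℝ) : ℂ :=
  (1 + ((h * p : ℝ) : ℂ) * Complex.I) * resSymbol h μ z p

theorem norm_weightedResSymbol_le (hβ : 0 < β) (hz : IsMatsubaraLike β z) (h μ p : ℝ) :
    ‖weightedResSymbol h μ z p‖ ≤ √(symbolConst β μ * |z.im|⁻¹) := by
  refine Real.le_sqrt_of_sq_le ?_
  rw [weightedResSymbol, norm_mul, mul_pow, norm_one_add_I_mul_sq]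
  exact sq_norm_resSymbol_le hβ hz h μ p

theorem isSymbol_weightedResSymbol (hβ : 0 < β) (hz : IsMatsubaraLike β z) (h μ : ℝ) :
    IsSymbol (weightedResSymbol h μ z) :=
  ⟨by unfold weightedResSymbol resSymbol; fun_prop, _, norm_weightedResSymbol_le hβ hz h μ⟩

theorem freeResolvent_eq_smooth_comp (hβ : 0 < β) (hz : IsMatsubaraLike β z) (h μ : ℝ) :
    freeResolvent h μ z =
      momentumOp (smoothSymbol h) ∘L momentumOp (weightedResSymbol h μ z) := by
  rw [← momentumOp_mul (isSymbol_smoothSymbol h) (isSymbol_weightedResSymbol hβ hz h μ),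
    freeResolvent]
  congr 1
  funext p
  have h1 : 1 + ((h * p : ℝ) : ℂ) * Complex.I ≠ 0 := by
    rw [← norm_pos_iff]
    exact zero_lt_one.trans_le (one_le_norm_one_add_I_mul _)
  rw [smoothSymbol, weightedResSymbol, ← mul_assoc, inv_mul_cancel₀ h1, one_mul]

theorem freeResolvent_periodic (h μ : ℝ) (hz : z.im ≠ 0) : IsPeriodicOp (freeResolvent h μ z) :=
  momentumOp_periodic (isSymbol_resSymbol h μ hz)

theorem lintegral_enorm_sq_cell {f : ℝ → ℂ} (hf : MemLp f 2 (volume.restrict (Set.Icc 0 1))) :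
    ∫⁻ x in Set.Icc (0 : ℝ) 1, ‖f x‖ₑ ^ 2 = ENNReal.ofReal (cellNormSq f) := by
  rw [cellNormSq, ofReal_integral_eq_lintegral_ofReal hf.integrable_norm_pow'
    (.of_forall fun x => by positivity)]
  simp only [enorm_sq_eq_ofReal]

theorem cellHS_freeResolvent_mulOp_le (hβ : 0 < β) (hz : IsMatsubaraLike β z) (hh : 0 < h) (μ : ℝ)
    {f : ℝ → ℂ} (hf : MemLp f ∞ volume) :
    cellHS (freeResolvent h μ z ∘L mulOp f) ≤
      ENNReal.ofReal (symbolConst β μ * |z.im|⁻¹ * (1 / (2 * h)) * cellNormSq f) := by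
  have hC : 0 ≤ symbolConst β μ * |z.im|⁻¹ * (1 / (2 * h)) :=
    mul_nonneg (mul_nonneg (zero_le_one.trans (one_le_symbolConst hβ μ)) (by positivity))
      (by positivity)
  refine (cellHS_momentumOp_mulOp_le (isSymbol_resSymbol h μ (hz.im_ne_zero hβ)) hf).trans ?_
  rw [ENNReal.ofReal_mul hC, ← lintegral_enorm_sq_cell]
  · exact mul_le_mul_left (lintegral_sq_resSymbol_le hβ hz hh μ) _
  · exact (hf.restrict _).mono_exponent le_top

theorem cellHS_mulOp_freeResolvent_le (hβ : 0 < β) (hz : IsMatsubaraLike β z) (hh : 0 < h) (μ : ℝ)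
    {f : ℝ → ℂ} (hf : MemLp f ∞ volume) (hp : Function.Periodic f 1) :
    cellHS (mulOp f ∘L freeResolvent h μ z) ≤
      ENNReal.ofReal (symbolConst β μ * |z.im|⁻¹ * (1 / (2 * h)) * cellNormSq f) := by
  have hz' := hz.neg
  have h1 : ContinuousLinearMap.adjoint (freeResolvent h μ (-z) ∘L mulOp fun x => star (f x)) =
      mulOp f ∘L freeResolvent h μ z := by
    rw [ContinuousLinearMap.adjoint_comp, adjoint_freeResolvent h μ (hz'.im_ne_zero hβ),
      adjoint_mulOp (memLp_top_star hf), hz'.star_eq, neg_neg]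
    simp only [star_star]
  have h2 : IsPeriodicOp (freeResolvent h μ (-z) ∘L mulOp fun x => star (f x)) :=
    (freeResolvent_periodic h μ (hz'.im_ne_zero hβ)).comp
      (mulOp_periodic (memLp_top_star hf) fun x => by simp only [hp x])
  rw [← h1, cellHS_adjoint h2]
  refine (cellHS_freeResolvent_mulOp_le hβ hz' hh μ (memLp_top_star hf)).trans_eq ?_
  simp [cellNormSq]

end MatsubaraLike

/-! ### Hilbert–Schmidt bounds for the entries of the resolvent -/

theorem enorm_sq_le_of_norm_le {E : Type*} [SeminormedAddCommGroup E] {A : E} {a : ℝ}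
    (hA : ‖A‖ ≤ a) : ‖A‖ₑ ^ 2 ≤ ENNReal.ofReal (a ^ 2) := by
  rw [ENNReal.ofReal_pow ((norm_nonneg A).trans hA), ← ofReal_norm]
  gcongr

theorem cellHS_comp_left_le_ofReal {A η : L2 →L[ℂ] L2} {a q : ℝ} (hA : ‖A‖ ≤ a)
    (hη : cellHS η ≤ ENNReal.ofReal q) : cellHS (A ∘L η) ≤ ENNReal.ofReal (a ^ 2 * q) := by
  rw [ENNReal.ofReal_mul (sq_nonneg a)]
  exact (cellHS_comp_left_le A η).trans (mul_le_mul' (enorm_sq_le_of_norm_le hA) hη)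

theorem cellHS_comp_right_le_ofReal {A η : L2 →L[ℂ] L2} {a q : ℝ} (hηp : IsPeriodicOp η)
    (hAp : IsPeriodicOp A) (hA : ‖A‖ ≤ a) (hη : cellHS η ≤ ENNReal.ofReal q) :
    cellHS (η ∘L A) ≤ ENNReal.ofReal (a ^ 2 * q) := by
  rw [mul_comm, ENNReal.ofReal_mul' (sq_nonneg a)]
  exact (cellHS_comp_right_le hηp hAp).trans (mul_le_mul' hη (enorm_sq_le_of_norm_le hA))

theorem cellHS_add_le_ofReal {η θ : L2 →L[ℂ] L2} {p q : ℝ} (hp : 0 ≤ p) (hq : 0 ≤ q)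
    (hη : cellHS η ≤ ENNReal.ofReal p) (hθ : cellHS θ ≤ ENNReal.ofReal q) :
    cellHS (η + θ) ≤ ENNReal.ofReal (2 * p + 2 * q) := by
  rw [ENNReal.ofReal_add (by positivity) (by positivity), ENNReal.ofReal_mul zero_le_two,
    ENNReal.ofReal_mul zero_le_two, ENNReal.ofReal_ofNat]
  refine (hsNormSq_add_le (η ∘L cell) (θ ∘L cell)).trans ?_
  gcongr
  · exact hη
  · exact hθ

/-- Left inverse of `1 + K` by the Neumann series, in the form in which fixed point equations are
solved. -/
theorem exists_inverse_one_add {E : Type*} [NormedAddCommGroup E] [NormedSpace ℂ E]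
    [CompleteSpace E] {K : E →L[ℂ] E} (hK : ‖K‖ ≤ 1 / 2) :
    ∃ B : E →L[ℂ] E, ‖B‖ ≤ 2 ∧ ∀ T S : E →L[ℂ] E, T + K ∘L T = S → T = B ∘L S := by
  have h1 : ‖-K‖ < 1 := by rw [norm_neg]; linarith
  obtain ⟨U, hU⟩ := isUnit_one_sub_of_norm_lt_one h1
  rw [sub_neg_eq_add] at hU
  have hBK : (↑U⁻¹ : E →L[ℂ] E) * (1 + K) = 1 := by rw [← hU]; exact U.inv_mul
  refine ⟨(↑U⁻¹ : E →L[ℂ] E), ?_, fun T S h => ?_⟩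
  · have h2 : (↑U⁻¹ : E →L[ℂ] E) = 1 - (↑U⁻¹ : E →L[ℂ] E) * K := by
      rw [eq_sub_iff_add_eq, ← hBK]
      noncomm_ring
    have h3 : ‖(↑U⁻¹ : E →L[ℂ] E)‖ ≤ 1 + ‖(↑U⁻¹ : E →L[ℂ] E)‖ * (1 / 2) := by
      calc ‖(↑U⁻¹ : E →L[ℂ] E)‖ = ‖1 - (↑U⁻¹ : E →L[ℂ] E) * K‖ := by rw [← h2]
        _ ≤ ‖(1 : E →L[ℂ] E)‖ + ‖(↑U⁻¹ : E →L[ℂ] E) * K‖ := norm_sub_le _ _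
        _ ≤ 1 + ‖(↑U⁻¹ : E →L[ℂ] E)‖ * (1 / 2) := by
            gcongr
            · exact ContinuousLinearMap.norm_id_le
            · exact (norm_mul_le _ _).trans (by gcongr)
    linarith
  · rw [← h]
    have h2 : T + K ∘L T = (1 + K) * T := by rw [add_mul, one_mul]; rfl
    rw [h2]
    change T = (↑U⁻¹ : E →L[ℂ] E) * ((1 + K) * T)
    rw [← mul_assoc, hBK, one_mul]

section Entries

variable {b d r r' V D D' : L2 →L[ℂ] L2} {ρ v δ q : ℝ}

/-- The solution `b`, `d` of the resolvent system agrees to first order in the pairing `D` with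
`b ≈ r D r'`; the remainder is `r X` with the given `X`. -/
theorem entry_expansion (hb : b = -(r ∘L (V ∘L b + D ∘L d)))
    (hd : d = r' ∘L (D' ∘L b - V ∘L d - ContinuousLinearMap.id ℂ L2)) :
    b = r ∘L D ∘L r' +
      r ∘L (-(V ∘L b + (D ∘L r') ∘L (D' ∘L b) - (D ∘L r') ∘L (V ∘L d))) := by
  have h1 : D ∘L d = (D ∘L r') ∘L (D' ∘L b) - (D ∘L r') ∘L (V ∘L d) - D ∘L r' := by
    nth_rewrite 1 [hd]
    ext1 u
    simp
  nth_rewrite 1 [hb]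
  rw [h1]
  ext1 u
  simp
  abel

theorem norm_entry12_le_of_system (hb : b = -(r ∘L (V ∘L b + D ∘L d))) (hr : ‖r‖ ≤ ρ)
    (hdn : ‖d‖ ≤ ρ) (hV : ‖V‖ ≤ v) (hρv : ρ * v ≤ 1 / 2) (hD : ‖D‖ ≤ δ) :
    ‖b‖ ≤ 2 * δ * ρ ^ 2 := by
  have hρ := (norm_nonneg _).trans hr
  have hv := (norm_nonneg _).trans hV
  have hδ := (norm_nonneg _).trans hD
  have h1 : ‖b‖ ≤ ρ * (v * ‖b‖ + δ * ρ) := by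
    calc ‖b‖ = ‖r ∘L (V ∘L b + D ∘L d)‖ := by rw [← norm_neg (r ∘L _), ← hb]
      _ ≤ ‖r‖ * (‖V‖ * ‖b‖ + ‖D‖ * ‖d‖) := by
          refine (ContinuousLinearMap.opNorm_comp_le _ _).trans ?_
          gcongr
          exact (norm_add_le _ _).trans (add_le_add (ContinuousLinearMap.opNorm_comp_le _ _)
            (ContinuousLinearMap.opNorm_comp_le _ _))
      _ ≤ _ := by gcongr
  have h2 : ρ * v * ‖b‖ ≤ 1 / 2 * ‖b‖ := by gcongr
  nlinarith

/-- The term `r V b` is absorbed into the left-hand side, since `‖r V‖ ≤ 1/2`; what remains is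
`r D d`, where `r D` is Hilbert–Schmidt per unit volume. -/
theorem cellHS_entry12_le (hb : b = -(r ∘L (V ∘L b + D ∘L d))) (hr : ‖r‖ ≤ ρ)
    (hdn : ‖d‖ ≤ ρ) (hV : ‖V‖ ≤ v) (hρv : ρ * v ≤ 1 / 2) (hrp : IsPeriodicOp (r ∘L D))
    (hdp : IsPeriodicOp d) (hq : cellHS (r ∘L D) ≤ ENNReal.ofReal q) :
    cellHS b ≤ ENNReal.ofReal (4 * (ρ ^ 2 * q)) := by
  have hρ := (norm_nonneg _).trans hr
  have hK : ‖r ∘L V‖ ≤ 1 / 2 := by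
    refine (ContinuousLinearMap.opNorm_comp_le _ _).trans (le_trans ?_ hρv)
    gcongr
  obtain ⟨B, hB, h⟩ := exists_inverse_one_add hK
  have h1 := h b (-((r ∘L D) ∘L d)) (by
    nth_rewrite 1 [hb]
    ext1 u
    simp)
  have hB' : ‖-B‖ ≤ 2 := by rwa [norm_neg]
  have h2 := cellHS_comp_left_le_ofReal hB' (cellHS_comp_right_le_ofReal hrp hdp hdn hq)
  have h3 : b = (-B) ∘L ((r ∘L D) ∘L d) := by
    rw [h1]
    ext1 u
    simp
  rw [← h3] at h2
  rwa [show (2 : ℝ) ^ 2 = 4 by norm_num] at h2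

theorem norm_remainder_le (hb : ‖b‖ ≤ 2 * δ * ρ ^ 2) (hr' : ‖r'‖ ≤ ρ) (hdn : ‖d‖ ≤ ρ)
    (hV : ‖V‖ ≤ v) (hD : ‖D‖ ≤ δ) (hD' : ‖D'‖ ≤ δ) :
    ‖-(V ∘L b + (D ∘L r') ∘L (D' ∘L b) - (D ∘L r') ∘L (V ∘L d))‖ ≤
      (3 * v * δ + 2 * δ ^ 3 * ρ) * ρ ^ 2 := by
  have hρ := (norm_nonneg _).trans hr'
  have hv := (norm_nonneg _).trans hV
  have hδ := (norm_nonneg _).trans hD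
  rw [norm_neg]
  have h1 : ‖V ∘L b‖ ≤ v * (2 * δ * ρ ^ 2) :=
    (ContinuousLinearMap.opNorm_comp_le _ _).trans (by gcongr)
  have h0 : ‖D ∘L r'‖ ≤ δ * ρ := (ContinuousLinearMap.opNorm_comp_le _ _).trans (by gcongr)
  have h2 : ‖D' ∘L b‖ ≤ δ * (2 * δ * ρ ^ 2) :=
    (ContinuousLinearMap.opNorm_comp_le _ _).trans (by gcongr)
  have h3 : ‖V ∘L d‖ ≤ v * ρ := (ContinuousLinearMap.opNorm_comp_le _ _).trans (by gcongr)
  have h4 : ‖(D ∘L r') ∘L (D' ∘L b)‖ ≤ δ * ρ * (δ * (2 * δ * ρ ^ 2)) :=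
    (ContinuousLinearMap.opNorm_comp_le _ _).trans (by gcongr)
  have h5 : ‖(D ∘L r') ∘L (V ∘L d)‖ ≤ δ * ρ * (v * ρ) :=
    (ContinuousLinearMap.opNorm_comp_le _ _).trans (by gcongr)
  calc _ ≤ ‖V ∘L b‖ + ‖(D ∘L r') ∘L (D' ∘L b)‖ + ‖(D ∘L r') ∘L (V ∘L d)‖ :=
        (norm_sub_le _ _).trans (by gcongr; exact norm_add_le _ _)
    _ ≤ v * (2 * δ * ρ ^ 2) + δ * ρ * (δ * (2 * δ * ρ ^ 2)) + δ * ρ * (v * ρ) := by gcongr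
    _ = _ := by ring

/-- Every term of the remainder contains `b` or `D r'`, which are Hilbert–Schmidt per unit volume,
and either the potential or two further factors of the pairing. -/
theorem cellHS_remainder_le (hq0 : 0 ≤ q) (hb : ‖b‖ ≤ 2 * δ * ρ ^ 2)
    (hbq : cellHS b ≤ ENNReal.ofReal (4 * (ρ ^ 2 * q))) (hbp : IsPeriodicOp b)
    (hdp : IsPeriodicOp d) (hVp : IsPeriodicOp V) (hDp' : IsPeriodicOp D')
    (hDr : IsPeriodicOp (D ∘L r')) (hdn : ‖d‖ ≤ ρ) (hV : ‖V‖ ≤ v) (hD' : ‖D'‖ ≤ δ)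
    (hq : cellHS (D ∘L r') ≤ ENNReal.ofReal q) :
    cellHS (-(V ∘L b + (D ∘L r') ∘L (D' ∘L b) - (D ∘L r') ∘L (V ∘L d))) ≤
      ENNReal.ofReal ((18 * v ^ 2 + 16 * δ ^ 4 * ρ ^ 2) * ρ ^ 2 * q) := by
  have hρ := (norm_nonneg _).trans hdn
  have hv := (norm_nonneg _).trans hV
  have hδ := (norm_nonneg _).trans hD'
  have h1 : cellHS ((-V) ∘L b) ≤ ENNReal.ofReal (v ^ 2 * (4 * (ρ ^ 2 * q))) :=
    cellHS_comp_left_le_ofReal (by rwa [norm_neg]) hbq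
  have h2 : cellHS ((D ∘L r') ∘L ((-D') ∘L b)) ≤
      ENNReal.ofReal ((δ * (2 * δ * ρ ^ 2)) ^ 2 * q) := by
    refine cellHS_comp_right_le_ofReal hDr (hDp'.neg.comp hbp) ?_ hq
    refine (ContinuousLinearMap.opNorm_comp_le _ _).trans ?_
    rw [norm_neg]
    gcongr
  have h3 : cellHS ((D ∘L r') ∘L (V ∘L d)) ≤ ENNReal.ofReal ((v * ρ) ^ 2 * q) := by
    refine cellHS_comp_right_le_ofReal hDr (hVp.comp hdp) ?_ hq
    refine (ContinuousLinearMap.opNorm_comp_le _ _).trans ?_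
    gcongr
  have h4 := cellHS_add_le_ofReal (by positivity) (by positivity)
    (cellHS_add_le_ofReal (by positivity) (by positivity) h1 h2) h3
  have h5 : -(V ∘L b + (D ∘L r') ∘L (D' ∘L b) - (D ∘L r') ∘L (V ∘L d)) =
      (-V) ∘L b + (D ∘L r') ∘L ((-D') ∘L b) + (D ∘L r') ∘L (V ∘L d) := by
    ext1 u
    simp
    abel
  rw [h5]
  refine h4.trans (ENNReal.ofReal_le_ofReal (le_of_eq ?_))
  ring

end Entries

/-! ### The remainder beyond first order in the pairing function -/

/-- The sum `∑_n ω_n⁻²` over the positive Matsubara frequencies. -/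
noncomputable def matsubaraSum (β : ℝ) : ℝ := ∑' n, 1 / matsubara β n ^ 2

theorem cellHS_tsum_le {T : ℕ → L2 →L[ℂ] L2} (hT : Summable T) {w : ℕ → ℝ} (hw : ∀ n, 0 < w n)
    (hws : Summable w) {K : ℝ≥0∞} (h : ∀ n, cellHS (T n) ≤ K * ENNReal.ofReal (w n) ^ 2) :
    cellHS (∑' n, T n) ≤ K * ENNReal.ofReal (∑' n, w n) ^ 2 := by
  have h1 : (∑' n, T n) ∘L cell = ∑' n, T n ∘L cell :=
    ((ContinuousLinearMap.compL ℂ L2 L2 L2).flip cell).map_tsum hT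
  have h2 : Summable fun n => T n ∘L cell :=
    ((ContinuousLinearMap.compL ℂ L2 L2 L2).flip cell).summable hT
  rw [cellHS, h1]
  exact hsNormSq_tsum_le h2 hw hws h

/-- The constant in the Hilbert–Schmidt bound for the remainder at a single frequency, for a
potential bounded by `M`. -/
noncomputable def remainderConst (β μ M : ℝ) : ℝ :=
  symbolConst β μ ^ 2 * (9 * M ^ 2 + 8 * sobolevConst ^ 4 * (β / Real.pi) ^ 2)

theorem remainderConst_nonneg (β μ M : ℝ) : 0 ≤ remainderConst β μ M := by
  unfold remainderConst; positivity

theorem IsPotential.isBoundedData {W : ℝ → ℝ} (hW : IsPotential W) {Δ : ℝ → ℂ}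
    (hΔ : MemLp Δ ∞ volume) : IsBoundedData W Δ := by
  obtain ⟨M, hM⟩ := hW.bounded
  refine ⟨memLp_top_of_bound (Complex.continuous_ofReal.comp_aestronglyMeasurable
    hW.aestronglyMeasurable) M (.of_forall fun x => ?_), hΔ⟩
  simpa using hM x

section

variable {β μ M h : ℝ} {W : ℝ → ℝ} {ψ ψ' ψ'' : ℝ → ℂ}

/-- The off-diagonal entry of the resolvent at a single frequency: up to a remainder of
square norm of order `h⁵ |z|⁻⁴` it is the first order term. The factor `(1 + h∇)⁻¹` is split off the
remainder so that the `H¹` norm becomes the Hilbert–Schmidt norm per unit volume of `Y`. -/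
theorem exists_entry12_remainder (hβ : 0 < β) (hW : IsPotential W) (hM : ∀ x, |W x| ≤ M)
    (hh : 0 < h) (hhM : h ^ 2 * M * (β / Real.pi) ≤ 1 / 2) (hψ : IsPeriodicH2 ψ ψ' ψ'')
    (hA : IsSymmetricSurjective (HΔ h μ W fun x => -(h : ℂ) * ψ x)) :
    ∃ c : ℝ, 0 ≤ c ∧ ∀ z : ℂ, IsMatsubaraLike β z → ∃ Y : L2 →L[ℂ] L2, IsPeriodicOp Y ∧
      entry12 (hA.resolvent z) =
        -(h : ℂ) • (freeResolvent h μ z ∘L mulOp ψ ∘L freeResolvent h μ (-z)) +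
          momentumOp (smoothSymbol h) ∘L Y ∧
      ‖Y‖ ≤ c * (1 / |z.im| ^ 2) ∧
      cellHS Y ≤ ENNReal.ofReal (remainderConst β μ M * h ^ 5 *
        ((cellNormSq ψ + cellNormSq ψ') + (cellNormSq ψ + cellNormSq ψ') ^ 3)) *
          ENNReal.ofReal (1 / |z.im| ^ 2) ^ 2 := by
  set N := cellNormSq ψ + cellNormSq ψ' with hN
  have hN0 : 0 ≤ N := add_nonneg (cellNormSq_nonneg _) (cellNormSq_nonneg _)
  set Δ : ℝ → ℂ := fun x => -(h : ℂ) * ψ x with hΔdef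
  have hM0 : 0 ≤ M := (abs_nonneg _).trans (hM 0)
  have hK0 := sobolevConst_nonneg
  have hC1 := one_le_symbolConst hβ μ
  have hC0 : 0 ≤ symbolConst β μ := zero_le_one.trans hC1
  have hπ := Real.pi_pos
  have hΔm : MemLp Δ ∞ volume := hψ.memLp_top.const_mul _
  have hΔp : Function.Periodic Δ 1 := fun x => by simp only [hΔdef, hψ.periodic x]
  have hd := hW.isBoundedData hΔm
  have hΔs := memLp_top_star hΔm
  have hΔsp : Function.Periodic (fun x => star (Δ x)) 1 := fun x => by simp only [hΔp x]
  set v := h ^ 2 * M with hv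
  set δ := h * (sobolevConst * √N) with hδ
  have hδ0 : 0 ≤ δ := by positivity
  have hv0 : 0 ≤ v := by positivity
  have hDae : ∀ᵐ x, ‖Δ x‖ ≤ δ := by
    filter_upwards [hψ.ae_norm_le] with x hx
    rw [hΔdef, norm_mul, norm_neg, Complex.norm_real, Real.norm_of_nonneg hh.le]
    exact mul_le_mul_of_nonneg_left hx hh.le
  have hDn : ‖mulOp Δ‖ ≤ δ := mulOp_norm_le hδ0 hDae
  have hDn' : ‖mulOp fun x => star (Δ x)‖ ≤ δ := mulOp_norm_le hδ0 (by simpa using hDae)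
  set V : L2 →L[ℂ] L2 := ((h ^ 2 : ℝ) : ℂ) • mulOp (fun x => (W x : ℂ)) with hVdef
  have hVn : ‖V‖ ≤ v := by
    rw [hVdef, norm_smul, Complex.norm_real, Real.norm_of_nonneg (by positivity)]
    exact mul_le_mul_of_nonneg_left (mulOp_norm_le hM0 (.of_forall fun x => by simpa using hM x))
      (by positivity)
  have hVp : IsPeriodicOp V :=
    (mulOp_periodic hd.memLp_W fun x => by simp only [hW.periodic x]).smul _
  refine ⟨(1 + symbolConst β μ * (β / Real.pi)) * (3 * v * δ + 2 * δ ^ 3 * (β / Real.pi)),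
    by positivity, fun z hz => ?_⟩
  have him := hz.im_ne_zero hβ
  have hz' := hz.neg
  have him' := hz'.im_ne_zero hβ
  have himp := hz.abs_im_pos hβ
  set ρ := |z.im|⁻¹ with hρ
  have hρ0 : 0 ≤ ρ := by positivity
  have hρβ : ρ ≤ β / Real.pi := by
    rw [hρ, ← inv_div]
    exact inv_anti₀ (by positivity) hz.le_abs_im
  have hρ2 : 1 / |z.im| ^ 2 = ρ ^ 2 := by rw [hρ, inv_pow, one_div]
  set r := freeResolvent h μ z
  set r' := freeResolvent h μ (-z)
  have hr : ‖r‖ ≤ ρ := norm_freeResolvent_le h μ him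
  have hr' : ‖r'‖ ≤ ρ := by
    have := norm_freeResolvent_le h μ him'
    rwa [Complex.neg_im, abs_neg] at this
  have hrp : IsPeriodicOp r := freeResolvent_periodic h μ him
  have hrp' : IsPeriodicOp r' := freeResolvent_periodic h μ him'
  have hDp : IsPeriodicOp (mulOp Δ) := mulOp_periodic hΔm hΔp
  have hDp' : IsPeriodicOp (mulOp fun x => star (Δ x)) := mulOp_periodic hΔs hΔsp
  obtain ⟨hbp, hdp⟩ := resolvent_HΔ_periodic hh.ne' hA him hd hW.periodic hΔp
  have hb := entry12_resolvent_eq hh.ne' hA him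
  have hdd := entry22_resolvent_eq hh.ne' hA him
  have hdn : ‖entry22 (hA.resolvent z)‖ ≤ ρ := (norm_entry22_le _).trans (hA.norm_resolvent_le him)
  set b := entry12 (hA.resolvent z)
  set d := entry22 (hA.resolvent z)
  rw [← ContinuousLinearMap.smul_comp] at hb hdd
  have hρv : ρ * v ≤ 1 / 2 := by
    refine le_trans ?_ hhM
    rw [mul_comm]
    gcongr
  set q := symbolConst β μ * ρ * (1 / (2 * h)) * cellNormSq Δ with hq
  have hqN : q ≤ symbolConst β μ * ρ * h * N / 2 := by
    have h1 : cellNormSq Δ = h ^ 2 * cellNormSq ψ := by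
      rw [cellNormSq, cellNormSq, ← integral_const_mul]
      refine integral_congr_ae (.of_forall fun x => ?_)
      simp only [hΔdef, norm_mul, norm_neg, Complex.norm_real, mul_pow, Real.norm_eq_abs, sq_abs]
    have h2 : cellNormSq ψ ≤ N := le_add_of_nonneg_right (cellNormSq_nonneg _)
    have h3 : q = symbolConst β μ * ρ * h * cellNormSq ψ / 2 := by
      rw [hq, h1]
      field_simp
    rw [h3]
    gcongr
  have hq0 : 0 ≤ q := by
    have := cellNormSq_nonneg Δ
    positivity
  have hq1 : cellHS (r ∘L mulOp Δ) ≤ ENNReal.ofReal q :=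
    cellHS_freeResolvent_mulOp_le hβ hz hh μ hΔm
  have hq2 : cellHS (mulOp Δ ∘L r') ≤ ENNReal.ofReal q := by
    have := cellHS_mulOp_freeResolvent_le hβ hz' hh μ hΔm hΔp
    rwa [Complex.neg_im, abs_neg] at this
  have hbn := norm_entry12_le_of_system hb hr hdn hVn hρv hDn
  have hbq := cellHS_entry12_le hb hr hdn hVn hρv (hrp.comp hDp) hdp hq1
  have hXn := norm_remainder_le hbn hr' hdn hVn hDn hDn'
  have hXq := cellHS_remainder_le hq0 hbn hbq hbp hdp hVp hDp' (hDp.comp hrp') hdn hVn hDn' hq2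
  have hexp := entry_expansion hb hdd
  set X := -(V ∘L b + (mulOp Δ ∘L r') ∘L ((mulOp fun x => star (Δ x)) ∘L b) -
    (mulOp Δ ∘L r') ∘L (V ∘L d)) with hX
  have hXp : IsPeriodicOp X :=
    (((hVp.comp hbp).add ((hDp.comp hrp').comp (hDp'.comp hbp))).sub
      ((hDp.comp hrp').comp (hVp.comp hdp))).neg
  set S := momentumOp (weightedResSymbol h μ z)
  have hSn : ‖S‖ ≤ √(symbolConst β μ * ρ) :=
    norm_momentumOp_le (Real.sqrt_nonneg _) (norm_weightedResSymbol_le hβ hz h μ)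
  refine ⟨S ∘L X, (momentumOp_periodic (isSymbol_weightedResSymbol hβ hz h μ)).comp hXp, ?_, ?_, ?_⟩
  · have h1 : mulOp Δ = -(h : ℂ) • mulOp ψ := mulOp_const_mul _ hψ.memLp_top
    rw [hexp, h1]
    congr 1
    · rw [ContinuousLinearMap.smul_comp, ContinuousLinearMap.comp_smul]
    · rw [← ContinuousLinearMap.comp_assoc]
      congr 1
      exact freeResolvent_eq_smooth_comp hβ hz h μ
  · rw [hρ2]
    have h1 : √(symbolConst β μ * ρ) ≤ 1 + symbolConst β μ * (β / Real.pi) := by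
      refine (Real.sqrt_le_left (by positivity)).2 ?_
      have h2 : symbolConst β μ * ρ ≤ symbolConst β μ * (β / Real.pi) := by gcongr
      have h3 : 0 ≤ symbolConst β μ * (β / Real.pi) := by positivity
      nlinarith
    calc ‖S ∘L X‖ ≤ ‖S‖ * ‖X‖ := ContinuousLinearMap.opNorm_comp_le _ _
      _ ≤ (1 + symbolConst β μ * (β / Real.pi)) * ((3 * v * δ + 2 * δ ^ 3 * ρ) * ρ ^ 2) := by
          gcongr
          exact hSn.trans h1
      _ ≤ (1 + symbolConst β μ * (β / Real.pi)) *
            ((3 * v * δ + 2 * δ ^ 3 * (β / Real.pi)) * ρ ^ 2) := by gcongr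
      _ = _ := by ring
  · refine (cellHS_comp_left_le_ofReal hSn hXq).trans ?_
    rw [hρ2, ← ENNReal.ofReal_pow (by positivity), ← ENNReal.ofReal_mul (by
      have := remainderConst_nonneg β μ M
      positivity)]
    refine ENNReal.ofReal_le_ofReal ?_
    rw [Real.sq_sqrt (by positivity)]
    have hs4 : √N ^ 4 = N ^ 2 := by
      rw [show 4 = 2 * 2 from rfl, pow_mul, Real.sq_sqrt hN0]
    have h1 : δ ^ 4 = h ^ 4 * sobolevConst ^ 4 * N ^ 2 := by
      rw [hδ, mul_pow, mul_pow, hs4]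
      ring
    calc symbolConst β μ * ρ * ((18 * v ^ 2 + 16 * δ ^ 4 * ρ ^ 2) * ρ ^ 2 * q)
        ≤ symbolConst β μ * ρ * ((18 * v ^ 2 + 16 * δ ^ 4 * (β / Real.pi) ^ 2) * ρ ^ 2 *
            (symbolConst β μ * ρ * h * N / 2)) := by gcongr
      _ = symbolConst β μ ^ 2 * h ^ 5 * (ρ ^ 2) ^ 2 * (9 * M ^ 2 * N +
            8 * sobolevConst ^ 4 * (β / Real.pi) ^ 2 * N ^ 3) := by
          rw [h1, hv]
          ring
      _ ≤ symbolConst β μ ^ 2 * h ^ 5 * (ρ ^ 2) ^ 2 * (9 * M ^ 2 * (N + N ^ 3) +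
            8 * sobolevConst ^ 4 * (β / Real.pi) ^ 2 * (N + N ^ 3)) := by
          have h2 : N ≤ N + N ^ 3 := le_add_of_nonneg_right (by positivity)
          have h3 : N ^ 3 ≤ N + N ^ 3 := le_add_of_nonneg_left hN0
          gcongr
      _ = _ := by
          rw [remainderConst]
          ring

/-- The remainder `η₂`: all contributions to the Matsubara expansion of the off-diagonal entry
beyond those of first order in the pairing function and of zeroth order in the potential. -/
theorem exists_remainder (hβ : 0 < β) (hW : IsPotential W) (hM : ∀ x, |W x| ≤ M)
    (hh : 0 < h) (hhM : h ^ 2 * M * (β / Real.pi) ≤ 1 / 2) (hψ : IsPeriodicH2 ψ ψ' ψ'')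
    (hA : IsSymmetricSurjective (HΔ h μ W fun x => -(h : ℂ) * ψ x)) :
    ∃ η : L2 →L[ℂ] L2, IsPeriodicOp η ∧
      h1NormSq h η ≤ ENNReal.ofReal (4 / β ^ 2 * remainderConst β μ M * matsubaraSum β ^ 2 *
        h ^ 5 * ((cellNormSq ψ + cellNormSq ψ') + (cellNormSq ψ + cellNormSq ψ') ^ 3)) ∧
      HasSum (fun n => -(1 / β : ℂ) • (entry12 (hA.resolvent (matsubara β n * Complex.I)) +
        entry12 (hA.resolvent (-(matsubara β n * Complex.I))) + (h : ℂ) •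
        (freeResolvent h μ (matsubara β n * Complex.I) ∘L mulOp ψ ∘L
            freeResolvent h μ (-(matsubara β n * Complex.I)) +
          freeResolvent h μ (-(matsubara β n * Complex.I)) ∘L mulOp ψ ∘L
            freeResolvent h μ (matsubara β n * Complex.I)))) η := by
  obtain ⟨c, hc, H⟩ := exists_entry12_remainder (μ := μ) hβ hW hM hh hhM hψ hA
  set B := remainderConst β μ M * h ^ 5 *
    ((cellNormSq ψ + cellNormSq ψ') + (cellNormSq ψ + cellNormSq ψ') ^ 3) with hB
  have hB0 : 0 ≤ B := by
    have := remainderConst_nonneg β μ M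
    have := cellNormSq_nonneg ψ
    have := cellNormSq_nonneg ψ'
    positivity
  choose Y hYp hYe hYn hYq using fun n => H _ (isMatsubaraLike_matsubara hβ n)
  choose Z hZp hZe hZn hZq using fun n => H _ (isMatsubaraLike_matsubara hβ n).neg
  simp only [Complex.neg_im, abs_neg, abs_im_matsubara hβ] at hYn hYq hZn hZq
  set T : ℕ → L2 →L[ℂ] L2 := fun n => -(1 / β : ℂ) • (Y n + Z n) with hT
  have hw := summable_inv_matsubara_sq β
  have hTs : Summable T := by
    refine Summable.const_smul _ (.of_norm_bounded (hw.mul_left (2 * c)) fun n => ?_)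
    refine (norm_add_le _ _).trans ((add_le_add (hYn n) (hZn n)).trans_eq (by ring))
  have hTq : ∀ n, cellHS (T n) ≤
      ENNReal.ofReal (4 / β ^ 2 * B) * ENNReal.ofReal (1 / matsubara β n ^ 2) ^ 2 := by
    intro n
    have hw0 : 0 ≤ 1 / matsubara β n ^ 2 := by positivity
    have hY := hYq n
    have hZ := hZq n
    rw [← ENNReal.ofReal_pow hw0, ← ENNReal.ofReal_mul hB0] at hY hZ
    have h1 := cellHS_add_le_ofReal (by positivity) (by positivity) hY hZ
    have h2 : ‖-(1 / β : ℂ) • ContinuousLinearMap.id ℂ L2‖ ≤ 1 / β := by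
      rw [norm_smul, norm_neg, norm_div, norm_one, Complex.norm_real, Real.norm_of_nonneg hβ.le]
      exact mul_le_of_le_one_right (by positivity) ContinuousLinearMap.norm_id_le
    have h3 := cellHS_comp_left_le_ofReal h2 h1
    rw [← ENNReal.ofReal_pow hw0, ← ENNReal.ofReal_mul (by positivity)]
    refine h3.trans (ENNReal.ofReal_le_ofReal (le_of_eq ?_))
    field_simp
    ring
  have hsum := cellHS_tsum_le hTs
    (fun n => one_div_pos.2 (pow_pos (matsubara_pos hβ n) 2)) hw hTq
  refine ⟨momentumOp (smoothSymbol h) ∘L ∑' n, T n,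
    (momentumOp_periodic (isSymbol_smoothSymbol h)).comp
      (.tsum hTs fun n => ((hYp n).add (hZp n)).smul _), ?_, ?_⟩
  · refine (h1NormSq_smooth_comp_le h _).trans (hsum.trans_eq ?_)
    rw [← ENNReal.ofReal_pow (tsum_nonneg fun n => by positivity), ← ENNReal.ofReal_mul
      (by positivity), matsubaraSum, hB]
    congr 1
    ring
  · have h1 := (ContinuousLinearMap.compL ℂ L2 L2 L2 (momentumOp (smoothSymbol h))).hasSum
      hTs.hasSum
    have h2 : ∀ n, -(1 / β : ℂ) • (entry12 (hA.resolvent (matsubara β n * Complex.I)) +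
        entry12 (hA.resolvent (-(matsubara β n * Complex.I))) + (h : ℂ) •
        (freeResolvent h μ (matsubara β n * Complex.I) ∘L mulOp ψ ∘L
            freeResolvent h μ (-(matsubara β n * Complex.I)) +
          freeResolvent h μ (-(matsubara β n * Complex.I)) ∘L mulOp ψ ∘L
            freeResolvent h μ (matsubara β n * Complex.I))) =
        momentumOp (smoothSymbol h) ∘L T n := by
      intro n
      have h3 := hZe n
      rw [neg_neg] at h3
      rw [hYe n, h3, hT]
      simp only
      rw [ContinuousLinearMap.comp_smul, ContinuousLinearMap.comp_add]
      congr 1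
      module
    rw [funext h2]
    exact h1

end

/-! ### The first order term -/

/-- The map `B ↦ (k₀ - z)⁻¹ B (k₀ + z)⁻¹ + (k₀ + z)⁻¹ B (k₀ - z)⁻¹`. -/
noncomputable def sandwich (h μ : ℝ) (z : ℂ) : (L2 →L[ℂ] L2) →L[ℂ] (L2 →L[ℂ] L2) :=
  ContinuousLinearMap.compL ℂ L2 L2 L2 (freeResolvent h μ z) ∘L
      (ContinuousLinearMap.compL ℂ L2 L2 L2).flip (freeResolvent h μ (-z)) +
    ContinuousLinearMap.compL ℂ L2 L2 L2 (freeResolvent h μ (-z)) ∘L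
      (ContinuousLinearMap.compL ℂ L2 L2 L2).flip (freeResolvent h μ z)

theorem sandwich_apply (h μ : ℝ) (z : ℂ) (B : L2 →L[ℂ] L2) :
    sandwich h μ z B = freeResolvent h μ z ∘L B ∘L freeResolvent h μ (-z) +
      freeResolvent h μ (-z) ∘L B ∘L freeResolvent h μ z := rfl

theorem norm_sandwich_le (h μ : ℝ) {z : ℂ} (hz : z.im ≠ 0) :
    ‖sandwich h μ z‖ ≤ 2 * (1 / |z.im| ^ 2) := by
  refine ContinuousLinearMap.opNorm_le_bound _ (by positivity) fun B => ?_
  have h1 := norm_freeResolvent_le h μ hz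
  have h2 := norm_freeResolvent_le h μ (z := -z) (by simpa using hz)
  rw [Complex.neg_im, abs_neg] at h2
  have h3 : ∀ r r' : L2 →L[ℂ] L2, ‖r‖ ≤ |z.im|⁻¹ → ‖r'‖ ≤ |z.im|⁻¹ →
      ‖r ∘L B ∘L r'‖ ≤ |z.im|⁻¹ * (‖B‖ * |z.im|⁻¹) := by
    intro r r' hr hr'
    refine (ContinuousLinearMap.opNorm_comp_le _ _).trans ?_
    gcongr
    exact (ContinuousLinearMap.opNorm_comp_le _ _).trans (by gcongr)
  rw [sandwich_apply]
  refine (norm_add_le _ _).trans ((add_le_add (h3 _ _ h1 h2) (h3 _ _ h2 h1)).trans_eq ?_)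
  rw [one_div, ← inv_pow]
  ring

theorem summable_continuousLinearMap {E F : Type*} [NormedAddCommGroup E] [NormedSpace ℂ E]
    [NormedAddCommGroup F] [NormedSpace ℂ F] [CompleteSpace F] {T : ℕ → E →L[ℂ] F} {b : ℕ → ℝ}
    (hb : Summable b) (h : ∀ n, ‖T n‖ ≤ b n) : Summable T :=
  .of_norm_bounded hb h

theorem g0Op_eq (β h μ : ℝ) :
    g0Op β h μ = momentumOp fun p => (g0 (β * (h ^ 2 * p ^ 2 - μ)) : ℂ) := rfl

theorem abs_g0_le {β : ℝ} (hβ : 0 < β) (t : ℝ) : |g0 (β * t)| ≤ 4 / β ^ 2 * matsubaraSum β := by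
  have h1 := hasSum_g0 hβ t
  have hpos : ∀ n, 0 ≤ 4 / β ^ 2 * (1 / (t ^ 2 + matsubara β n ^ 2)) := fun n => by positivity
  rw [abs_of_nonneg (h1.nonneg hpos)]
  refine hasSum_le (fun n => ?_) h1 ((summable_inv_matsubara_sq β).hasSum.mul_left (4 / β ^ 2))
  have := matsubara_pos hβ n
  gcongr
  exact le_add_of_nonneg_left (sq_nonneg t)

theorem measurable_g0 : Measurable g0 := by
  unfold g0
  refine Measurable.ite (measurableSet_singleton 0) measurable_const ?_
  have : Measurable Real.tanh := by
    have h1 : Real.tanh = fun x => Real.sinh x / Real.cosh x := funext Real.tanh_eq_sinh_div_cosh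
    rw [h1]
    exact Real.measurable_sinh.div Real.measurable_cosh
  fun_prop

theorem isSymbol_g0 {β : ℝ} (hβ : 0 < β) (h μ : ℝ) :
    IsSymbol fun p => (g0 (β * (h ^ 2 * p ^ 2 - μ)) : ℂ) := by
  refine ⟨Complex.measurable_ofReal.comp (measurable_g0.comp (by fun_prop)),
    4 / β ^ 2 * matsubaraSum β, fun p => ?_⟩
  rw [Complex.norm_real]
  exact abs_g0_le hβ _

/-- The map `B ↦ (h/β) ∑_n ((k₀ - iω_n)⁻¹ B (k₀ + iω_n)⁻¹ + (k₀ + iω_n)⁻¹ B (k₀ - iω_n)⁻¹)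
- (βh/4) (B g₀(βk₀) + g₀(βk₀) B)`. -/
noncomputable def firstOrderError (β h μ : ℝ) : (L2 →L[ℂ] L2) →L[ℂ] (L2 →L[ℂ] L2) :=
  ((h / β : ℝ) : ℂ) • ∑' n, sandwich h μ (matsubara β n * Complex.I) -
    ((β * h / 4 : ℝ) : ℂ) • ((ContinuousLinearMap.compL ℂ L2 L2 L2).flip (g0Op β h μ) +
      ContinuousLinearMap.compL ℂ L2 L2 L2 (g0Op β h μ))

section FirstOrder

variable {β : ℝ} (hβ : 0 < β) (h μ : ℝ)

include hβ

theorem summable_sandwich : Summable fun n => sandwich h μ (matsubara β n * Complex.I) := by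
  have h1 : ∀ n, ‖sandwich h μ (matsubara β n * Complex.I)‖ ≤ 2 * (1 / matsubara β n ^ 2) := by
    intro n
    have h1 := norm_sandwich_le h μ ((isMatsubaraLike_matsubara hβ n).im_ne_zero hβ)
    rwa [abs_im_matsubara hβ] at h1
  exact summable_continuousLinearMap ((summable_inv_matsubara_sq β).mul_left 2) h1

theorem hasSum_sandwich (B : L2 →L[ℂ] L2) :
    HasSum (fun n => ((h / β : ℝ) : ℂ) • sandwich h μ (matsubara β n * Complex.I) B)
      (firstOrderError β h μ B +
        ((β * h / 4 : ℝ) : ℂ) • (B ∘L g0Op β h μ + g0Op β h μ ∘L B)) := by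
  have h1 := ((ContinuousLinearMap.apply ℂ (L2 →L[ℂ] L2) B).hasSum
    (summable_sandwich hβ h μ).hasSum).const_smul ((h / β : ℝ) : ℂ)
  have h2 : firstOrderError β h μ B +
      ((β * h / 4 : ℝ) : ℂ) • (B ∘L g0Op β h μ + g0Op β h μ ∘L B) =
      ((h / β : ℝ) : ℂ) • (∑' n, sandwich h μ (matsubara β n * Complex.I)) B :=
    sub_add_cancel _ _
  rw [h2]
  exact h1

theorem firstOrderError_periodic {B : L2 →L[ℂ] L2} (hB : IsPeriodicOp B) :
    IsPeriodicOp (firstOrderError β h μ B) := by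
  have h1 := hasSum_sandwich hβ h μ B
  have hg : IsPeriodicOp (g0Op β h μ) := momentumOp_periodic (isSymbol_g0 hβ h μ)
  have h2 : firstOrderError β h μ B =
      (∑' n, ((h / β : ℝ) : ℂ) • sandwich h μ (matsubara β n * Complex.I) B) -
        ((β * h / 4 : ℝ) : ℂ) • (B ∘L g0Op β h μ + g0Op β h μ ∘L B) := by
    rw [h1.tsum_eq, add_sub_cancel_right]
  rw [h2]
  refine (IsPeriodicOp.tsum h1.summable fun n => ?_).sub (((hB.comp hg).add (hg.comp hB)).smul _)
  have hz := isMatsubaraLike_matsubara hβ n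
  have hr := freeResolvent_periodic h μ (hz.im_ne_zero hβ)
  have hr' := freeResolvent_periodic h μ (hz.neg.im_ne_zero hβ)
  rw [sandwich_apply]
  exact ((hr.comp (hB.comp hr')).add (hr'.comp (hB.comp hr))).smul _

end FirstOrder

/-! ### The first order error on plane waves -/

theorem momentumOp_comp_wave_comp {m n : ℝ → ℂ} (hm : IsSymbol m) (hn : IsSymbol n) (l : ℝ) :
    momentumOp m ∘L mulOp (cexpi l) ∘L momentumOp n =
      momentumOp (fun p => m p * n (p + -(2 * Real.pi * l))) ∘L mulOp (cexpi l) := by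
  have h1 := momentumOp_comp_modulation (hn.comp_add (-(2 * Real.pi * l))) l
  simp only [add_neg_cancel_right] at h1
  rw [← h1, momentumOp_mul hm (hn.comp_add _), ContinuousLinearMap.comp_assoc]

theorem wave_comp_momentumOp {n : ℝ → ℂ} (hn : IsSymbol n) (l : ℝ) :
    mulOp (cexpi l) ∘L momentumOp n =
      momentumOp (fun p => n (p + -(2 * Real.pi * l))) ∘L mulOp (cexpi l) := by
  have h1 := momentumOp_comp_modulation (hn.comp_add (-(2 * Real.pi * l))) l
  simp only [add_neg_cancel_right] at h1
  exact h1.symm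

/-- The symbol of `sandwich h μ z` applied to the plane wave `e^{2πilx}`. -/
noncomputable def sandwichSymbol (h μ : ℝ) (z : ℂ) (l p : ℝ) : ℂ :=
  resSymbol h μ z p * resSymbol h μ (-z) (p + -(2 * Real.pi * l)) +
    resSymbol h μ (-z) p * resSymbol h μ z (p + -(2 * Real.pi * l))

section PlaneWave

variable {β : ℝ} {z : ℂ}

theorem isSymbol_sandwichSymbol (h μ : ℝ) (hz : z.im ≠ 0) (l : ℝ) :
    IsSymbol (sandwichSymbol h μ z l) := by
  have hz' : (-z).im ≠ 0 := by simpa using hz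
  exact ((isSymbol_resSymbol h μ hz).mul ((isSymbol_resSymbol h μ hz').comp_add _)).add
    ((isSymbol_resSymbol h μ hz').mul ((isSymbol_resSymbol h μ hz).comp_add _))

theorem sandwich_wave (h μ : ℝ) (hz : z.im ≠ 0) (l : ℝ) :
    sandwich h μ z (mulOp (cexpi l)) =
      momentumOp (sandwichSymbol h μ z l) ∘L mulOp (cexpi l) := by
  have hz' : (-z).im ≠ 0 := by simpa using hz
  have hm := isSymbol_resSymbol h μ hz
  have hm' := isSymbol_resSymbol h μ hz'
  rw [sandwich_apply]
  unfold freeResolvent sandwichSymbol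
  rw [momentumOp_comp_wave_comp hm hm', momentumOp_comp_wave_comp hm' hm,
    momentumOp_add (hm.mul (hm'.comp_add _)) (hm'.mul (hm.comp_add _)),
    ContinuousLinearMap.add_comp]

theorem norm_resSymbol_neg (hz : z.re = 0) (h μ p : ℝ) :
    ‖resSymbol h μ (-z) p‖ = ‖resSymbol h μ z p‖ := by
  have h1 : resSymbol h μ (-z) p = star (resSymbol h μ z p) := by
    have : (-z) = star z := by apply Complex.ext <;> simp [hz]
    rw [this]
    simp [resSymbol]
  rw [h1, norm_star]

/-- The resolvent identity for symbols. -/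
theorem resSymbol_sub (h μ : ℝ) (hz : z.im ≠ 0) (p q : ℝ) :
    resSymbol h μ z p - resSymbol h μ z q =
      ((h ^ 2 * q ^ 2 - h ^ 2 * p ^ 2 : ℝ) : ℂ) * (resSymbol h μ z p * resSymbol h μ z q) := by
  have h1 := ofReal_sub_ne_zero hz (h ^ 2 * p ^ 2 - μ)
  have h2 := ofReal_sub_ne_zero hz (h ^ 2 * q ^ 2 - μ)
  unfold resSymbol
  rw [inv_sub_inv h1 h2, ← mul_inv, div_eq_mul_inv]
  congr 1
  push_cast
  ring

/-- The double commutator structure: replacing `r B r*` by `(B r r* + r r* B)/2` costs two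
derivatives of `B`. -/
theorem norm_sandwichSymbol_sub_le (hβ : 0 < β) (hz : IsMatsubaraLike β z) (h μ l p : ℝ) :
    (1 + (h * p) ^ 2) * ‖sandwichSymbol h μ z l p - (resSymbol h μ z p * resSymbol h μ (-z) p +
        resSymbol h μ z (p + -(2 * Real.pi * l)) * resSymbol h μ (-z) (p + -(2 * Real.pi * l)))‖ ≤
      4 * symbolConst β μ ^ 2 * (h * (2 * Real.pi * l)) ^ 2 * (1 / |z.im| ^ 2) := by
  have hC1 := one_le_symbolConst hβ μ
  set C := symbolConst β μ
  have him := hz.im_ne_zero hβ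
  have him' := hz.neg.im_ne_zero hβ
  set q := p + -(2 * Real.pi * l) with hq
  have h1 : sandwichSymbol h μ z l p - (resSymbol h μ z p * resSymbol h μ (-z) p +
      resSymbol h μ z q * resSymbol h μ (-z) q) =
      -((resSymbol h μ z p - resSymbol h μ z q) *
        (resSymbol h μ (-z) p - resSymbol h μ (-z) q)) := by
    rw [sandwichSymbol]
    ring
  rw [h1, resSymbol_sub h μ him, resSymbol_sub h μ him', norm_neg, norm_mul, norm_mul, norm_mul,
    norm_mul, norm_mul, norm_resSymbol_neg hz.re_eq, norm_resSymbol_neg hz.re_eq, Complex.norm_real,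
    Real.norm_eq_abs]
  have hP := norm_resSymbol_le h μ him p
  have hQ := norm_resSymbol_le h μ him q
  have hxP := one_add_sq_mul_norm_resSymbol_le hβ hz h μ p
  have hyQ := one_add_sq_mul_norm_resSymbol_le hβ hz h μ q
  have hP0 := norm_nonneg (resSymbol h μ z p)
  have hQ0 := norm_nonneg (resSymbol h μ z q)
  set P := ‖resSymbol h μ z p‖
  set Q := ‖resSymbol h μ z q‖
  set ρ := |z.im|⁻¹ with hρ
  have hρ0 : 0 ≤ ρ := by positivity
  have hC0 : 0 ≤ C := by linarith
  have hρ2 : 1 / |z.im| ^ 2 = ρ ^ 2 := by rw [hρ, inv_pow, one_div]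
  have h2 : |h ^ 2 * q ^ 2 - h ^ 2 * p ^ 2| * |h ^ 2 * q ^ 2 - h ^ 2 * p ^ 2| ≤
      (h * (2 * Real.pi * l)) ^ 2 * (2 * ((1 + (h * p) ^ 2) + (1 + (h * q) ^ 2))) := by
    rw [abs_mul_abs_self]
    have h3 : (h ^ 2 * q ^ 2 - h ^ 2 * p ^ 2) * (h ^ 2 * q ^ 2 - h ^ 2 * p ^ 2) =
        (h * (2 * Real.pi * l)) ^ 2 * (h * p + h * q) ^ 2 := by
      have : 2 * Real.pi * l = p - q := by rw [hq]; ring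
      rw [this]
      ring
    rw [h3]
    gcongr
    nlinarith [sq_nonneg (h * p - h * q)]
  set L := (h * (2 * Real.pi * l)) ^ 2
  have hL : 0 ≤ L := sq_nonneg _
  calc (1 + (h * p) ^ 2) * (|h ^ 2 * q ^ 2 - h ^ 2 * p ^ 2| * (P * Q) *
        (|h ^ 2 * q ^ 2 - h ^ 2 * p ^ 2| * (P * Q)))
      = (|h ^ 2 * q ^ 2 - h ^ 2 * p ^ 2| * |h ^ 2 * q ^ 2 - h ^ 2 * p ^ 2|) *
          ((1 + (h * p) ^ 2) * (P * Q) ^ 2) := by ring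
    _ ≤ (L * (2 * ((1 + (h * p) ^ 2) + (1 + (h * q) ^ 2)))) *
          ((1 + (h * p) ^ 2) * (P * Q) ^ 2) := by gcongr
    _ = 2 * L * (((1 + (h * p) ^ 2) * P) * ((1 + (h * p) ^ 2) * P) * (Q * Q) +
          ((1 + (h * p) ^ 2) * P) * ((1 + (h * q) ^ 2) * Q) * (P * Q)) := by ring
    _ ≤ 2 * L * (C * C * (ρ * ρ) + C * C * (ρ * ρ)) := by gcongr
    _ = 4 * C ^ 2 * L * (1 / |z.im| ^ 2) := by
        rw [hρ2]
        ring

end PlaneWave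

section PlaneWaveSum

variable {β : ℝ} (hβ : 0 < β) (h μ : ℝ)

/-- The symbol of the first order error on the plane wave `e^{2πilx}`. -/
noncomputable def errorSymbol (β h μ l p : ℝ) : ℂ :=
  ((h / β : ℝ) : ℂ) * ∑' n, sandwichSymbol h μ (matsubara β n * Complex.I) l p -
    ((β * h / 4 : ℝ) : ℂ) * ((g0 (β * (h ^ 2 * (p + -(2 * Real.pi * l)) ^ 2 - μ)) : ℂ) +
      (g0 (β * (h ^ 2 * p ^ 2 - μ)) : ℂ))

include hβ

theorem norm_sandwichSymbol_le (n : ℕ) (l p : ℝ) :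
    ‖sandwichSymbol h μ (matsubara β n * Complex.I) l p‖ ≤ 2 * (1 / matsubara β n ^ 2) := by
  have hz := isMatsubaraLike_matsubara hβ n
  have h1 := fun p => norm_resSymbol_le h μ (hz.im_ne_zero hβ) p
  have h2 := fun p => norm_resSymbol_le h μ (hz.neg.im_ne_zero hβ) p
  simp only [Complex.neg_im, abs_neg, abs_im_matsubara hβ] at h1 h2
  have hω := matsubara_pos hβ n
  rw [sandwichSymbol]
  refine (norm_add_le _ _).trans ?_
  rw [norm_mul, norm_mul]
  refine (add_le_add (mul_le_mul (h1 _) (h2 _) (norm_nonneg _) (by positivity))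
    (mul_le_mul (h2 _) (h1 _) (norm_nonneg _) (by positivity))).trans_eq ?_
  rw [one_div, ← inv_pow]
  ring

theorem summable_sandwichSymbol (l p : ℝ) :
    Summable fun n => sandwichSymbol h μ (matsubara β n * Complex.I) l p :=
  .of_norm_bounded ((summable_inv_matsubara_sq β).mul_left 2) fun n =>
    norm_sandwichSymbol_le hβ h μ n l p

theorem isSymbol_tsum_sandwichSymbol (l : ℝ) :
    IsSymbol fun p => ∑' n, sandwichSymbol h μ (matsubara β n * Complex.I) l p := by
  have hs := (summable_inv_matsubara_sq β).mul_left 2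
  refine ⟨?_, ∑' n, 2 * (1 / matsubara β n ^ 2), fun p => ?_⟩
  · refine measurable_of_tendsto_metrizable (f := fun N p =>
      ∑ n ∈ Finset.range N, sandwichSymbol h μ (matsubara β n * Complex.I) l p) (fun N => ?_) ?_
    · exact (IsSymbol.sum (fun n => isSymbol_sandwichSymbol h μ
        ((isMatsubaraLike_matsubara hβ n).im_ne_zero hβ) l) N).measurable
    · rw [tendsto_pi_nhds]
      exact fun p => (summable_sandwichSymbol hβ h μ l p).hasSum.tendsto_sum_nat
  · exact tsum_of_norm_bounded hs.hasSum fun n => norm_sandwichSymbol_le hβ h μ n l p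

theorem isSymbol_errorSymbol (l : ℝ) : IsSymbol (errorSymbol β h μ l) := by
  have hg := isSymbol_g0 hβ h μ
  have h1 := ((IsSymbol.const ((h / β : ℝ) : ℂ)).mul (isSymbol_tsum_sandwichSymbol hβ h μ l)).add
    ((IsSymbol.const (-((β * h / 4 : ℝ) : ℂ))).mul
      ((hg.comp_add (-(2 * Real.pi * l))).add hg))
  simp only [neg_mul, ← sub_eq_add_neg] at h1
  exact h1

theorem firstOrderError_wave (l : ℝ) :
    firstOrderError β h μ (mulOp (cexpi l)) =
      momentumOp (errorSymbol β h μ l) ∘L mulOp (cexpi l) := by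
  have hsym := isSymbol_tsum_sandwichSymbol hβ h μ l
  have hg := isSymbol_g0 hβ h μ
  have h1 := hasSum_momentumOp (fun n => isSymbol_sandwichSymbol h μ
    ((isMatsubaraLike_matsubara hβ n).im_ne_zero hβ) l)
    ((summable_inv_matsubara_sq β).mul_left 2)
    (fun n p => norm_sandwichSymbol_le hβ h μ n l p) hsym
    fun p => (summable_sandwichSymbol hβ h μ l p).hasSum
  have h2 := (((ContinuousLinearMap.compL ℂ L2 L2 L2).flip (mulOp (cexpi l))).hasSum h1).const_smul
    ((h / β : ℝ) : ℂ)
  have h3 := hasSum_sandwich hβ h μ (mulOp (cexpi l))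
  simp only [sandwich_wave h μ ((isMatsubaraLike_matsubara hβ _).im_ne_zero hβ) l] at h3
  have h4 := h3.unique h2
  rw [← eq_sub_iff_add_eq] at h4
  have h5 : errorSymbol β h μ l = fun p =>
      ((h / β : ℝ) : ℂ) * ∑' n, sandwichSymbol h μ (matsubara β n * Complex.I) l p -
        ((β * h / 4 : ℝ) : ℂ) * ((fun p => (g0 (β * (h ^ 2 * p ^ 2 - μ)) : ℂ))
          (p + -(2 * Real.pi * l)) + (g0 (β * (h ^ 2 * p ^ 2 - μ)) : ℂ)) := rfl
  rw [h4, h5, momentumOp_sub ((IsSymbol.const _).mul hsym)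
    ((IsSymbol.const _).mul ((hg.comp_add _).add hg)), momentumOp_const_mul _ hsym,
    momentumOp_const_mul _ ((hg.comp_add _).add hg), momentumOp_add (hg.comp_add _) hg, g0Op_eq,
    wave_comp_momentumOp hg, ContinuousLinearMap.sub_comp, ContinuousLinearMap.smul_comp,
    ContinuousLinearMap.smul_comp, ContinuousLinearMap.add_comp]
  rfl

/-- The expansion of `g₀` identifies `(βh/4) g₀(βk₀)` with `(h/β) ∑_n (k₀ - iω_n)⁻¹ (k₀ + iω_n)⁻¹`,
so that the estimate for a single frequency can be summed. -/
theorem norm_errorSymbol_le (hh : 0 < h) (l p : ℝ) :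
    (1 + (h * p) ^ 2) * ‖errorSymbol β h μ l p‖ ≤
      4 * symbolConst β μ ^ 2 * matsubaraSum β / β * h ^ 3 * (2 * Real.pi * l) ^ 2 := by
  set q := p + -(2 * Real.pi * l) with hq
  have hres : ∀ (n : ℕ) (p : ℝ), resSymbol h μ (matsubara β n * Complex.I) p *
      resSymbol h μ (-(matsubara β n * Complex.I)) p =
      ((1 / ((h ^ 2 * p ^ 2 - μ) ^ 2 + matsubara β n ^ 2) : ℝ) : ℂ) := by
    intro n p
    unfold resSymbol
    rw [← mul_inv, one_div, Complex.ofReal_inv]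
    congr 1
    push_cast
    linear_combination (-(matsubara β n : ℂ) ^ 2) * Complex.I_sq
  have hgs : ∀ p : ℝ, HasSum (fun n => ((h / β : ℝ) : ℂ) *
      (resSymbol h μ (matsubara β n * Complex.I) p *
        resSymbol h μ (-(matsubara β n * Complex.I)) p))
      (((β * h / 4 : ℝ) : ℂ) * (g0 (β * (h ^ 2 * p ^ 2 - μ)) : ℂ)) := by
    intro p
    have h1 : HasSum (fun n => h / β * (1 / ((h ^ 2 * p ^ 2 - μ) ^ 2 + matsubara β n ^ 2)))
        (β * h / 4 * g0 (β * (h ^ 2 * p ^ 2 - μ))) := by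
      refine hasSum_of_eq ((hasSum_g0 hβ (h ^ 2 * p ^ 2 - μ)).mul_left (β * h / 4))
        (fun n => ?_) rfl
      field_simp
    have h2 := Complex.hasSum_ofReal.2 h1
    simp only [Complex.ofReal_mul _ (g0 _), Complex.ofReal_mul (h / β)] at h2
    simp only [hres]
    exact h2
  have h1 := ((summable_sandwichSymbol hβ h μ l p).hasSum.mul_left ((h / β : ℝ) : ℂ)).sub
    ((hgs q).add (hgs p))
  have h2 : HasSum (fun n => ((h / β : ℝ) : ℂ) *
      (sandwichSymbol h μ (matsubara β n * Complex.I) l p -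
        (resSymbol h μ (matsubara β n * Complex.I) p *
          resSymbol h μ (-(matsubara β n * Complex.I)) p +
        resSymbol h μ (matsubara β n * Complex.I) q *
          resSymbol h μ (-(matsubara β n * Complex.I)) q))) (errorSymbol β h μ l p) := by
    rw [errorSymbol, mul_add]
    refine h1.congr_fun fun n => ?_
    ring
  have hx : 0 < 1 + (h * p) ^ 2 := by positivity
  rw [← le_div_iff₀' hx]
  rw [← h2.tsum_eq]
  refine (tsum_of_norm_bounded ((summable_inv_matsubara_sq β).hasSum.mul_left
    (h / β * (4 * symbolConst β μ ^ 2 * (h * (2 * Real.pi * l)) ^ 2) / (1 + (h * p) ^ 2)))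
    fun n => ?_).trans_eq ?_
  · rw [norm_mul, Complex.norm_real, Real.norm_of_nonneg (by positivity), mul_div_assoc, mul_assoc]
    gcongr
    rw [div_mul_eq_mul_div, le_div_iff₀' hx]
    have h3 := norm_sandwichSymbol_sub_le hβ (isMatsubaraLike_matsubara hβ n) h μ l p
    rwa [abs_im_matsubara hβ] at h3
  · rw [matsubaraSum]
    field_simp

end PlaneWaveSum

/-! ### The first order error for periodic functions -/

/-- For fixed `ξ` the vectors representing `u ↦ 𝓕(e^{2πilx} χ u)(ξ)`, `l ∈ ℤ`, are orthonormal, so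
the contributions of different Fourier modes of `ψ` do not interfere. -/
theorem orthonormal_waveVec (ξ : ℝ) :
    Orthonormal ℂ fun l : ℤ => waveVec (memLp_cexpi l) ξ := by
  rw [orthonormal_iff_ite]
  intro l m
  rw [inner_L2_eq]
  have h1 : (∫ x, star (waveVec (memLp_cexpi l) ξ x) * waveVec (memLp_cexpi m) ξ x) =
      ∫ x, (Set.Icc (0 : ℝ) 1).indicator (cexpi ((l - m : ℤ) : ℝ)) x := by
    refine integral_congr_ae ?_
    filter_upwards [(memLp_waveVec (memLp_cexpi l) ξ).coeFn_toLp,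
      (memLp_waveVec (memLp_cexpi m) ξ).coeFn_toLp] with x h1 h2
    rw [waveVec, waveVec, h1, h2, star_star]
    by_cases hx : x ∈ Set.Icc (0 : ℝ) 1
    · rw [Set.indicator_of_mem hx, Set.indicator_of_mem hx, Pi.one_apply, mul_one, mul_one,
        star_mul', star_cexpi, star_cexpi, neg_neg]
      have h3 : cexpi (-ξ) x * cexpi ξ x = 1 := by
        rw [← cexpi_add, neg_add_cancel]
        simp [cexpi]
      push_cast
      rw [sub_eq_add_neg, cexpi_add]
      linear_combination (cexpi l x * cexpi (-m) x) * h3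
    · rw [Set.indicator_of_notMem hx, Set.indicator_of_notMem hx]
      simp
  rw [h1, integral_indicator measurableSet_Icc, integral_cexpi]
  simp [sub_eq_zero]

theorem enorm_sq_sum_smul {ι E : Type*} [NormedAddCommGroup E] [InnerProductSpace ℂ E] {v : ι → E}
    (hv : Orthonormal ℂ v) (a : ι → ℂ) (s : Finset ι) :
    ‖∑ i ∈ s, a i • v i‖ₑ ^ 2 = ENNReal.ofReal (∑ i ∈ s, ‖a i‖ ^ 2) := by
  rw [enorm_sq_eq_ofReal]
  congr 1
  have h1 : ((‖∑ i ∈ s, a i • v i‖ : ℂ) ^ 2) = ((∑ i ∈ s, ‖a i‖ ^ 2 : ℝ) : ℂ) := by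
    have h2 := inner_self_eq_norm_sq_to_K (𝕜 := ℂ) (∑ i ∈ s, a i • v i)
    refine h2.symm.trans ?_
    rw [hv.inner_sum, Complex.ofReal_sum]
    refine Finset.sum_congr rfl fun i _ => ?_
    rw [← Complex.normSq_eq_norm_sq, Complex.normSq_eq_conj_mul_self]
  exact_mod_cast h1

theorem fourier_sum_repr {ι : Type*} {T : ι → L2 →L[ℂ] L2} {g : ι → ℝ → L2}
    (hg : ∀ i u, ((𝓕 (T i u) : L2) : ℝ → ℂ) =ᵐ[volume] fun ξ => inner ℂ (g i ξ) u) (c : ι → ℂ)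
    (s : Finset ι) (u : L2) : ((𝓕 ((∑ i ∈ s, c i • T i) u) : L2) : ℝ → ℂ) =ᵐ[volume]
      fun ξ => inner ℂ (∑ i ∈ s, star (c i) • g i ξ) u := by
  classical
  induction s using Finset.induction_on with
  | empty =>
    have h0 : (𝓕 (0 : L2) : L2) = 0 := (Lp.fourierTransformₗᵢ ℝ ℂ).map_zero
    simp only [Finset.sum_empty, zero_apply, h0, inner_zero_left]
    exact Lp.coeFn_zero _ _ _
  | insert a s ha ih =>
    simp only [Finset.sum_insert ha]
    rw [add_apply, smul_apply, fourier_add, fourier_smul]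
    filter_upwards [Lp.coeFn_add (c a • (𝓕 (T a u) : L2)) (𝓕 ((∑ i ∈ s, c i • T i) u) : L2),
      Lp.coeFn_smul (c a) (𝓕 (T a u) : L2), ih, hg a u] with ξ h1 h2 h3 h4
    rw [h1, Pi.add_apply, h2, Pi.smul_apply, h3, h4, inner_add_left, inner_smul_left]
    simp

/-- The bound on `η₁`: by orthogonality of the plane waves it reduces to the bound on the symbols,
where two factors of `2πl` turn the Fourier coefficients of `ψ` into those of `ψ''`. Lower
semicontinuity passes from trigonometric polynomials to `ψ`. -/
theorem h1NormSq_firstOrderError_le {β : ℝ} (hβ : 0 < β) {h : ℝ} (hh : 0 < h) (μ : ℝ)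
    {ψ ψ' ψ'' : ℝ → ℂ} (hψ : IsPeriodicH2 ψ ψ' ψ'') :
    h1NormSq h (firstOrderError β h μ (mulOp ψ)) ≤
      ENNReal.ofReal ((4 * symbolConst β μ ^ 2 * matsubaraSum β / β) ^ 2 * h ^ 5 *
        cellNormSq ψ'') := by
  set K := 4 * symbolConst β μ ^ 2 * matsubaraSum β / β with hK
  have hlim := (firstOrderError β h μ).hasSum hψ.hasSum_mulOp
  refine h1NormSq_le_of_tendsto h hlim fun s => ?_
  have hsum : ∑ l ∈ s, firstOrderError β h μ (coeff ψ l • mulOp (cexpi l)) =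
      ∑ l ∈ s, coeff ψ l • (momentumOp (errorSymbol β h μ l) ∘L mulOp (cexpi l)) := by
    refine Finset.sum_congr rfl fun l _ => ?_
    rw [map_smul, firstOrderError_wave hβ]
  have hg : ∀ (l : ℤ) u, ((𝓕 (((momentumOp (errorSymbol β h μ l) ∘L mulOp (cexpi l)) ∘L cell) u) :
      L2) : ℝ → ℂ) =ᵐ[volume] fun ξ =>
        inner ℂ (star (errorSymbol β h μ l (2 * Real.pi * ξ)) • waveVec (memLp_cexpi l) ξ) u := by
    intro l u
    filter_upwards [fourier_momentumOp (isSymbol_errorSymbol hβ h μ l) (mulOp (cexpi l) (cell u)),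
      fourier_mulOp_cell (memLp_cexpi l) u] with ξ h1 h2
    rw [ContinuousLinearMap.comp_apply, ContinuousLinearMap.comp_apply, h1, h2, inner_smul_left]
    simp
  have hrepr := fourier_sum_repr hg (fun l => coeff ψ l) s
  have hcomp : ∀ u, (∑ l ∈ s, coeff ψ l •
      (momentumOp (errorSymbol β h μ l) ∘L mulOp (cexpi l))) (cell u) =
      (∑ l ∈ s, coeff ψ l •
        ((momentumOp (errorSymbol β h μ l) ∘L mulOp (cexpi l)) ∘L cell)) u := by
    intro u
    simp [sum_apply]
  rw [hsum]
  refine (h1NormSq_le_lintegral h fun u => by rw [hcomp]; exact hrepr u).trans ?_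
  have hpt : ∀ ξ : ℝ, ENNReal.ofReal (1 + h ^ 2 * (2 * Real.pi * ξ) ^ 2) *
      ‖∑ l ∈ s, star (coeff ψ l) • (star (errorSymbol β h μ l (2 * Real.pi * ξ)) •
        waveVec (memLp_cexpi l) ξ)‖ₑ ^ 2 ≤
      ENNReal.ofReal (K ^ 2 * h ^ 6 * cellNormSq ψ'') *
        ENNReal.ofReal (1 + (h * (2 * Real.pi * ξ)) ^ 2)⁻¹ := by
    intro ξ
    simp only [smul_smul]
    rw [enorm_sq_sum_smul (orthonormal_waveVec ξ), ← ENNReal.ofReal_mul (by positivity),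
      ← ENNReal.ofReal_mul (mul_nonneg (by positivity) (cellNormSq_nonneg _))]
    refine ENNReal.ofReal_le_ofReal ?_
    have hx : 0 < 1 + (h * (2 * Real.pi * ξ)) ^ 2 := by positivity
    rw [← div_eq_mul_inv, le_div_iff₀ hx, Finset.mul_sum, Finset.sum_mul]
    have h1 := sum_le_hasSum s (fun l _ => by positivity)
      (hψ.hasSum_sq_coeff_deriv2.mul_left (K ^ 2 * h ^ 6))
    refine le_trans (Finset.sum_le_sum fun l _ => ?_) h1
    have h2 := norm_errorSymbol_le hβ h μ hh l (2 * Real.pi * ξ)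
    rw [← hK] at h2
    have h3 := pow_le_pow_left₀ (by positivity) h2 2
    rw [norm_mul, norm_star, norm_star]
    calc (1 + h ^ 2 * (2 * Real.pi * ξ) ^ 2) * (‖coeff ψ l‖ *
          ‖errorSymbol β h μ l (2 * Real.pi * ξ)‖) ^ 2 * (1 + (h * (2 * Real.pi * ξ)) ^ 2)
        = ‖coeff ψ l‖ ^ 2 * ((1 + (h * (2 * Real.pi * ξ)) ^ 2) *
          ‖errorSymbol β h μ l (2 * Real.pi * ξ)‖) ^ 2 := by ring
      _ ≤ ‖coeff ψ l‖ ^ 2 * (K * h ^ 3 * (2 * Real.pi * l) ^ 2) ^ 2 := by gcongr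
      _ = _ := by ring
  refine (lintegral_mono hpt).trans ?_
  rw [lintegral_const_mul _ (by fun_prop), lintegral_inv_one_add_sq hh,
    ← ENNReal.ofReal_mul (mul_nonneg (by positivity) (cellNormSq_nonneg _))]
  refine ENNReal.ofReal_le_ofReal ?_
  have h4 := cellNormSq_nonneg ψ''
  have h5 : K ^ 2 * h ^ 6 * cellNormSq ψ'' * (1 / (2 * h)) =
      K ^ 2 * h ^ 5 * cellNormSq ψ'' * (1 / 2) := by
    field_simp
  rw [h5]
  have h6 : 0 ≤ K ^ 2 * h ^ 5 * cellNormSq ψ'' := by positivity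
  linarith

/-! ### The off-diagonal entry of the Fermi operator -/

theorem entry12_fermiPartial {A : L2Sum →ₗ.[ℂ] L2Sum} (hA : IsSymmetricSurjective A) (β : ℝ)
    (N : ℕ) : entry12 (hA.fermiPartial β N) = ∑ n ∈ Finset.range N, -(1 / β : ℂ) •
      (entry12 (hA.resolvent (matsubara β n * Complex.I)) +
        entry12 (hA.resolvent (-(matsubara β n * Complex.I)))) := by
  ext1 u
  have h1 : hA.fermiPartial β N (WithLp.toLp 2 (0, u)) =
      (1 / 2 : ℂ) • (WithLp.toLp 2 (0, u) : L2Sum) - (1 / β : ℂ) • ∑ n ∈ Finset.range N,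
        (hA.resolvent (matsubara β n * Complex.I) (WithLp.toLp 2 (0, u)) +
          hA.resolvent (-(matsubara β n * Complex.I)) (WithLp.toLp 2 (0, u))) := by
    rw [IsSymmetricSurjective.fermiPartial, sub_apply, smul_apply, smul_apply, sum_apply]
    rfl
  have h2 : ∀ x y : L2Sum, (x - y).fst = x.fst - y.fst := fun _ _ => rfl
  have h3 : ∀ (c : ℂ) (x : L2Sum), (c • x).fst = c • x.fst := fun _ _ => rfl
  have h4 : ∀ f : ℕ → L2Sum, (∑ n ∈ Finset.range N, f n).fst = ∑ n ∈ Finset.range N, (f n).fst :=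
    fun f => map_sum (WithLp.fstL 2 ℂ L2 L2) f _
  have h5 : ∀ x y : L2Sum, (x + y).fst = x.fst + y.fst := fun _ _ => rfl
  rw [entry12_apply, h1, h2, h3, h3, h4, sum_apply]
  change (1 / 2 : ℂ) • (0 : L2) - _ = _
  rw [smul_zero, zero_sub, Finset.smul_sum, ← Finset.sum_neg_distrib]
  refine Finset.sum_congr rfl fun n _ => ?_
  rw [h5, smul_apply, add_apply, entry12_apply, entry12_apply, neg_smul]

/-- The off-diagonal entry of the weak limit of the Matsubara expansion. -/
theorem entry12_eq_of_hasSum {A : L2Sum →ₗ.[ℂ] L2Sum} (hA : IsSymmetricSurjective A) {β : ℝ}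
    {R : L2Sum →L[ℂ] L2Sum}
    (hR : ∀ u v, Filter.Tendsto (fun N => (inner ℂ u (hA.fermiPartial β N v) : ℂ)) Filter.atTop
      (nhds (inner ℂ u (R v)))) {S : L2 →L[ℂ] L2}
    (hS : HasSum (fun n => -(1 / β : ℂ) • (entry12 (hA.resolvent (matsubara β n * Complex.I)) +
        entry12 (hA.resolvent (-(matsubara β n * Complex.I))))) S) : entry12 R = S := by
  have h1 := hS.tendsto_sum_nat
  simp only [← entry12_fermiPartial hA β] at h1
  ext1 v
  refine ext_inner_left ℂ fun u => ?_
  have h2 : ∀ B : L2Sum →L[ℂ] L2Sum, (inner ℂ u (entry12 B v) : ℂ) =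
      inner ℂ (WithLp.toLp 2 (u, 0) : L2Sum) (B (WithLp.toLp 2 (0, v))) := by
    intro B
    rw [inner_L2Sum, entry12_apply]
    change _ = inner ℂ u _ + inner ℂ (0 : L2) _
    rw [inner_zero_left, add_zero]
  have h3 := hR (WithLp.toLp 2 (u, 0)) (WithLp.toLp 2 (0, v))
  simp only [← h2] at h3
  refine tendsto_nhds_unique h3 ?_
  exact ((innerSL ℂ u).continuous.tendsto _).comp
    (((ContinuousLinearMap.apply ℂ L2 v).continuous.tendsto _).comp h1)

/-- The decomposition of `[ρ(βH_Δ)]₁₂` with explicit constants, for `h` so small that the potential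
is a perturbation of relative size at most `1/2` at all Matsubara frequencies. -/
theorem exists_decomposition {β μ M h : ℝ} {W : ℝ → ℝ} {ψ ψ' ψ'' : ℝ → ℂ} (hβ : 0 < β)
    (hW : IsPotential W) (hM : ∀ x, |W x| ≤ M) (hh : 0 < h)
    (hhM : h ^ 2 * M * (β / Real.pi) ≤ 1 / 2) (hψ : IsPeriodicH2 ψ ψ' ψ'') :
    ∃ R : L2Sum →L[ℂ] L2Sum,
      (∀ R' : L2Sum →L[ℂ] L2Sum,
        IsFunctionOf (HΔ h μ W fun x => -(h : ℂ) * ψ x) (fun t => rho (β * t)) R' ↔ R' = R) ∧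
      ∃ η₁ η₂ : L2 →L[ℂ] L2, IsPeriodicOp η₁ ∧ IsPeriodicOp η₂ ∧
        entry12 R = ((β * h / 4 : ℝ) : ℂ) •
          (mulOp ψ ∘L g0Op β h μ + g0Op β h μ ∘L mulOp ψ) + η₁ + η₂ ∧
        h1NormSq h η₁ ≤ ENNReal.ofReal ((4 * symbolConst β μ ^ 2 * matsubaraSum β / β) ^ 2 * h ^ 5 *
          cellNormSq ψ'') ∧
        h1NormSq h η₂ ≤ ENNReal.ofReal (4 / β ^ 2 * remainderConst β μ M * matsubaraSum β ^ 2 *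
          h ^ 5 * ((cellNormSq ψ + cellNormSq ψ') + (cellNormSq ψ + cellNormSq ψ') ^ 3)) := by
  have hA : IsSymmetricSurjective (HΔ h μ W fun x => -(h : ℂ) * ψ x) :=
    isSymmetricSurjective_HΔ hh.ne' μ (hW.isBoundedData (hψ.memLp_top.const_mul _))
  obtain ⟨R, hR, hlim⟩ := hA.exists_fermi hβ
  obtain ⟨η₂, hη₂p, hη₂, hsum⟩ := exists_remainder (μ := μ) hβ hW hM hh hhM hψ hA
  have hψp : IsPeriodicOp (mulOp ψ) := mulOp_periodic hψ.memLp_top hψ.periodic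
  refine ⟨R, hR, firstOrderError β h μ (mulOp ψ), η₂, firstOrderError_periodic hβ h μ hψp, hη₂p, ?_,
    h1NormSq_firstOrderError_le hβ hh μ hψ, hη₂⟩
  have h1 := (hasSum_sandwich hβ h μ (mulOp ψ)).add hsum
  refine (entry12_eq_of_hasSum hA hlim ?_).trans (congrArg (· + η₂) (add_comm _ _))
  refine h1.congr_fun fun n => ?_
  rw [sandwich_apply]
  push_cast
  have hβ' : (β : ℂ) ≠ 0 := by exact_mod_cast hβ.ne'
  match_scalars <;> field_simp <;> ring

end BCS

theorem theorem3 (β μ : ℝ) (hβ : 0 < β) (W : ℝ → ℝ) (hW : BCS.IsPotential W) :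
    ∃ C : ℝ, 0 < C ∧ ∃ h₀ : ℝ, 0 < h₀ ∧ ∀ h : ℝ, 0 < h → h < h₀ →
      ∀ ψ ψ' ψ'' : ℝ → ℂ, BCS.IsPeriodicH2 ψ ψ' ψ'' →
        ∃ R : BCS.L2Sum →L[ℂ] BCS.L2Sum,
          (∀ R' : BCS.L2Sum →L[ℂ] BCS.L2Sum,
            BCS.IsFunctionOf (BCS.HΔ h μ W fun x => -(h : ℂ) * ψ x)
              (fun t => BCS.rho (β * t)) R' ↔ R' = R) ∧
          ∃ η₁ η₂ : BCS.L2 →L[ℂ] BCS.L2,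
            BCS.IsPeriodicOp η₁ ∧ BCS.IsPeriodicOp η₂ ∧
            BCS.entry12 R =
              ((β * h / 4 : ℝ) : ℂ) •
                (BCS.mulOp ψ ∘L BCS.g0Op β h μ + BCS.g0Op β h μ ∘L BCS.mulOp ψ) + η₁ + η₂ ∧
            BCS.h1NormSq h η₁ ≤ ENNReal.ofReal (C * h ^ 5 *
              (BCS.cellNormSq ψ + BCS.cellNormSq ψ' + BCS.cellNormSq ψ'')) ∧
            BCS.h1NormSq h η₂ ≤ ENNReal.ofReal (C * h ^ 5 *
              ((BCS.cellNormSq ψ + BCS.cellNormSq ψ') +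
                (BCS.cellNormSq ψ + BCS.cellNormSq ψ') ^ 3)) := by
  obtain ⟨M, hM⟩ := hW.bounded
  have hM0 : 0 ≤ M := (abs_nonneg _).trans (hM 0)
  have hπ := Real.pi_pos
  set C₁ := (4 * BCS.symbolConst β μ ^ 2 * BCS.matsubaraSum β / β) ^ 2
  set C₂ := 4 / β ^ 2 * BCS.remainderConst β μ M * BCS.matsubaraSum β ^ 2
  have hC₁ : 0 ≤ C₁ := sq_nonneg _
  have hC₂ : 0 ≤ C₂ := by
    have := BCS.remainderConst_nonneg β μ M
    positivity
  -- below this threshold the potential is a small perturbation at every Matsubara frequency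
  set c := 2 * (M * (β / Real.pi)) + 1 with hc
  have hc0 : 1 ≤ c := by
    have : 0 ≤ M * (β / Real.pi) := by positivity
    linarith
  refine ⟨C₁ + C₂ + 1, by positivity, c⁻¹, by positivity, fun h hh hh₀ ψ ψ' ψ'' hψ => ?_⟩
  have hhM : h ^ 2 * M * (β / Real.pi) ≤ 1 / 2 := by
    have h1 : h * c < 1 := by
      rwa [← one_div, lt_div_iff₀ (by linarith)] at hh₀
    have h2 : h ≤ 1 := by nlinarith
    have h3 : 0 ≤ M * (β / Real.pi) := by positivity
    have h4 : h ^ 2 * (M * (β / Real.pi)) ≤ h * (M * (β / Real.pi)) := by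
      gcongr
      nlinarith
    have h5 : h * c = 2 * (h * (M * (β / Real.pi))) + h := by rw [hc]; ring
    rw [mul_assoc]
    linarith
  obtain ⟨R, hR, η₁, η₂, hp₁, hp₂, he, h₁, h₂⟩ :=
    BCS.exists_decomposition (μ := μ) hβ hW hM hh hhM hψ
  have hN := BCS.cellNormSq_nonneg ψ
  have hN' := BCS.cellNormSq_nonneg ψ'
  have hN'' := BCS.cellNormSq_nonneg ψ''
  refine ⟨R, hR, η₁, η₂, hp₁, hp₂, he, h₁.trans (ENNReal.ofReal_le_ofReal ?_),
    h₂.trans (ENNReal.ofReal_le_ofReal ?_)⟩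
  · gcongr
    · linarith
    · linarith
  · gcongr
    linarith
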